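/- For integers $k\ge 0$, $n\ge 0$ let $\triangle_k(n)$ be the number of ordered representations of $n$ as a sum of $k$ triangular numbers $\tfrac{a(a+1)}2$, $a\ge 0$; put $\triangle_k(y)=0$ if $y$ is not an integer. For integer $m$-tuples write $(k_1,\dots,k_m)\simeq(l_1,\dots,l_m)\ (n)$ if there are a permutation $\sigma\in S_m$ and signs $\varepsilon_i\in\{\pm1\}$ with $k_{\sigma(i)}\equiv\varepsilon_i l_i \pmod n$ for all $i$. Below, "$a\le k_i\le b \bmod n$" means that the residue of $k_i$ modulo $n$ in $\{0,\dots,n-1\}$ lies in $[a,b]$, empty sums are $0$, empty products are $1$ (in particular, $\prod_{l=1}^{-1}=1$), and no integer is congruent to $d/2$ modulo $d$ when $d$ is odd. Let $d\ge1$, $m\ge0$ and $x\ge0$ be integers. (1) If $d\mid 2m$, then $$\sum_{\substack{k_1l_1+\dots+k_ml_m=m^2+x\\ k_i,\,l_i\text{ odd positive}\\ (k_1,\dots,k_m)\simeq(1,3,\dots,2m-1)\ (2d)}}(-1)^{|\{i:\,d+1\le k_i\le 2d-1 \bmod 2d\}|}\prod_{\substack{1\le i\le m\\ k_i\equiv d\,(2d)}}k_i\prod_{\substack{1\le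 i<j\le m\\ k_i\equiv k_j\,(2d)}}\Big(\frac{k_j-k_i}2\Big)^2\prod_{\substack{1\le i<j\le m\\ k_i\equiv -k_j\,(2d)}}\Big(\frac{k_j+k_i}2\Big)^2$$ $$=(-1)^{\binom d2\binom{2m/d}2}\,d^{(2m-d)m/d}\,m!\prod_{l=1}^{(2m-d)/d}l!^{\,d}\;\triangle_{4m^2/d}\Big(\frac{x}{2d}\Big).$$ (2) If $d\mid 2m$ or $d\mid 2m+2$, then $$\sum_{\substack{k_1l_1+\dots+k_ml_m=\frac12m(m+1)+x\\ k_i\text{ positive},\ l_i\text{ odd positive}\\ (k_1,\dots,k_m)\simeq(1,2,\dots,m)\ (d)}}(-1)^{|\{i:\,(d+1)/2\le k_i\le d-1 \bmod d\}|}\prod_{\substack{1\le i\le m\\ k_i\equiv 0\,(d)}}2k_i^3\prod_{\substack{1\le i\le m\\ k_i\equiv d/2\,(d)}}2k_i\prod_{\substack{1\le i<j\le m\\ k_i\equiv k_j\,(d)}}(k_j-k_i)^2\prod_{\substack{1\le i<j\le m\\ k_i\equiv -k_j\,(d)}}(k_i+k_j)^2$$ $$=C\,d^{(2m+2-d)m/d}\,m!\;\triangle_{4m(m+1)/d}\Big(\frac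 xd\Big),$$ where $$C=(-1)^{\binom{d-1}2\binom{2m/d}2}\Big(\frac{2m}d\Big)!\prod_{l=1}^{(2m-d)/d}l!^{\,d}\quad\text{if } d\mid 2m,$$ $$C=(-1)^{\binom{d-1}2\binom{2(m+1)/d}2}\,\frac{1}{\big(\frac{2m+2-d}d\big)!}\prod_{l=1}^{(2m+2-d)/d}l!^{\,d}\quad\text{if } d\mid 2m+2$$ (if $d$ divides both $2m$ and $2m+2$, the identity holds with either expression for $C$). -/

import Mathlib

/-- `triangleCount k n` is the number of ordered representations of `n` as a sum of `k`
triangular numbers `a (a + 1) / 2`, `a ≥ 0`. -/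
noncomputable def triangleCount (k n : ℕ) : ℕ :=
  Set.ncard {a : Fin k → ℕ | ∑ i, a i * (a i + 1) / 2 = n}

/-- The set counted by `triangleCount` is finite. -/
theorem finite_triangleReps (k n : ℕ) :
    {a : Fin k → ℕ | ∑ i, a i * (a i + 1) / 2 = n}.Finite := by
  refine (Set.Finite.pi' (fun _ : Fin k => Set.finite_Iic n)).subset ?_
  intro a ha i
  have h1 : a i * (a i + 1) / 2 ≤ n := by
    rw [← (show ∑ i, a i * (a i + 1) / 2 = n from ha)]
    exact Finset.single_le_sum (f := fun i => a i * (a i + 1) / 2)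
      (fun _ _ => Nat.zero_le _) (Finset.mem_univ i)
  have h2 : a i ≤ a i * (a i + 1) / 2 := by
    rw [Nat.le_div_iff_mul_le (by norm_num)]
    rcases Nat.eq_zero_or_pos (a i) with h | h
    · simp [h]
    · exact Nat.mul_le_mul_left _ (by omega)
  exact h2.trans h1

/-- `(k₁, …, kₘ) ≃ (l₁, …, lₘ) mod n`: equality modulo `n` up to reordering and signs. -/
def SimeqMod {m : ℕ} (n : ℕ) (k l : Fin m → ℕ) : Prop :=
  ∃ (σ : Equiv.Perm (Fin m)) (ε : Fin m → ℤ),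
    (∀ i, ε i = 1 ∨ ε i = -1) ∧ ∀ i, (k (σ i) : ℤ) ≡ ε i * (l i : ℤ) [ZMOD (n : ℤ)]

/-- The pairs `(k, l)` of `m`-tuples of odd positive integers with `k₁ l₁ + ⋯ + kₘ lₘ = N` and
`(k₁, …, kₘ) ≃ (1, 3, …, 2m - 1) mod 2d`. -/
def oddSolutions (m d N : ℕ) : Set ((Fin m → ℕ) × (Fin m → ℕ)) :=
  {p | ∑ i, p.1 i * p.2 i = N ∧ (∀ i, Odd (p.1 i)) ∧ (∀ i, Odd (p.2 i)) ∧
    SimeqMod (2 * d) p.1 (fun i => 2 * (i : ℕ) + 1)}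

/-- The pairs `(k, l)` of `m`-tuples of positive integers, all `lᵢ` odd, with
`k₁ l₁ + ⋯ + kₘ lₘ = N` and `(k₁, …, kₘ) ≃ (1, 2, …, m) mod d`. -/
def positiveSolutions (m d N : ℕ) : Set ((Fin m → ℕ) × (Fin m → ℕ)) :=
  {p | ∑ i, p.1 i * p.2 i = N ∧ (∀ i, 0 < p.1 i) ∧ (∀ i, Odd (p.2 i)) ∧
    SimeqMod d p.1 (fun i => (i : ℕ) + 1)}

theorem finite_pairs (m N : ℕ) :
    {p : (Fin m → ℕ) × (Fin m → ℕ) |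
      ∑ i, p.1 i * p.2 i = N ∧ (∀ i, 0 < p.1 i) ∧ (∀ i, 0 < p.2 i)}.Finite := by
  have hF : {a : Fin m → ℕ | ∀ i, a i ∈ Set.Iic N}.Finite :=
    Set.Finite.pi' (fun _ : Fin m => Set.finite_Iic N)
  refine (hF.prod hF).subset ?_
  rintro ⟨k, l⟩ ⟨hs, hk, hl⟩
  have h1 : ∀ i, k i * l i ≤ N := fun i => by
    rw [← hs]
    exact Finset.single_le_sum (f := fun i => k i * l i)
      (fun _ _ => Nat.zero_le _) (Finset.mem_univ i)
  exact ⟨fun i => (Nat.le_mul_of_pos_right _ (hl i)).trans (h1 i),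
    fun i => (Nat.le_mul_of_pos_left _ (hk i)).trans (h1 i)⟩

theorem finite_oddSolutions (m d N : ℕ) : (oddSolutions m d N).Finite :=
  (finite_pairs m N).subset fun _ h => ⟨h.1, fun i => (h.2.1 i).pos, fun i => (h.2.2.1 i).pos⟩

theorem finite_positiveSolutions (m d N : ℕ) : (positiveSolutions m d N).Finite :=
  (finite_pairs m N).subset fun _ h => ⟨h.1, h.2.1, fun i => (h.2.2.1 i).pos⟩

/-- The summand of the first identity. The sign exponent counts the `i` for which the least
non-negative residue of `kᵢ` modulo `2d` lies in `[d + 1, 2d - 1]`. -/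
def oddWeight {m : ℕ} (d : ℕ) (k : Fin m → ℕ) : ℚ :=
  (-1) ^ (Finset.univ.filter fun i : Fin m =>
      d + 1 ≤ k i % (2 * d) ∧ k i % (2 * d) ≤ 2 * d - 1).card *
  (∏ i : Fin m with (k i : ℤ) ≡ d [ZMOD 2 * d], (k i : ℚ)) *
  (∏ p : Fin m × Fin m with p.1 < p.2 ∧ (k p.1 : ℤ) ≡ k p.2 [ZMOD 2 * d],
    (((k p.2 : ℚ) - k p.1) / 2) ^ 2) *
  (∏ p : Fin m × Fin m with p.1 < p.2 ∧ (k p.1 : ℤ) ≡ -k p.2 [ZMOD 2 * d],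
    (((k p.2 : ℚ) + k p.1) / 2) ^ 2)

/-- The summand of the second identity. The sign exponent counts the `i` for which the least
non-negative residue of `kᵢ` modulo `d` lies in `[(d + 1) / 2, d - 1]`. For odd `d` no integer
is congruent to `d / 2` modulo `d`, so that product is then empty. -/
def positiveWeight {m : ℕ} (d : ℕ) (k : Fin m → ℕ) : ℚ :=
  (-1) ^ (Finset.univ.filter fun i : Fin m =>
      ((d : ℚ) + 1) / 2 ≤ ((k i % d : ℕ) : ℚ) ∧ k i % d ≤ d - 1).card *
  (∏ i : Fin m with (k i : ℤ) ≡ 0 [ZMOD d], 2 * (k i : ℚ) ^ 3) *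
  (∏ i : Fin m with Even d ∧ (k i : ℤ) ≡ (d / 2 : ℕ) [ZMOD d], 2 * (k i : ℚ)) *
  (∏ p : Fin m × Fin m with p.1 < p.2 ∧ (k p.1 : ℤ) ≡ k p.2 [ZMOD d],
    ((k p.2 : ℚ) - k p.1) ^ 2) *
  (∏ p : Fin m × Fin m with p.1 < p.2 ∧ (k p.1 : ℤ) ≡ -k p.2 [ZMOD d],
    ((k p.1 : ℚ) + k p.2) ^ 2)

/-- The sum on the left of the first identity, with `k₁ l₁ + ⋯ + kₘ lₘ = m² + x`. -/
noncomputable def oddSum (m d x : ℕ) : ℚ :=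
  ∑ p ∈ (finite_oddSolutions m d (m ^ 2 + x)).toFinset, oddWeight d p.1

/-- The sum on the left of the second identity, with `k₁ l₁ + ⋯ + kₘ lₘ = m (m + 1) / 2 + x`. -/
noncomputable def positiveSum (m d x : ℕ) : ℚ :=
  ∑ p ∈ (finite_positiveSolutions m d (m * (m + 1) / 2 + x)).toFinset, positiveWeight d p.1

/-- `triangleCountDiv k x n` is the number of representations of `x / n` as a sum of `k`
triangular numbers, interpreted as zero when `n` does not divide `x`. -/
noncomputable def triangleCountDiv (k x n : ℕ) : ℕ :=
  if n ∣ x then triangleCount k (x / n) else 0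

/-!
The sums over the solutions `(k, l)` are coefficients of generating functions in `q`, and the
identities express that these series are products of theta functions. They are limits, at roots of
unity, of a product formula for determinants.

Let `w (x) = θ₁(x) / θ₄(x)` be the quotient of the two theta series
`∑ (-1)ⁿ⁺¹ q^(r n(n+1)) x^(2n+1)` and `∑ (-1)ⁿ q^(r n²) x^(2n)`, that is, up to scaling, the Jacobi
function `sn` in the multiplicative variable `x`. It satisfies a four-term relation (`w_four_term`), by which the
values `w (yⱼ / yₖ)` are given by an addition formula on an Edwards curve
(`exists_isAdditionFamily_w`). On such a curve there are analogues of the partial fraction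
identities for `∑ j, ∏ k ≠ j, (yⱼ - yₖ)⁻¹`, proved by Lagrange interpolation (`edwards_sum`); they
evaluate alternating sums over pairs `i, j` of expressions in `yᵢ / yⱼ` against the products
`∏ w (yₖ / yₗ)` over the remaining points (`sum_minors_even`, `sum_minors_odd`).

The Lambert series `∑ q^(k l) (x^k - x^(-k))`, over odd `l` and over odd or even `k`, are
expressed by `w`: the series over even `k` is, up to a constant factor, the logarithmic derivative
of `θ₄`, by Jacobi's triple product, and has an addition theorem (`T2_three_term`); the other is a
multiple of `w` itself (`S1_eq`). Consider now the determinants with entries `yᵢ^(±kⱼ)`, with a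
column of ones added when the `k` are even. Expansion along two columns at a time, with the
evaluations above, shows by induction that the sum of these determinants with weight `q^(∑ kⱼ lⱼ)`
is a constant times a power of `q`, a power of the generating function `psi` of triangular
numbers, and `∏ w (yᵢ / yⱼ)` over `i < j` (`genDet_odd`, `genDet_even`). For even `k` the series
are written with `q` in place of `q^2`, as all exponents `k l` are even.

For a primitive `2d`-th root of unity `ζ`, let the `i`-th point tend to `ζⁱ` as `ζⁱ t^⌊i/d⌋` with
`t → 1`. Both sides vanish, and are divided by `∏ (yⱼ / yᵢ - yᵢ / yⱼ)`. On the left, columns whose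
exponents are congruent modulo `2d` become confluent, and each such pair of columns contributes
the difference of its exponents; so the determinant vanishes to an order equal to the number of
such pairs. This number is smallest when the exponents are, up to order and signs, congruent to
the base exponents `1, 3, …, 2m - 1` or `2, 4, …, 2m`, which, as `d` divides `2m` or `2m + 2`, are
distributed over the classes as evenly as possible (`congPairs_lt_pairCount`). Hence exactly these
tuples survive, and they contribute a common constant times the weight of the identities
(`tendsto_zvander_div`). On the right, the values of `w (x) / (x⁻¹ - x)` at roots of unity multiply to
a power of `psi`, by the multiplication formula `prod_W` (`psi_pow_mul_pairProd_W`). This proves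
`gf_expWeight_eq`, an identity of generating functions up to a constant factor. The factor follows
from the lowest coefficient, to which only the permutations of the base exponents with all `l = 1`
contribute (`coeff_gf_expWeight`), and whose weight is an explicit product of factorials
(`expWeight_baseExp_odd`, `expWeight_baseExp_even`, `expWeight_baseExp_even'`).
-/

/-! ### Formal generating functions -/

open PowerSeries in
/-- The formal power series `∑ i, a i * X ^ e i`. -/
noncomputable def gf {ι A : Type*} [CommRing A] (e : ι → ℕ) (a : ι → A) : PowerSeries A :=
  PowerSeries.mk fun N => ∑ᶠ (i) (_ : e i = N), a i

/-- The exponents `e` take each bounded range of values only finitely often, so that every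
family of coefficients gives a well-defined power series. -/
def FinFib {ι : Type*} (e : ι → ℕ) : Prop := ∀ N, {i | e i ≤ N}.Finite

section gf
variable {ι κ A B : Type*} [CommRing A] [CommRing B]

theorem coeff_gf_eq_sum {e : ι → ℕ} (a : ι → A) {N : ℕ} (s : Finset ι)
    (hs : ∀ i, e i = N → i ∈ s) :
    PowerSeries.coeff N (gf e a) = ∑ i ∈ s with e i = N, a i := by
  rw [gf, PowerSeries.coeff_mk]
  apply finsum_mem_eq_sum_of_inter_support_eq
  ext i
  simp only [Set.mem_inter_iff, Set.mem_ofPred_eq, Function.mem_support, Finset.coe_filter]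
  constructor
  · rintro ⟨h, h'⟩; exact ⟨⟨hs i h, h⟩, h'⟩
  · rintro ⟨⟨_, h⟩, h'⟩; exact ⟨h, h'⟩

theorem coeff_gf_eq_coeff_sum {e : ι → ℕ} (a : ι → A) {N : ℕ} (s : Finset ι)
    (hs : ∀ i, e i = N → i ∈ s) :
    PowerSeries.coeff N (gf e a) =
      PowerSeries.coeff N (∑ i ∈ s, PowerSeries.monomial (e i) (a i)) := by
  rw [coeff_gf_eq_sum a s hs, map_sum, Finset.sum_filter]
  refine Finset.sum_congr rfl fun i _ => ?_
  rw [PowerSeries.coeff_monomial]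
  simp [eq_comm]

theorem FinFib.add {e : ι → ℕ} {e' : κ → ℕ} (h : FinFib e) (h' : FinFib e') :
    FinFib fun p : ι × κ => e p.1 + e' p.2 := fun N =>
  ((h N).prod (h' N)).subset fun p (hp : e p.1 + e' p.2 ≤ N) =>
    ⟨show e p.1 ≤ N by omega, show e' p.2 ≤ N by omega⟩

theorem FinFib.of_le {e e' : ι → ℕ} (h : FinFib e) (hle : ∀ i, e i ≤ e' i) : FinFib e' := fun N =>
  (h N).subset fun i (hi : _ ≤ N) => (hle i).trans hi

theorem FinFib.comp_injective {e : κ → ℕ} (h : FinFib e) {f : ι → κ} (hf : f.Injective) :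
    FinFib (e ∘ f) := fun N => (h N).preimage hf.injOn

theorem finFib_of_finite [Finite ι] (e : ι → ℕ) : FinFib e := fun _ => Set.toFinite _

theorem gf_mul {e : ι → ℕ} {e' : κ → ℕ} (h : FinFib e) (h' : FinFib e') (a : ι → A) (b : κ → A) :
    gf e a * gf e' b = gf (fun p : ι × κ => e p.1 + e' p.2) fun p => a p.1 * b p.2 := by
  ext N
  rw [coeff_gf_eq_coeff_sum _ ((h N).toFinset ×ˢ (h' N).toFinset), Finset.sum_product]
  · have : ∀ p ∈ Finset.HasAntidiagonal.antidiagonal N,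
        PowerSeries.coeff p.1 (gf e a) * PowerSeries.coeff p.2 (gf e' b) =
        PowerSeries.coeff p.1 (∑ i ∈ (h N).toFinset, PowerSeries.monomial (e i) (a i)) *
        PowerSeries.coeff p.2 (∑ i ∈ (h' N).toFinset, PowerSeries.monomial (e' i) (b i)) := by
      intro p hp
      replace hp := Finset.HasAntidiagonal.mem_antidiagonal.1 hp
      rw [coeff_gf_eq_coeff_sum, coeff_gf_eq_coeff_sum]
      · intro i hi; simp; omega
      · intro i hi; simp; omega
    rw [PowerSeries.coeff_mul, Finset.sum_congr rfl this, ← PowerSeries.coeff_mul,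
      Finset.sum_mul_sum]
    simp only [PowerSeries.monomial_mul_monomial]
  · rintro ⟨i, j⟩ hij
    simp only [Finset.mem_product, Set.Finite.mem_toFinset, Set.mem_ofPred_eq] at hij ⊢
    omega

theorem gf_equiv (φ : ι ≃ κ) {e : ι → ℕ} {e' : κ → ℕ} {a : ι → A} {b : κ → A}
    (he : ∀ i, e i = e' (φ i)) (ha : ∀ i, a i = b (φ i)) : gf e a = gf e' b := by
  ext N
  rw [gf, gf, PowerSeries.coeff_mk, PowerSeries.coeff_mk, ← finsum_comp_equiv φ]
  simp only [he, ha]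

theorem gf_sum {e : ι → ℕ} {e' : κ → ℕ} (h : FinFib e) (h' : FinFib e') (a : ι ⊕ κ → A) :
    gf (Sum.elim e e') a = gf e (fun i => a (Sum.inl i)) + gf e' fun i => a (Sum.inr i) := by
  ext N
  rw [map_add, coeff_gf_eq_sum a ((h N).toFinset.disjSum (h' N).toFinset),
    coeff_gf_eq_sum _ (h N).toFinset, coeff_gf_eq_sum _ (h' N).toFinset]
  · simp only [Finset.sum_filter, Finset.sum_disjSum, Sum.elim_inl, Sum.elim_inr]
    congr
  · intro i hi; simp [hi]
  · intro i hi; simp [hi]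
  · rintro (i | i) hi <;> simpa using (show _ = N from hi).le

theorem gf_finsetSum {S : Type*} {e : ι → ℕ} (h : FinFib e) (s : Finset S) (a : S → ι → A) :
    ∑ j ∈ s, gf e (a j) = gf e fun i => ∑ j ∈ s, a j i := by
  ext N
  have : ∀ i, e i = N → i ∈ (h N).toFinset := fun i hi => by simp [hi]
  rw [map_sum, coeff_gf_eq_sum _ _ this, Finset.sum_comm]
  exact Finset.sum_congr rfl fun j _ => coeff_gf_eq_sum _ _ this

theorem gf_add {e : ι → ℕ} (h : FinFib e) (a b : ι → A) :
    gf e a + gf e b = gf e fun i => a i + b i := by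
  ext N
  have : ∀ i, e i = N → i ∈ (h N).toFinset := fun i hi => by simp [hi]
  rw [map_add, coeff_gf_eq_sum _ _ this, coeff_gf_eq_sum _ _ this, coeff_gf_eq_sum _ _ this,
    Finset.sum_add_distrib]

theorem gf_zero (e : ι → ℕ) : gf e (fun _ => (0 : A)) = 0 := by
  ext N; simp [gf]

theorem C_mul_gf {e : ι → ℕ} (h : FinFib e) (c : A) (a : ι → A) :
    PowerSeries.C c * gf e a = gf e fun i => c * a i := by
  ext N
  have : ∀ i, e i = N → i ∈ (h N).toFinset := fun i hi => by simp [hi]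
  rw [PowerSeries.coeff_C_mul, coeff_gf_eq_sum _ _ this, coeff_gf_eq_sum _ _ this, Finset.mul_sum]

theorem gf_neg {e : ι → ℕ} (h : FinFib e) (a : ι → A) : gf e (fun i => -a i) = -gf e a := by
  rw [eq_neg_iff_add_eq_zero, gf_add h]; simp [gf_zero]

theorem gf_sub {e : ι → ℕ} (h : FinFib e) (a b : ι → A) :
    gf e a - gf e b = gf e fun i => a i - b i := by
  rw [sub_eq_add_neg, ← gf_neg h, gf_add h]; simp [sub_eq_add_neg]

theorem gf_unique [Unique ι] (e : ι → ℕ) (a : ι → A) :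
    gf e a = PowerSeries.monomial (e default) (a default) := by
  ext N
  rw [coeff_gf_eq_coeff_sum a Finset.univ fun i _ => Finset.mem_univ i]; simp

theorem X_pow_mul_gf {e : ι → ℕ} (h : FinFib e) (k : ℕ) (a : ι → A) :
    PowerSeries.X ^ k * gf e a = gf (fun i => k + e i) a := by
  have := gf_mul (finFib_of_finite fun _ : Unit => k) h (fun _ => (1 : A)) a
  rw [gf_unique] at this
  rw [PowerSeries.X_pow_eq, this]
  exact gf_equiv (Equiv.punitProd ι) (fun _ => rfl) fun _ => by simp

theorem map_gf {e : ι → ℕ} (h : FinFib e) (f : A →+* B) (a : ι → A) :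
    PowerSeries.map f (gf e a) = gf e fun i => f (a i) := by
  ext N
  have : ∀ i, e i = N → i ∈ (h N).toFinset := fun i hi => by simp [hi]
  rw [PowerSeries.coeff_map, coeff_gf_eq_sum _ _ this, coeff_gf_eq_sum _ _ this, map_sum]

/-- The sum over an index type splits along a predicate. -/
theorem gf_split {e : ι → ℕ} (h : FinFib e) (p : ι → Prop) (a : ι → A) :
    gf e a = gf (fun i : {i // p i} => e i) (fun i => a i) +
      gf (fun i : {i // ¬p i} => e i) fun i => a i := by
  classical
  have h1 : FinFib fun i : {i // p i} => e i := h.comp_injective Subtype.val_injective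
  have h2 : FinFib fun i : {i // ¬p i} => e i := h.comp_injective Subtype.val_injective
  refine Eq.trans ?_ (gf_sum h1 h2 fun s => a (Equiv.sumCompl p s))
  refine (gf_equiv (Equiv.sumCompl p) ?_ fun _ => rfl).symm
  rintro (i | i) <;> rfl

end gf

/-! ### Theta series and their bilinear relations -/

section theta
variable {A : Type*} [CommRing A]

theorem finFib_int_of_natAbs_le {e : ℤ → ℕ} (h : ∀ n, n.natAbs ≤ e n + 1) : FinFib e := fun N =>
  (Set.finite_Icc (-(N + 1 : ℤ)) (N + 1)).subset fun n (hn : e n ≤ N) => by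
    have := h n
    rw [Set.mem_Icc]; omega

/-- The exponent `n ^ 2` scaled by `r`. -/
def eSq (r : ℕ) (n : ℤ) : ℕ := r * (n ^ 2).toNat

/-- The exponent `n (n + 1)` scaled by `r`. -/
def ePr (r : ℕ) (n : ℤ) : ℕ := r * (n * (n + 1)).toNat

theorem eSq_cast (r : ℕ) (n : ℤ) : (eSq r n : ℤ) = r * n ^ 2 := by
  rw [eSq]; push_cast; rw [Int.toNat_of_nonneg (sq_nonneg n)]

theorem ePr_cast (r : ℕ) (n : ℤ) : (ePr r n : ℤ) = r * (n * (n + 1)) := by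
  have : 0 ≤ n * (n + 1) := by
    rcases le_or_gt 0 n with h | h
    · positivity
    · nlinarith
  rw [ePr]; push_cast; rw [Int.toNat_of_nonneg this]

theorem finFib_eSq {r : ℕ} (hr : 0 < r) : FinFib (eSq r) := finFib_int_of_natAbs_le fun n => by
  have h := eSq_cast r n
  have hr' : (1 : ℤ) ≤ r := by exact_mod_cast hr
  zify
  rw [h]
  rcases abs_cases n with ⟨h1, h2⟩ | ⟨h1, h2⟩ <;> rw [h1] <;> nlinarith [sq_nonneg n]

theorem finFib_ePr {r : ℕ} (hr : 0 < r) : FinFib (ePr r) := finFib_int_of_natAbs_le fun n => by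
  have h := ePr_cast r n
  have hr' : (1 : ℤ) ≤ r := by exact_mod_cast hr
  have h0 : 0 ≤ n * (n + 1) := by
    rcases le_or_gt 0 n with h | h
    · positivity
    · nlinarith
  zify
  rw [h]
  rcases abs_cases n with ⟨h1, h2⟩ | ⟨h1, h2⟩ <;> rw [h1] <;> nlinarith [sq_nonneg n]

/-- The even theta series `∑ (-1)ⁿ q^(r n²) x^(2n)`, with coefficients weighted by `c (2n)`. -/
noncomputable def th4w (c : ℤ → A) (r : ℕ) (x : Aˣ) : PowerSeries A :=
  gf (eSq r) fun n => c (2 * n) * (((-1) ^ n * x ^ (2 * n) : Aˣ) : A)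

/-- The odd theta series `∑ (-1)ⁿ⁺¹ q^(r n(n+1)) x^(2n+1)`, with coefficients weighted by
`c (2n+1)`. -/
noncomputable def th1w (c : ℤ → A) (r : ℕ) (x : Aˣ) : PowerSeries A :=
  gf (ePr r) fun n => c (2 * n + 1) * (((-1) ^ (n + 1) * x ^ (2 * n + 1) : Aˣ) : A)

/-- The series `∑ q^(2 r n²) x^(4n)`, with coefficients weighted by `c (4n)`. -/
noncomputable def F0w (c : ℤ → A) (r : ℕ) (x : Aˣ) : PowerSeries A :=
  gf (eSq (2 * r)) fun n => c (4 * n) * ((x ^ (4 * n) : Aˣ) : A)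

/-- The series `∑ q^(2 r n(n+1)) x^(4n+2)`, with coefficients weighted by `c (4n+2)`. -/
noncomputable def F1w (c : ℤ → A) (r : ℕ) (x : Aˣ) : PowerSeries A :=
  gf (ePr (2 * r)) fun n => c (4 * n + 2) * ((x ^ (4 * n + 2) : Aˣ) : A)

/-- The theta series `∑ (-1)ⁿ q^(r n²) x^(2n)`. -/
noncomputable abbrev th4 (r : ℕ) (x : Aˣ) : PowerSeries A := th4w (fun _ => 1) r x

/-- The theta series `∑ (-1)ⁿ⁺¹ q^(r n(n+1)) x^(2n+1)`. -/
noncomputable abbrev th1 (r : ℕ) (x : Aˣ) : PowerSeries A := th1w (fun _ => 1) r x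

/-- The series `∑ q^(2 r n²) x^(4n)`. -/
noncomputable abbrev F0 (r : ℕ) (x : Aˣ) : PowerSeries A := F0w (fun _ => 1) r x

/-- The series `∑ q^(2 r n(n+1)) x^(4n+2)`. -/
noncomputable abbrev F1 (r : ℕ) (x : Aˣ) : PowerSeries A := F1w (fun _ => 1) r x

/-- The image of `th4` under `x d/dx`. -/
noncomputable abbrev dth4 (r : ℕ) (x : Aˣ) : PowerSeries A := th4w (fun n => (n : A)) r x

/-- The image of `th1` under `x d/dx`. -/
noncomputable abbrev dth1 (r : ℕ) (x : Aˣ) : PowerSeries A := th1w (fun n => (n : A)) r x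

/-- Pairs of integers with even sum are `(c + d, c - d)`. -/
def evenPairEquiv : ℤ × ℤ ≃ {p : ℤ × ℤ // Even (p.1 + p.2)} where
  toFun p := ⟨(p.1 + p.2, p.1 - p.2), ⟨p.1, by ring⟩⟩
  invFun p := ((p.1.1 + p.1.2) / 2, (p.1.1 - p.1.2) / 2)
  left_inv p := by ext <;> simp <;> omega
  right_inv := by
    rintro ⟨⟨a, b⟩, ⟨c, hc⟩⟩
    ext <;> simp at hc ⊢ <;> omega

/-- Pairs of integers with odd sum are `(c + d + 1, c - d)`. -/
def oddPairEquiv : ℤ × ℤ ≃ {p : ℤ × ℤ // ¬Even (p.1 + p.2)} where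
  toFun p := ⟨(p.1 + p.2 + 1, p.1 - p.2), by
    rw [Int.not_even_iff_odd]; exact ⟨p.1, by ring⟩⟩
  invFun p := ((p.1.1 + p.1.2 - 1) / 2, (p.1.1 - p.1.2 - 1) / 2)
  left_inv p := by ext <;> simp <;> omega
  right_inv := by
    rintro ⟨⟨a, b⟩, hab⟩
    obtain ⟨c, hc⟩ := Int.not_even_iff_odd.1 hab
    ext <;> simp at hc ⊢ <;> omega

theorem gf_int_parity {e : ℤ × ℤ → ℕ} (h : FinFib e) (a : ℤ × ℤ → A) :
    gf e a = gf (fun p : ℤ × ℤ => e (p.1 + p.2, p.1 - p.2)) (fun p => a (p.1 + p.2, p.1 - p.2)) +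
      gf (fun p : ℤ × ℤ => e (p.1 + p.2 + 1, p.1 - p.2))
        (fun p => a (p.1 + p.2 + 1, p.1 - p.2)) := by
  rw [gf_split h (fun p => Even (p.1 + p.2))]
  congr 1
  · exact (gf_equiv evenPairEquiv (fun _ => rfl) fun _ => rfl).symm
  · exact (gf_equiv oddPairEquiv (fun _ => rfl) fun _ => rfl).symm

theorem neg_one_zpow_two_mul (n : ℤ) : (-1 : Aˣ) ^ (2 * n) = 1 := by
  rw [zpow_mul]; simp

/-- The parallelogram law behind the bilinear relations: a double sum over `(a, b)` of a function
of `(a + b, a - b)`, split by parity. -/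
theorem gf_eSq_add_eSq {r : ℕ} (hr : 0 < r) (h : ℤ → ℤ → A) :
    gf (fun p : ℤ × ℤ => eSq r p.1 + eSq r p.2) (fun p => h (p.1 + p.2) (p.1 - p.2)) =
      gf (fun p : ℤ × ℤ => eSq (2 * r) p.1 + eSq (2 * r) p.2) (fun p => h (2 * p.1) (2 * p.2)) +
      PowerSeries.X ^ r * gf (fun p : ℤ × ℤ => ePr (2 * r) p.1 + ePr (2 * r) p.2)
        (fun p => h (2 * p.1 + 1) (2 * p.2 + 1)) := by
  rw [gf_int_parity ((finFib_eSq hr).add (finFib_eSq hr)), X_pow_mul_gf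
    ((finFib_ePr (by omega)).add (finFib_ePr (by omega)))]
  congr 1
  · refine gf_equiv (Equiv.refl _) (fun p => ?_) fun p => ?_
    · zify; simp only [eSq_cast, Equiv.refl_apply]; push_cast; ring
    · simp only [Equiv.refl_apply]; congr 1 <;> ring
  · refine gf_equiv (Equiv.refl _) (fun p => ?_) fun p => ?_
    · zify; simp only [eSq_cast, ePr_cast, Equiv.refl_apply]; push_cast; ring
    · simp only [Equiv.refl_apply]; congr 1 <;> ring

/-- The parallelogram law for the exponents `n (n + 1)`. -/
theorem gf_ePr_add_ePr {r : ℕ} (hr : 0 < r) (h : ℤ → ℤ → A) :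
    gf (fun p : ℤ × ℤ => ePr r p.1 + ePr r p.2) (fun p => h (p.1 + p.2 + 1) (p.1 - p.2)) =
      gf (fun p : ℤ × ℤ => ePr (2 * r) p.1 + eSq (2 * r) p.2)
        (fun p => h (2 * p.1 + 1) (2 * p.2)) +
      gf (fun p : ℤ × ℤ => eSq (2 * r) p.1 + ePr (2 * r) p.2)
        (fun p => h (2 * p.1) (2 * p.2 + 1)) := by
  rw [gf_int_parity ((finFib_ePr hr).add (finFib_ePr hr))]
  congr 1
  · refine gf_equiv (Equiv.refl _) (fun p => ?_) fun p => ?_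
    · zify; simp only [eSq_cast, ePr_cast, Equiv.refl_apply]; push_cast; ring
    · simp only [Equiv.refl_apply]; congr 1 <;> ring
  · refine gf_equiv ((Equiv.addRight 1).prodCongr (Equiv.refl _)) (fun p => ?_) fun p => ?_
    · zify; simp [eSq_cast, ePr_cast]; ring
    · simp; congr 1 <;> ring

/-- The bilinear relation between `th4`, `F0` and `F1`, with additive weights. Constant weights give
the product formula `th4_mul`, the weight `c n = n` gives its image under `x d/dx`. -/
theorem th4w_mul_add {r : ℕ} (hr : 0 < r) (c c' : ℤ → A) (hc : ∀ a b, c a + c b = c' (a + b))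
    (x y : Aˣ) :
    th4w c r (x * y) * th4 r (x / y) + th4 r (x * y) * th4w c r (x / y) =
      F0w c' r x * F0 r y - PowerSeries.X ^ r * (F1w c' r x * F1 r y) := by
  have h4 := finFib_eSq hr
  have h0 := finFib_eSq (r := 2 * r) (by omega)
  have h1 := finFib_ePr (r := 2 * r) (by omega)
  simp only [th4, F0, F1, th4w, F0w, F1w]
  rw [gf_mul h4 h4, gf_mul h4 h4, gf_mul h0 h0,
    gf_mul h1 h1, gf_add (h4.add h4)]
  have key := gf_eSq_add_eSq hr fun m n : ℤ =>
    c' (2 * m) * (((-1) ^ m * x ^ (2 * m) * y ^ (2 * n) : Aˣ) : A)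
  have e1 : (fun p : ℤ × ℤ => c' (2 * (p.1 + p.2)) *
      (((-1) ^ (p.1 + p.2) * x ^ (2 * (p.1 + p.2)) * y ^ (2 * (p.1 - p.2)) : Aˣ) : A)) =
      fun p => c (2 * p.1) * (((-1) ^ p.1 * (x * y) ^ (2 * p.1) : Aˣ) : A) *
          (1 * (((-1) ^ p.2 * (x / y) ^ (2 * p.2) : Aˣ) : A)) +
        1 * (((-1) ^ p.1 * (x * y) ^ (2 * p.1) : Aˣ) : A) *
          (c (2 * p.2) * (((-1) ^ p.2 * (x / y) ^ (2 * p.2) : Aˣ) : A)) := by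
    funext p
    have : ((-1) ^ (p.1 + p.2) * x ^ (2 * (p.1 + p.2)) * y ^ (2 * (p.1 - p.2)) : Aˣ) =
        ((-1) ^ p.1 * (x * y) ^ (2 * p.1)) * ((-1) ^ p.2 * (x / y) ^ (2 * p.2)) := by
      simp only [mul_zpow, inv_zpow, mul_add, mul_sub, zpow_add, zpow_sub, div_eq_mul_inv]
      simp only [mul_comm, mul_left_comm, mul_assoc]
    rw [this, mul_add, ← hc]; push_cast; ring
  rw [e1] at key
  rw [key]
  rw [sub_eq_add_neg, ← mul_neg, ← gf_neg (h1.add h1)]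
  congr 3
  · funext p
    rw [neg_one_zpow_two_mul]; push_cast; ring_nf
  · funext p
    rw [zpow_add, neg_one_zpow_two_mul, zpow_one, one_mul]; push_cast; ring_nf

/-- The bilinear relation between `th1`, `F0` and `F1`, with additive weights. -/
theorem th1w_mul_add {r : ℕ} (hr : 0 < r) (c c' : ℤ → A) (hc : ∀ a b, c a + c b = c' (a + b))
    (x y : Aˣ) :
    th1w c r (x * y) * th1 r (x / y) + th1 r (x * y) * th1w c r (x / y) =
      F1w c' r x * F0 r y - F0w c' r x * F1 r y := by
  have h4 := finFib_ePr hr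
  have h0 := finFib_eSq (r := 2 * r) (by omega)
  have h1 := finFib_ePr (r := 2 * r) (by omega)
  simp only [th1, F0, F1, th1w, F0w, F1w]
  rw [gf_mul h4 h4, gf_mul h4 h4, gf_mul h0 h1,
    gf_mul h1 h0, gf_add (h4.add h4)]
  have key := gf_ePr_add_ePr hr fun m n : ℤ =>
    c' (2 * m) * (((-1) ^ (m + 1) * x ^ (2 * m) * y ^ (2 * n) : Aˣ) : A)
  have e1 : (fun p : ℤ × ℤ => c' (2 * (p.1 + p.2 + 1)) *
      (((-1) ^ (p.1 + p.2 + 1 + 1) * x ^ (2 * (p.1 + p.2 + 1)) * y ^ (2 * (p.1 - p.2)) : Aˣ) : A)) =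
      fun p => c (2 * p.1 + 1) * (((-1) ^ (p.1 + 1) * (x * y) ^ (2 * p.1 + 1) : Aˣ) : A) *
          (1 * (((-1) ^ (p.2 + 1) * (x / y) ^ (2 * p.2 + 1) : Aˣ) : A)) +
        1 * (((-1) ^ (p.1 + 1) * (x * y) ^ (2 * p.1 + 1) : Aˣ) : A) *
          (c (2 * p.2 + 1) * (((-1) ^ (p.2 + 1) * (x / y) ^ (2 * p.2 + 1) : Aˣ) : A)) := by
    funext p
    have : ((-1) ^ (p.1 + p.2 + 1 + 1) * x ^ (2 * (p.1 + p.2 + 1)) * y ^ (2 * (p.1 - p.2)) : Aˣ) =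
        ((-1) ^ (p.1 + 1) * (x * y) ^ (2 * p.1 + 1)) *
          ((-1) ^ (p.2 + 1) * (x / y) ^ (2 * p.2 + 1)) := by
      rw [show p.1 + p.2 + 1 + 1 = (p.1 + 1) + (p.2 + 1) by ring,
        show 2 * (p.1 + p.2 + 1) = (2 * p.1 + 1) + (2 * p.2 + 1) by ring,
        show 2 * (p.1 - p.2) = (2 * p.1 + 1) - (2 * p.2 + 1) by ring]
      simp only [mul_zpow, inv_zpow, zpow_add _ (2 * p.1 + 1), zpow_add _ (p.1 + 1), zpow_sub,
        div_eq_mul_inv]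
      simp only [mul_comm, mul_left_comm, mul_assoc]
    rw [this, show 2 * (p.1 + p.2 + 1) = (2 * p.1 + 1) + (2 * p.2 + 1) by ring, ← hc]
    push_cast; ring
  rw [e1] at key
  rw [key, sub_eq_add_neg, ← gf_neg (h0.add h1)]
  congr 2
  · funext p
    rw [show 2 * p.1 + 1 + 1 = 2 * (p.1 + 1) by ring, neg_one_zpow_two_mul]; push_cast; ring_nf
  · funext p
    rw [zpow_add, neg_one_zpow_two_mul, zpow_one, one_mul]; push_cast; ring_nf

end theta

section thetaField

theorem constantCoeff_gf_zero {ι A : Type*} [CommRing A] {e : ι → ℕ} (a : ι → A) (s : Finset ι)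
    (hs : ∀ i, e i = 0 ↔ i ∈ s) : PowerSeries.constantCoeff (gf e a) = ∑ i ∈ s, a i := by
  rw [← PowerSeries.coeff_zero_eq_constantCoeff_apply, coeff_gf_eq_sum a s fun i h => (hs i).1 h,
    Finset.filter_true_of_mem fun i h => (hs i).2 h]

theorem eSq_eq_zero {r : ℕ} (hr : 0 < r) (n : ℤ) : eSq r n = 0 ↔ n = 0 := by
  have h := eSq_cast r n
  have hr' : (r : ℤ) ≠ 0 := by exact_mod_cast hr.ne'
  rw [← Int.natCast_eq_zero, h]; simp [hr.ne']

theorem ePr_eq_zero {r : ℕ} (hr : 0 < r) (n : ℤ) : ePr r n = 0 ↔ n = 0 ∨ n = -1 := by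
  have h := ePr_cast r n
  have hr' : (r : ℤ) ≠ 0 := by exact_mod_cast hr.ne'
  rw [← Int.natCast_eq_zero, h]; simp [hr.ne']; omega

variable {r : ℕ}

theorem constantCoeff_th4 {A : Type*} [CommRing A] (hr : 0 < r) (x : Aˣ) :
    PowerSeries.constantCoeff (th4 r x) = 1 := by
  rw [th4, th4w, constantCoeff_gf_zero _ {0} (by simp [eSq_eq_zero hr])]; simp

theorem constantCoeff_th1 {A : Type*} [CommRing A] (hr : 0 < r) (x : Aˣ) :
    PowerSeries.constantCoeff (th1 r x) = ((x⁻¹ : Aˣ) : A) - x := by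
  rw [th1, th1w, constantCoeff_gf_zero _ {0, -1} (by simp [ePr_eq_zero hr]),
    Finset.sum_pair (by norm_num)]
  norm_num; ring

theorem neg_one_zpow_neg {A : Type*} [CommRing A] (n : ℤ) : (-1 : Aˣ) ^ (-n) = (-1) ^ n := by
  rw [zpow_neg, ← inv_zpow, inv_neg, inv_one]

theorem th1_inv {A : Type*} [CommRing A] (hr : 0 < r) (x : Aˣ) : th1 r x⁻¹ = -th1 r x := by
  simp only [th1, th1w]
  rw [← gf_neg (finFib_ePr hr)]
  refine gf_equiv ((Equiv.neg ℤ).trans (Equiv.subRight 1)) (fun n => ?_) fun n => ?_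
  · zify; simp [ePr_cast]; ring_nf
  · simp only [Equiv.trans_apply, Equiv.neg_apply, Equiv.subRight_apply]
    rw [show -n - 1 + 1 = -n by ring, show 2 * (-n - 1) + 1 = -(2 * n + 1) by ring,
      neg_one_zpow_neg, zpow_add _ n]
    simp

theorem th4_inv {A : Type*} [CommRing A] (x : Aˣ) : th4 r x⁻¹ = th4 r x := by
  simp only [th4, th4w]
  refine gf_equiv (Equiv.neg ℤ) (fun n => ?_) fun n => ?_
  · zify; simp [eSq_cast]
  · simp only [Equiv.neg_apply]
    rw [neg_one_zpow_neg, mul_neg, zpow_neg, ← inv_zpow]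

theorem th1_neg {A : Type*} [CommRing A] (hr : 0 < r) (x : Aˣ) : th1 r (-x) = -th1 r x := by
  simp only [th1, th1w]
  rw [← gf_neg (finFib_ePr hr)]
  congr 1; funext n
  rw [Odd.neg_zpow (odd_two_mul_add_one n)]; simp

theorem th4_neg {A : Type*} [CommRing A] (x : Aˣ) : th4 r (-x) = th4 r x := by
  simp only [th4, th4w]
  congr 1; funext n
  rw [Even.neg_zpow (even_two_mul n)]

theorem two_powerSeries_ne_zero {A : Type*} [CommRing A] [CharZero A] :
    (2 : PowerSeries A) ≠ 0 := fun h => by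
  have h' := congrArg PowerSeries.constantCoeff h
  rw [map_ofNat, map_zero] at h'
  exact two_ne_zero h'

theorem th1_one {A : Type*} [CommRing A] [IsDomain A] [CharZero A] (hr : 0 < r) :
    th1 r (1 : Aˣ) = 0 := by
  have h := th1_inv hr (1 : Aˣ)
  rw [inv_one] at h
  have h2 : 2 * th1 r (1 : Aˣ) = 0 := by linear_combination h
  exact (mul_eq_zero.1 h2).resolve_left two_powerSeries_ne_zero

theorem th4_mul {A : Type*} [CommRing A] [IsDomain A] [CharZero A] (hr : 0 < r) (x y : Aˣ) :
    th4 r (x * y) * th4 r (x / y) =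
      F0 r x * F0 r y - PowerSeries.X ^ r * (F1 r x * F1 r y) := by
  have h := th4w_mul_add hr (fun _ => 1) (fun _ => 2) (fun _ _ => one_add_one_eq_two) x y
  have h0 : F0w (fun _ => (2 : A)) r x = 2 * F0 r x := by
    simp only [F0, F0w]
    rw [show (2 : PowerSeries A) = PowerSeries.C 2 from (map_ofNat PowerSeries.C 2).symm,
      C_mul_gf (finFib_eSq (by omega))]
    simp
  have h1 : F1w (fun _ => (2 : A)) r x = 2 * F1 r x := by
    simp only [F1, F1w]
    rw [show (2 : PowerSeries A) = PowerSeries.C 2 from (map_ofNat PowerSeries.C 2).symm,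
      C_mul_gf (finFib_ePr (by omega))]
    simp
  rw [h0, h1] at h
  refine mul_left_cancel₀ two_powerSeries_ne_zero ?_
  linear_combination h

theorem th1_mul {A : Type*} [CommRing A] [IsDomain A] [CharZero A] (hr : 0 < r) (x y : Aˣ) :
    th1 r (x * y) * th1 r (x / y) = F1 r x * F0 r y - F0 r x * F1 r y := by
  have h := th1w_mul_add hr (fun _ => 1) (fun _ => 2) (fun _ _ => one_add_one_eq_two) x y
  have h0 : F0w (fun _ => (2 : A)) r x = 2 * F0 r x := by
    simp only [F0, F0w]
    rw [show (2 : PowerSeries A) = PowerSeries.C 2 from (map_ofNat PowerSeries.C 2).symm,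
      C_mul_gf (finFib_eSq (by omega))]
    simp
  have h1 : F1w (fun _ => (2 : A)) r x = 2 * F1 r x := by
    simp only [F1, F1w]
    rw [show (2 : PowerSeries A) = PowerSeries.C 2 from (map_ofNat PowerSeries.C 2).symm,
      C_mul_gf (finFib_ePr (by omega))]
    simp
  rw [h0, h1] at h
  refine mul_left_cancel₀ two_powerSeries_ne_zero ?_
  linear_combination h

/-! ### The theta quotient and its addition theorems -/

/-- The quotient `th1 / th4`; up to scaling this is the Jacobi function `sn`, written
multiplicatively. -/
noncomputable def w (r : ℕ) (x : ℂˣ) : PowerSeries ℂ := th1 r x * (th4 r x)⁻¹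

theorem th4_mul_inv (hr : 0 < r) (x : ℂˣ) : th4 r x * (th4 r x)⁻¹ = 1 :=
  PowerSeries.mul_inv_cancel _ (by rw [constantCoeff_th4 hr]; exact one_ne_zero)

theorem th4_ne_zero (hr : 0 < r) (x : ℂˣ) : th4 r x ≠ 0 :=
  left_ne_zero_of_mul_eq_one (th4_mul_inv hr x)

theorem w_mul_th4 (hr : 0 < r) (x : ℂˣ) : w r x * th4 r x = th1 r x := by
  rw [w, mul_assoc, mul_comm _ (th4 r x), th4_mul_inv hr, mul_one]

theorem w_neg (hr : 0 < r) (x : ℂˣ) : w r (-x) = -w r x := by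
  rw [w, w, th1_neg hr, th4_neg, neg_mul]

theorem constantCoeff_w (hr : 0 < r) (x : ℂˣ) :
    PowerSeries.constantCoeff (w r x) = ((x⁻¹ : ℂˣ) : ℂ) - x := by
  rw [w, map_mul, PowerSeries.constantCoeff_inv, constantCoeff_th4 hr, constantCoeff_th1 hr]; simp

theorem w_ne_zero (hr : 0 < r) {x : ℂˣ} (hx : x ^ 2 ≠ 1) : w r x ≠ 0 := by
  intro h
  have := constantCoeff_w hr x
  rw [h, map_zero] at this
  apply hx
  ext
  have hx0 := x.ne_zero
  rw [Units.val_inv_eq_inv_val] at this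
  field_simp at this
  push_cast; linear_combination this

/-- The product `w (x y) w (x / y)` is a difference of values of `F1 / F0`, as for the hyperbolic
tangent. -/
theorem w_mul_w (hr : 0 < r) (x y : ℂˣ) :
    w r (x * y) * w r (x / y) * (F0 r x * F0 r y - PowerSeries.X ^ r * (F1 r x * F1 r y)) =
      F1 r x * F0 r y - F0 r x * F1 r y := by
  rw [← th4_mul hr, ← th1_mul hr, ← w_mul_th4 hr, ← w_mul_th4 hr]; ring

theorem exists_sq_eq_unit (x : ℂˣ) : ∃ y : ℂˣ, y ^ 2 = x := by
  obtain ⟨y, hy⟩ := IsAlgClosed.exists_pow_nat_eq (x : ℂ) (n := 2) (by norm_num)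
  have hy0 : y ≠ 0 := by
    rintro rfl; exact x.ne_zero (by rw [← hy]; simp)
  exact ⟨Units.mk0 y hy0, by ext; simpa using hy⟩

/-- The four-term relation: the Pfaffian of the `4 × 4` matrix `w (xᵢ / xⱼ)` is `q ^ r` times the
product of its entries above the diagonal. -/
theorem w_four_term (hr : 0 < r) (x₁ x₂ x₃ x₄ : ℂˣ) :
    w r (x₁ / x₂) * w r (x₃ / x₄) - w r (x₁ / x₃) * w r (x₂ / x₄) + w r (x₁ / x₄) * w r (x₂ / x₃) =
      PowerSeries.X ^ r * (w r (x₁ / x₂) * w r (x₃ / x₄) * (w r (x₁ / x₃) * w r (x₂ / x₄)) *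
        (w r (x₁ / x₄) * w r (x₂ / x₃))) := by
  obtain ⟨y₁, rfl⟩ := exists_sq_eq_unit x₁
  obtain ⟨y₂, rfl⟩ := exists_sq_eq_unit x₂
  obtain ⟨y₃, rfl⟩ := exists_sq_eq_unit x₃
  obtain ⟨y₄, rfl⟩ := exists_sq_eq_unit x₄
  -- Each product of two values in the relation has the form `w (x y) w (x / y)` for two of `a, b,
  -- c`.
  set a := y₁ * y₃ / (y₂ * y₄) with ha
  set b := y₁ * y₄ / (y₂ * y₃) with hb
  set c := y₁ * y₂ / (y₃ * y₄) with hc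
  have key : ∀ z₁ z₂ z₃ z₄ : ℂˣ, z₁ * z₃ / (z₂ * z₄) * (z₁ * z₄ / (z₂ * z₃)) = z₁ ^ 2 / z₂ ^ 2 ∧
      z₁ * z₃ / (z₂ * z₄) / (z₁ * z₄ / (z₂ * z₃)) = z₃ ^ 2 / z₄ ^ 2 := by
    intro z₁ z₂ z₃ z₄
    constructor
    · ext; push_cast; field_simp
    · ext; push_cast; field_simp
  have h1 : y₁ ^ 2 / y₂ ^ 2 = a * b := (key y₁ y₂ y₃ y₄).1.symm
  have h2 : y₃ ^ 2 / y₄ ^ 2 = a / b := (key y₁ y₂ y₃ y₄).2.symm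
  have h3 : y₁ ^ 2 / y₃ ^ 2 = c * b := by
    rw [← (key y₁ y₃ y₂ y₄).1, hc, hb, mul_comm y₂ y₃]
  have h4 : y₂ ^ 2 / y₄ ^ 2 = c / b := by
    rw [← (key y₁ y₃ y₂ y₄).2, hc, hb, mul_comm y₂ y₃]
  have h5 : y₁ ^ 2 / y₄ ^ 2 = c * a := by
    rw [← (key y₁ y₄ y₂ y₃).1, hc, ha, mul_comm y₄ y₃, mul_comm y₂ y₄]
  have h6 : y₂ ^ 2 / y₃ ^ 2 = c / a := by
    rw [← (key y₁ y₄ y₂ y₃).2, hc, ha, mul_comm y₄ y₃, mul_comm y₂ y₄]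
  rw [h1, h2, h3, h4, h5, h6]
  have hab := w_mul_w hr a b
  have hcb := w_mul_w hr c b
  have hca := w_mul_w hr c a
  have nz : ∀ x y : ℂˣ, F0 r x * F0 r y - PowerSeries.X ^ r * (F1 r x * F1 r y) ≠ 0 := by
    intro x y
    rw [← th4_mul hr]
    exact mul_ne_zero (th4_ne_zero hr _) (th4_ne_zero hr _)
  -- Cleared of denominators the relation is an identity between the values of `F0` and `F1`, the
  -- addition formula for `tanh` in disguise.
  refine mul_right_cancel₀ (mul_ne_zero (mul_ne_zero (nz a b) (nz c b)) (nz c a)) ?_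
  generalize w r (a * b) * w r (a / b) = P at *
  generalize w r (c * b) * w r (c / b) = Q at *
  generalize w r (c * a) * w r (c / a) = R at *
  set Da := F0 r a * F0 r b - PowerSeries.X ^ r * (F1 r a * F1 r b) with hDa
  set Db := F0 r c * F0 r b - PowerSeries.X ^ r * (F1 r c * F1 r b) with hDb
  set Dc := F0 r c * F0 r a - PowerSeries.X ^ r * (F1 r c * F1 r a) with hDc
  have e : (P - Q + R) * (Da * Db * Dc) - PowerSeries.X ^ r * (P * Q * R) * (Da * Db * Dc) =
      (P * Da) * Db * Dc - (Q * Db) * Da * Dc + (R * Dc) * Da * Db -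
      PowerSeries.X ^ r * ((P * Da) * (Q * Db) * (R * Dc)) := by ring
  rw [← sub_eq_zero, e, hab, hcb, hca, hDa, hDb, hDc]
  ring

end thetaField

/-! ### The addition theorem for the logarithmic derivative -/

section threeTerm
variable {r : ℕ}

theorem dth4_inv {A : Type*} [CommRing A] (hr : 0 < r) (x : Aˣ) : dth4 r x⁻¹ = -dth4 r x := by
  simp only [dth4, th4w]
  rw [← gf_neg (finFib_eSq hr)]
  refine gf_equiv (Equiv.neg ℤ) (fun n => ?_) fun n => ?_
  · zify; simp [eSq_cast]
  · simp only [Equiv.neg_apply]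
    rw [neg_one_zpow_neg, mul_neg, zpow_neg, ← inv_zpow]; push_cast; ring

theorem dth4_one (hr : 0 < r) : dth4 r (1 : ℂˣ) = 0 := by
  have h := dth4_inv hr (1 : ℂˣ)
  rw [inv_one] at h
  have h2 : 2 * dth4 r (1 : ℂˣ) = 0 := by linear_combination h
  exact (mul_eq_zero.1 h2).resolve_left two_powerSeries_ne_zero

/-- The addition theorem for the logarithmic derivative of `th4`, cleared of denominators. -/
theorem dth4_three_term (hr : 0 < r) (a b : ℂˣ) :
    (dth4 r a * th4 r b * th4 r (a * b) + th4 r a * dth4 r b * th4 r (a * b) -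
      th4 r a * th4 r b * dth4 r (a * b)) * th4 r 1 =
    PowerSeries.X ^ r * (dth1 r 1 * th1 r a * th1 r b * th1 r (a * b)) := by
  obtain ⟨y₁, rfl⟩ := exists_sq_eq_unit a
  obtain ⟨y₂, rfl⟩ := exists_sq_eq_unit b
  set x := y₁ * y₂ with hx
  set y := y₁ / y₂ with hy
  have h1 : y₁ ^ 2 = x * y := by rw [hx, hy]; ext; push_cast; field_simp
  have h2 : y₂ ^ 2 = x / y := by rw [hx, hy]; ext; push_cast; field_simp
  have h3 : y₁ ^ 2 * y₂ ^ 2 = x * x := by rw [hx]; ext; push_cast; ring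
  have hc : ∀ m n : ℤ, ((m : ℤ) : ℂ) + ((n : ℤ) : ℂ) = ((m + n : ℤ) : ℂ) := fun m n => by simp
  rw [h3, h1, h2]
  have e1 := th4w_mul_add hr _ _ hc x y
  have e2 := th4_mul hr x y
  have e3 := th4w_mul_add hr _ _ hc x x
  have e4 := th4_mul hr x x
  have e5 := th1_mul hr x y
  have e6 := th1w_mul_add hr _ _ hc x x
  simp only [div_self', dth4_one hr, th1_one hr, mul_zero, add_zero, zero_add] at e3 e4 e6
  linear_combination (th4 r (x * x) * th4 r 1) * e1 - (dth4 r (x * x) * th4 r 1) * e2 +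
    (F0w (fun n => (n : ℂ)) r x * F0 r y -
      PowerSeries.X ^ r * (F1w (fun n => (n : ℂ)) r x * F1 r y)) * e4 -
    (F0 r x * F0 r y - PowerSeries.X ^ r * (F1 r x * F1 r y)) * e3 -
    PowerSeries.X ^ r * th1 r (x * y) * th1 r (x / y) * e6 -
    PowerSeries.X ^ r * (F1w (fun n => (n : ℂ)) r x * F0 r x -
      F0w (fun n => (n : ℂ)) r x * F1 r x) * e5

/-! ### The nonvanishing factor of the odd theta series -/

/-- For exponents symmetric under `n ↦ -1 - n`, a series over `ℤ` folds to one over `ℕ`. -/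
theorem gf_int_fold {A : Type*} [CommRing A] {e : ℤ → ℕ} (h : FinFib e)
    (he : ∀ n : ℕ, e (Int.negSucc n) = e n) (a : ℤ → A) :
    gf e a = gf (fun n : ℕ => e n) fun n => a n + a (Int.negSucc n) := by
  have h1 : FinFib fun n : ℕ => e n := h.comp_injective Nat.cast_injective
  have h2 : FinFib fun n : ℕ => e (Int.negSucc n) :=
    h.comp_injective fun _ _ h => Int.negSucc.inj h
  have h3 := gf_sum h1 h2 fun s => a (Equiv.intEquivNatSumNat.symm s)
  rw [gf_equiv Equiv.intEquivNatSumNat (b := fun s => a (Equiv.intEquivNatSumNat.symm s))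
    (e' := Sum.elim (fun n : ℕ => e n) fun n : ℕ => e (Int.negSucc n)) ?_ (by simp), h3]
  · rw [← gf_add h1]
    congr 1
    simp only [he]; rfl
  · rintro (n | n) <;> rfl

/-- The quotient of `th1 r x` by `x⁻¹ - x`, which is defined also where `x ^ 2 = 1`. -/
noncomputable def Om {A : Type*} [CommRing A] (r : ℕ) (x : Aˣ) : PowerSeries A :=
  gf (fun n : ℕ => ePr r n) fun n => (-1) ^ n *
    ∑ j ∈ Finset.range (2 * n + 1), ((x ^ (2 * (j : ℤ) - 2 * n) : Aˣ) : A)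

theorem ePr_negSucc (r n : ℕ) : ePr r (Int.negSucc n) = ePr r n := by
  zify; rw [ePr_cast, ePr_cast, Int.negSucc_eq]; ring

theorem finFib_ePr_nat (hr : 0 < r) : FinFib fun n : ℕ => ePr r n :=
  (finFib_ePr hr).comp_injective Nat.cast_injective

theorem th1_eq_mul_Om {A : Type*} [CommRing A] (hr : 0 < r) (x : Aˣ) :
    th1 r x = PowerSeries.C (((x⁻¹ : Aˣ) : A) - x) * Om r x := by
  rw [Om, C_mul_gf (finFib_ePr_nat hr), th1, th1w,
    gf_int_fold (finFib_ePr hr) (ePr_negSucc r)]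
  congr 1; funext n
  have tele : ∀ m : ℕ, (((x⁻¹ : Aˣ) : A) - x) * ∑ j ∈ Finset.range m,
      ((x ^ (2 * (j : ℤ) - 2 * n) : Aˣ) : A) = ((x ^ (-2 * n - 1 : ℤ) : Aˣ) : A) -
        ((x ^ (2 * (m : ℤ) - 2 * n - 1) : Aˣ) : A) := by
    intro m
    induction m with
    | zero => simp
    | succ m ih =>
      rw [Finset.sum_range_succ, mul_add, ih, sub_mul, ← Units.val_mul, ← Units.val_mul]
      rw [show x⁻¹ * x ^ (2 * (m : ℤ) - 2 * n) = x ^ (2 * (m : ℤ) - 2 * n - 1) by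
        rw [zpow_sub_one, mul_comm], show x * x ^ (2 * (m : ℤ) - 2 * n) =
        x ^ (2 * ((m + 1 : ℕ) : ℤ) - 2 * n - 1) by
          rw [← zpow_one_add]; congr 1; push_cast; ring]
      ring
  rw [mul_left_comm, tele, Int.negSucc_eq]
  rw [show 2 * ((2 * n + 1 : ℕ) : ℤ) - 2 * n - 1 = 2 * n + 1 by push_cast; ring,
    show 2 * -((n : ℤ) + 1) + 1 = -2 * n - 1 by ring,
    show -((n : ℤ) + 1) + 1 = -n by ring, neg_one_zpow_neg]
  rw [zpow_add (-1) (n : ℤ), zpow_natCast]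
  push_cast
  rw [zpow_one]
  push_cast
  ring

theorem dth1_one (hr : 0 < r) : dth1 r (1 : ℂˣ) = -2 * Om r 1 := by
  rw [show (-2 : PowerSeries ℂ) = PowerSeries.C (-2) by
      rw [map_neg, map_ofNat], Om, C_mul_gf (finFib_ePr_nat hr), dth1, th1w,
    gf_int_fold (finFib_ePr hr) (ePr_negSucc r)]
  congr 1; funext n
  rw [Int.negSucc_eq, show -((n : ℤ) + 1) + 1 = -n by ring, neg_one_zpow_neg]
  rw [zpow_add, zpow_natCast]
  simp
  ring

end threeTerm

/-! ### Jacobi's triple product -/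

section jtp
variable {R : Type*} [CommRing R]

/-- The general term `α ^ (k (k + 1) / 2) * β ^ (k (k - 1) / 2)` of a theta series. -/
def thetaTerm (α β : R) (k : ℤ) : R :=
  α ^ (k * (k + 1) / 2).toNat * β ^ (k * (k - 1) / 2).toNat

theorem half_mul_succ (k : ℤ) : 0 ≤ k * (k + 1) / 2 ∧ 2 * (k * (k + 1) / 2) = k * (k + 1) := by
  constructor
  · apply Int.ediv_nonneg _ (by norm_num)
    rcases le_or_gt 0 k with h | h
    · positivity
    · nlinarith
  · exact Int.mul_ediv_cancel' (Int.even_mul_succ_self k).two_dvd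

theorem half_mul_pred (k : ℤ) : 0 ≤ k * (k - 1) / 2 ∧ 2 * (k * (k - 1) / 2) = k * (k - 1) := by
  have h := half_mul_succ (k - 1)
  rwa [sub_add_cancel, mul_comm] at h

theorem mul_thetaTerm_left (α β : R) {n k : ℤ} (h1 : -n ≤ k) (h2 : k ≤ n) :
    α * (α * β) ^ n.toNat * thetaTerm α β k = (α * β) ^ (n - k).toNat * thetaTerm α β (k + 1) := by
  have a1 := half_mul_succ k
  have a2 := half_mul_pred k
  have a3 := half_mul_succ (k + 1)
  have a4 := half_mul_pred (k + 1)
  rw [thetaTerm, thetaTerm, mul_pow, mul_pow]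
  have e1 : 1 + n.toNat + (k * (k + 1) / 2).toNat =
      (n - k).toNat + ((k + 1) * (k + 1 + 1) / 2).toNat := by
    zify
    rw [Int.toNat_of_nonneg a1.1, Int.toNat_of_nonneg a3.1, Int.toNat_of_nonneg (by omega),
      Int.toNat_of_nonneg (by omega)]
    nlinarith
  have e2 : n.toNat + (k * (k - 1) / 2).toNat =
      (n - k).toNat + ((k + 1) * (k + 1 - 1) / 2).toNat := by
    zify
    rw [Int.toNat_of_nonneg a2.1, Int.toNat_of_nonneg a4.1, Int.toNat_of_nonneg (by omega),
      Int.toNat_of_nonneg (by omega)]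
    nlinarith
  calc _ = α ^ (1 + n.toNat + (k * (k + 1) / 2).toNat) *
        β ^ (n.toNat + (k * (k - 1) / 2).toNat) := by ring
    _ = _ := by rw [e1, e2]; ring

theorem thetaTerm_swap (α β : R) (k : ℤ) : thetaTerm α β k = thetaTerm β α (-k) := by
  rw [thetaTerm, thetaTerm, mul_comm, show -k * (-k + 1) = k * (k - 1) by ring,
    show -k * (-k - 1) = k * (k + 1) by ring]

theorem mul_thetaTerm_right (α β : R) {n k : ℤ} (h1 : -n ≤ k) (h2 : k ≤ n) :
    β * (α * β) ^ n.toNat * thetaTerm α β k = (α * β) ^ (n + k).toNat * thetaTerm α β (k - 1) := by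
  have := mul_thetaTerm_left β α (n := n) (k := -k) (by omega) (by omega)
  rw [thetaTerm_swap α β k, thetaTerm_swap α β (k - 1), mul_comm α β, this]
  congr 2 <;> congr 1 <;> ring_nf

/-- A finite form of Jacobi's triple product. The functions `P` and `ip` stand for the
`q`-factorials `(Q; Q)ⱼ` and their inverses, so that the coefficients are `q`-binomials. -/
theorem finite_triple_product (α β Q : R) (hQ : α * β = Q) (P : ℕ → R) (ip : ℤ → R)
    (P0 : P 0 = 1) (Ps : ∀ j, P (j + 1) = P j * (1 - Q ^ (j + 1))) (ip0 : ip 0 = 1)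
    (ipneg : ∀ j, j < 0 → ip j = 0)
    (ips : ∀ j, 0 ≤ j → ip j = (1 - Q ^ (j + 1).toNat) * ip (j + 1)) (n : ℕ) :
    ∏ i ∈ Finset.range n, ((1 + α * Q ^ i) * (1 + β * Q ^ i)) =
      ∑ᶠ k : ℤ, P (2 * n) * ip (n + k) * ip (n - k) * thetaTerm α β k := by
  have ips' : ∀ j, ip j = (1 - Q ^ (j + 1).toNat) * ip (j + 1) := by
    intro j
    rcases lt_trichotomy j (-1) with h | h | h
    · rw [ipneg j (by omega), ipneg (j + 1) (by omega), mul_zero]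
    · subst h; simp [ipneg (-1) (by norm_num)]
    · exact ips j (by omega)
  have fin : ∀ (n : ℕ) (f : ℤ → R) (s t : ℤ), (Function.support fun k : ℤ =>
      P (2 * n) * ip (n + k + s) * ip (n - k + t) * f k).Finite := by
    intro n f s t
    refine (Set.finite_Icc (-n - s) (n + t)).subset fun k hk => ?_
    rw [Function.mem_support] at hk
    by_contra hk'
    apply hk
    rw [Set.mem_Icc, not_and_or] at hk'
    rcases hk' with h | h
    · rw [ipneg (n + k + s) (by omega)]; ring
    · rw [ipneg (n - k + t) (by omega)]; ring
  induction n with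
  | zero =>
    rw [Finset.prod_range_zero, finsum_eq_single _ 0]
    · simp [P0, ip0, thetaTerm]
    · intro k hk
      rcases lt_or_gt_of_ne hk with h | h
      · rw [ipneg ((0 : ℕ) + k) (by simpa using h)]; ring
      · rw [ipneg ((0 : ℕ) - k) (by simpa using h)]; ring
  | succ n ih =>
    rw [Finset.prod_range_succ, ih, finsum_mul' _ _ (by
      have := fin n (thetaTerm α β) 0 0; simp only [add_zero] at this; exact this)]
    have step : ∀ k : ℤ, P (2 * n) * ip (n + k) * ip (n - k) * thetaTerm α β k *
        ((1 + α * Q ^ n) * (1 + β * Q ^ n)) =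
        P (2 * n) * ip (n + k) * ip (n - k) * ((1 + Q ^ (2 * n + 1)) * thetaTerm α β k) +
        P (2 * n) * ip (n + k) * ip (n - k) * (Q ^ (n - k).toNat * thetaTerm α β (k + 1)) +
        P (2 * n) * ip (n + k) * ip (n - k) * (Q ^ (n + k).toNat * thetaTerm α β (k - 1)) := by
      intro k
      by_cases hk : -(n : ℤ) ≤ k ∧ k ≤ n
      · have h1 := mul_thetaTerm_left α β hk.1 hk.2
        have h2 := mul_thetaTerm_right α β hk.1 hk.2
        rw [hQ, Int.toNat_natCast] at h1 h2
        have h3 : α * Q ^ n * (β * Q ^ n) = Q ^ (2 * n + 1) := by rw [← hQ]; ring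
        linear_combination (P (2 * n) * ip (n + k) * ip (n - k)) * (h1 + h2 + thetaTerm α β k * h3)
      · rw [not_and_or] at hk
        rcases hk with h | h
        · rw [ipneg (n + k) (by omega)]; ring
        · rw [ipneg (n - k) (by omega)]; ring
    simp only [step]
    have f1 := fin n (fun k => (1 + Q ^ (2 * n + 1)) * thetaTerm α β k) 0 0
    have f2 := fin n (fun k => Q ^ (n - k).toNat * thetaTerm α β (k + 1)) 0 0
    have f3 := fin n (fun k => Q ^ (n + k).toNat * thetaTerm α β (k - 1)) 0 0
    have f2' := fin n (fun k => Q ^ (n - (k - 1)).toNat * thetaTerm α β k) (-1) 1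
    have f3' := fin n (fun k => Q ^ (n + (k + 1)).toNat * thetaTerm α β k) 1 (-1)
    simp only [add_zero] at f1 f2 f3
    rw [finsum_add_distrib (f1.union f2 |>.subset (Function.support_add _ _)) f3,
      finsum_add_distrib f1 f2,
      ← finsum_comp_equiv (Equiv.subRight (1 : ℤ)) (f := fun k =>
        P (2 * n) * ip (n + k) * ip (n - k) * (Q ^ (n - k).toNat * thetaTerm α β (k + 1))),
      ← finsum_comp_equiv (Equiv.addRight (1 : ℤ)) (f := fun k =>
        P (2 * n) * ip (n + k) * ip (n - k) * (Q ^ (n + k).toNat * thetaTerm α β (k - 1)))]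
    simp only [Equiv.subRight_apply, Equiv.coe_addRight, sub_add_cancel, add_sub_cancel_right]
    have g2 : ∀ k : ℤ, P (2 * n) * ip (n + (k - 1)) * ip (n - (k - 1)) *
        (Q ^ (n - (k - 1)).toNat * thetaTerm α β k) = P (2 * n) * ip (n + k + -1) *
          ip (n - k + 1) * (Q ^ (n - (k - 1)).toNat * thetaTerm α β k) := by
      intro k
      rw [show (n : ℤ) + (k - 1) = n + k + -1 by ring]
      congr 3; ring
    have g3 : ∀ k : ℤ, P (2 * n) * ip (n + (k + 1)) * ip (n - (k + 1)) *
        (Q ^ (n + (k + 1)).toNat * thetaTerm α β k) = P (2 * n) * ip (n + k + 1) *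
          ip (n - k + -1) * (Q ^ (n + (k + 1)).toNat * thetaTerm α β k) := by
      intro k
      rw [show (n : ℤ) - (k + 1) = n - k + -1 by ring]
      congr 3; ring
    simp only [g2, g3]
    rw [← finsum_add_distrib f1 f2',
      ← finsum_add_distrib (f1.union f2' |>.subset (Function.support_add _ _)) f3']
    refine finsum_congr fun k => ?_
    have P2 : P (2 * (n + 1)) = P (2 * n) * (1 - Q ^ (2 * n + 1)) * (1 - Q ^ (2 * n + 2)) := by
      rw [show 2 * (n + 1) = 2 * n + 1 + 1 by ring, Ps, Ps]
    -- the `q`-Pascal recursion, with all factorials expressed through those of `a` and `b`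
    obtain ⟨a, ha⟩ : ∃ a : ℤ, a = n + 1 + k := ⟨_, rfl⟩
    obtain ⟨b, hb⟩ : ∃ b : ℤ, b = n + 1 - k := ⟨_, rfl⟩
    have i1 : ip (n + k) = (1 - Q ^ a.toNat) * ip a := by
      rw [ips', show (n : ℤ) + k + 1 = a by omega]
    have i2 : ip (n - k) = (1 - Q ^ b.toNat) * ip b := by
      rw [ips', show (n : ℤ) - k + 1 = b by omega]
    have i3 : ip (n + k + -1) = (1 - Q ^ (a - 1).toNat) * ((1 - Q ^ a.toNat) * ip a) := by
      rw [ips', show (n : ℤ) + k + -1 + 1 = n + k by ring, i1, show (n : ℤ) + k = a - 1 by omega]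
    have i4 : ip (n - k + -1) = (1 - Q ^ (b - 1).toNat) * ((1 - Q ^ b.toNat) * ip b) := by
      rw [ips', show (n : ℤ) - k + -1 + 1 = n - k by ring, i2, show (n : ℤ) - k = b - 1 by omega]
    rw [i1, i2, i3, i4, show (n : ℤ) + k + 1 = a by omega, show (n : ℤ) - k + 1 = b by omega,
      show (n : ℤ) - (k - 1) = b by omega, show (n : ℤ) + (k + 1) = a by omega, P2,
      show ((n + 1 : ℕ) : ℤ) + k = a by push_cast; omega,
      show ((n + 1 : ℕ) : ℤ) - k = b by push_cast; omega]
    rcases lt_trichotomy a 0 with ha0 | ha0 | ha0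
    · rw [ipneg a ha0]; ring
    · rw [ha0, show b.toNat = 2 * n + 2 by omega, show (b - 1).toNat = 2 * n + 1 by omega]
      simp; ring
    rcases lt_trichotomy b 0 with hb0 | hb0 | hb0
    · rw [ipneg b hb0]; ring
    · rw [hb0, show a.toNat = 2 * n + 2 by omega, show (a - 1).toNat = 2 * n + 1 by omega]
      simp; ring
    rw [show a.toNat = (a - 1).toNat + 1 by omega, show b.toNat = (b - 1).toNat + 1 by omega,
      show 2 * n + 1 = (a - 1).toNat + (b - 1).toNat + 1 by omega,
      show 2 * n + 2 = (a - 1).toNat + (b - 1).toNat + 2 by omega]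
    ring

end jtp

/-! ### Congruences of power series and infinite products -/

section cong
variable {A : Type*} [CommRing A]

/-- Congruence of power series modulo `X ^ n`. -/
def PCong (n : ℕ) (f g : PowerSeries A) : Prop := PowerSeries.X ^ n ∣ f - g

namespace PCong
variable {n : ℕ} {f g h f' g' : PowerSeries A}

theorem refl (n : ℕ) (f : PowerSeries A) : PCong n f f := by simp [PCong]

theorem symm (h : PCong n f g) : PCong n g f := by
  unfold PCong at *; rw [← neg_sub]; exact (dvd_neg).2 h

theorem trans (h₁ : PCong n f g) (h₂ : PCong n g h) : PCong n f h := by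
  unfold PCong at *; rw [← sub_add_sub_cancel f g h]; exact dvd_add h₁ h₂

theorem add (h₁ : PCong n f g) (h₂ : PCong n f' g') : PCong n (f + f') (g + g') := by
  unfold PCong at *; rw [add_sub_add_comm]; exact dvd_add h₁ h₂

theorem neg (h₁ : PCong n f g) : PCong n (-f) (-g) := by
  unfold PCong at *; rw [← neg_sub']; exact (dvd_neg).2 h₁

theorem sub (h₁ : PCong n f g) (h₂ : PCong n f' g') : PCong n (f - f') (g - g') := by
  rw [sub_eq_add_neg, sub_eq_add_neg]; exact h₁.add h₂.neg

theorem mul (h₁ : PCong n f g) (h₂ : PCong n f' g') : PCong n (f * f') (g * g') := by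
  unfold PCong at *
  rw [show f * f' - g * g' = (f - g) * f' + g * (f' - g') by ring]
  exact dvd_add (h₁.mul_right _) (h₂.mul_left _)

theorem pow (h₁ : PCong n f g) (k : ℕ) : PCong n (f ^ k) (g ^ k) := by
  induction k with
  | zero => simpa using refl n 1
  | succ k ih => rw [pow_succ, pow_succ]; exact ih.mul h₁

theorem prod {ι : Type*} {s : Finset ι} {f g : ι → PowerSeries A}
    (h : ∀ i ∈ s, PCong n (f i) (g i)) : PCong n (∏ i ∈ s, f i) (∏ i ∈ s, g i) := by
  classical
  induction s using Finset.induction_on with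
  | empty => simpa using refl n 1
  | insert a s ha ih =>
    rw [Finset.prod_insert ha, Finset.prod_insert ha]
    exact (h a (by simp)).mul (ih fun i hi => h i (by simp [hi]))

theorem sum {ι : Type*} {s : Finset ι} {f g : ι → PowerSeries A}
    (h : ∀ i ∈ s, PCong n (f i) (g i)) : PCong n (∑ i ∈ s, f i) (∑ i ∈ s, g i) := by
  unfold PCong at *
  rw [← Finset.sum_sub_distrib]
  exact Finset.dvd_sum h

theorem mono {m : ℕ} (hmn : m ≤ n) (h : PCong n f g) : PCong m f g := (pow_dvd_pow _ hmn).trans h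

theorem of_unit_mul {u : PowerSeries A} (hu : IsUnit u) (h : PCong n (u * f) (u * g)) :
    PCong n f g := by
  unfold PCong at *
  rw [← mul_sub] at h
  exact (hu.dvd_mul_left).1 h

theorem iff_coeff : PCong n f g ↔ ∀ j < n, PowerSeries.coeff j f = PowerSeries.coeff j g := by
  unfold PCong
  rw [PowerSeries.X_pow_dvd_iff]
  simp [sub_eq_zero]

theorem map {B : Type*} [CommRing B] (φ : A →+* B) (h : PCong n f g) :
    PCong n (PowerSeries.map φ f) (PowerSeries.map φ g) := by
  rw [iff_coeff] at *
  intro j hj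
  rw [PowerSeries.coeff_map, PowerSeries.coeff_map, h j hj]

end PCong

theorem eq_of_forall_PCong {f g : PowerSeries A} (h : ∀ n, PCong n f g) : f = g := by
  ext j
  exact PCong.iff_coeff.1 (h (j + 1)) j (Nat.lt_succ_self j)

/-- The `q`-factorial `∏ (1 - X ^ (s (i + 1)))` over `i < n`. -/
noncomputable def qfac (A : Type*) [CommRing A] (s n : ℕ) : PowerSeries A :=
  ∏ i ∈ Finset.range n, (1 - PowerSeries.X ^ (s * (i + 1)))

theorem isUnit_one_sub_X_pow_mul {k : ℕ} (hk : 0 < k) (f : PowerSeries A) :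
    IsUnit (1 - PowerSeries.X ^ k * f) := by
  rw [PowerSeries.isUnit_iff_constantCoeff]
  simp [hk.ne']

theorem isUnit_qfac {s : ℕ} (hs : 0 < s) (n : ℕ) : IsUnit (qfac A s n) := by
  rw [qfac]
  refine Submonoid.prod_mem (IsUnit.submonoid _) fun i _ => ?_
  have := isUnit_one_sub_X_pow_mul (A := A) (k := s * (i + 1)) (by positivity) 1
  rwa [mul_one] at this

theorem PCong_one_sub {n k : ℕ} (hk : n ≤ k) (f : PowerSeries A) :
    PCong n (1 - PowerSeries.X ^ k * f) 1 := by
  unfold PCong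
  rw [sub_sub_cancel_left, dvd_neg]
  exact ((pow_dvd_pow _ hk).mul_right _)

theorem qfac_cong {s : ℕ} (hs : 0 < s) {m j : ℕ} (hj : m ≤ j) :
    PCong (m + 1) (qfac A s j) (qfac A s m) := by
  obtain ⟨c, rfl⟩ := Nat.exists_eq_add_of_le hj
  rw [qfac, Finset.prod_range_add]
  suffices h : PCong (m + 1) (∏ x ∈ Finset.range c,
      (1 - (PowerSeries.X : PowerSeries A) ^ (s * (m + x + 1)))) 1 by
    simpa [qfac] using (PCong.refl (m + 1) (qfac A s m)).mul h
  rw [← Finset.prod_const_one (M := PowerSeries A) (s := Finset.range c)]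
  refine PCong.prod fun i _ => ?_
  have := PCong_one_sub (A := A) (n := m + 1) (k := s * (m + i + 1)) (by nlinarith) 1
  simpa using this

/-- Jacobi's triple product, as a congruence modulo `X ^ n`. -/
theorem triple_product_cong {s : ℕ} (hs : 0 < s) (α β : PowerSeries A)
    (hαβ : α * β = PowerSeries.X ^ s) {e : ℤ → ℕ} (he : ∀ k, k.natAbs ≤ e k + 1) (a : ℤ → A)
    (hT : ∀ k, thetaTerm α β k = PowerSeries.monomial (e k) (a k)) (n : ℕ) :
    PCong n (gf e a) (qfac A s n * ∏ i ∈ Finset.range n,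
      ((1 + α * PowerSeries.X ^ (s * i)) * (1 + β * PowerSeries.X ^ (s * i)))) := by
  set ip : ℤ → PowerSeries A := fun j => if j < 0 then 0 else Ring.inverse (qfac A s j.toNat)
    with hip
  have ip_mul : ∀ j : ℤ, 0 ≤ j → qfac A s j.toNat * ip j = 1 := fun j hj => by
    rw [hip]; simp only [not_lt.2 hj, if_false]
    exact Ring.mul_inverse_cancel _ (isUnit_qfac hs _)
  have key := finite_triple_product α β (PowerSeries.X ^ s) hαβ (qfac A s) ip (by simp [qfac])
    (fun j => by rw [qfac, qfac, Finset.prod_range_succ, pow_mul])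
    (by simpa [qfac] using ip_mul 0 le_rfl) (fun j hj => by simp [hip, hj])
    (fun j hj => by
      have h1 := ip_mul j hj
      have h2 := ip_mul (j + 1) (by omega)
      rw [show (j + 1).toNat = j.toNat + 1 by omega] at h2 ⊢
      refine (isUnit_qfac hs j.toNat).mul_left_cancel ?_
      have h3 : qfac A s (j.toNat + 1) = qfac A s j.toNat *
          (1 - (PowerSeries.X ^ s) ^ (j.toNat + 1)) := by
        rw [qfac, qfac, Finset.prod_range_succ, pow_mul]
      linear_combination h1 - h2 + h3 * ip (j + 1)) n
  simp only [← pow_mul] at key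
  rw [key, finsum_eq_sum_of_support_subset (s := Finset.Icc (-n : ℤ) n), Finset.mul_sum]
  · rw [PCong.iff_coeff]
    intro j hj
    rw [coeff_gf_eq_coeff_sum a (Finset.Icc (-n : ℤ) n)
      fun k hk => by have := he k; rw [Finset.mem_Icc]; omega]
    refine PCong.iff_coeff.1 (PCong.sum fun k hk => ?_) j hj
    rw [Finset.mem_Icc] at hk
    rw [hT]
    set μ := n - k.natAbs with hμ
    -- the `q`-binomial coefficient tends to the inverse of the infinite `q`-factorial
    have hb : PCong (μ + 1) (qfac A s n * (qfac A s (2 * n) * ip (n + k) * ip (n - k))) 1 := by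
      have u1 := ip_mul (n + k) (by omega)
      have u2 := ip_mul (n - k) (by omega)
      refine PCong.of_unit_mul ((isUnit_qfac hs (n + k).toNat).mul (isUnit_qfac hs (n - k).toNat)) ?_
      have : qfac A s (n + k).toNat * qfac A s (n - k).toNat *
          (qfac A s n * (qfac A s (2 * n) * ip (n + k) * ip (n - k))) =
          qfac A s n * qfac A s (2 * n) := by
        linear_combination (qfac A s n * qfac A s (2 * n)) *
          (qfac A s (n - k).toNat * ip (n - k) * u1 + u2)
      rw [this, mul_one]
      exact ((qfac_cong hs (by omega)).mul (qfac_cong hs (by omega))).trans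
        ((qfac_cong hs (by omega)).mul (qfac_cong hs (by omega))).symm
    obtain ⟨c, hc⟩ := hb.symm
    rw [PCong, show PowerSeries.monomial (e k) (a k) - qfac A s n * (qfac A s (2 * n) * ip (n + k) *
      ip (n - k) * PowerSeries.monomial (e k) (a k)) = PowerSeries.monomial (e k) (a k) *
      (1 - qfac A s n * (qfac A s (2 * n) * ip (n + k) * ip (n - k))) by ring, hc]
    rw [PowerSeries.monomial_eq_C_mul_X_pow, show PowerSeries.C (a k) * PowerSeries.X ^ e k *
      (PowerSeries.X ^ (μ + 1) * c) = PowerSeries.X ^ (e k + (μ + 1)) * (PowerSeries.C (a k) * c) by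
        ring]
    have := he k
    exact (pow_dvd_pow _ (by omega)).mul_right _
  · intro k hk
    rw [Function.mem_support] at hk
    rw [Finset.coe_Icc, Set.mem_Icc]
    by_contra hk'
    apply hk
    rw [not_and_or] at hk'
    rcases hk' with h | h
    · have : ip (n + k) = 0 := by simp only [hip]; rw [if_pos (by omega)]
      rw [this]; ring
    · have : ip (n - k) = 0 := by simp only [hip]; rw [if_pos (by omega)]
      rw [this]; ring

end cong

/-! ### Product expansions of the theta series -/

section products
variable {r : ℕ}

theorem thetaTerm_C_mul_X {A : Type*} [CommRing A] (u : Aˣ) (p p' : ℕ) (k : ℤ) :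
    thetaTerm (PowerSeries.C (u : A) * PowerSeries.X ^ p)
      (PowerSeries.C ((u⁻¹ : Aˣ) : A) * PowerSeries.X ^ p') k =
    PowerSeries.monomial (p * (k * (k + 1) / 2).toNat + p' * (k * (k - 1) / 2).toNat)
      ((u ^ k : Aˣ) : A) := by
  have h1 := half_mul_succ k
  have h2 := half_mul_pred k
  rw [thetaTerm, PowerSeries.monomial_eq_C_mul_X_pow]
  set a := (k * (k + 1) / 2).toNat with ha
  set b := (k * (k - 1) / 2).toNat with hb
  have hab : (a : ℤ) - b = k := by
    have h3 : (2 : ℤ) * (a - b) = 2 * k := by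
      rw [ha, hb, Int.toNat_of_nonneg h1.1, Int.toNat_of_nonneg h2.1, mul_sub, h1.2, h2.2]; ring
    linarith
  rw [← hab, zpow_sub, zpow_natCast, zpow_natCast, ← inv_pow, mul_pow, mul_pow, ← map_pow,
    ← map_pow, Units.val_mul, map_mul, Units.val_pow_eq_pow_val, Units.val_pow_eq_pow_val]
  ring

/-- The product `∏ (1 - x² q^(r (2i+1))) (1 - x⁻² q^(r (2i+1)))` over `i < n`. -/
noncomputable def oddP {A : Type*} [CommRing A] (r n : ℕ) (x : Aˣ) : PowerSeries A :=
  ∏ i ∈ Finset.range n, ((1 - PowerSeries.X ^ (r * (2 * i + 1)) * PowerSeries.C ((x ^ 2 : Aˣ) : A)) *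
    (1 - PowerSeries.X ^ (r * (2 * i + 1)) * PowerSeries.C (((x ^ 2)⁻¹ : Aˣ) : A)))

/-- The product `∏ (1 - x² q^(2 r (i+1))) (1 - x⁻² q^(2 r (i+1)))` over `i < n`. -/
noncomputable def evenP {A : Type*} [CommRing A] (r n : ℕ) (x : Aˣ) : PowerSeries A :=
  ∏ i ∈ Finset.range n, ((1 - PowerSeries.X ^ (2 * r * (i + 1)) * PowerSeries.C ((x ^ 2 : Aˣ) : A)) *
    (1 - PowerSeries.X ^ (2 * r * (i + 1)) * PowerSeries.C (((x ^ 2)⁻¹ : Aˣ) : A)))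

theorem isUnit_oddP {A : Type*} [CommRing A] (hr : 0 < r) (n : ℕ) (x : Aˣ) :
    IsUnit (oddP r n x) := by
  rw [oddP]
  refine Submonoid.prod_mem (IsUnit.submonoid _) fun i _ => ?_
  exact (isUnit_one_sub_X_pow_mul (by positivity) _).mul (isUnit_one_sub_X_pow_mul (by positivity) _)

theorem natAbs_le_eSq (hr : 0 < r) (k : ℤ) : k.natAbs ≤ eSq r k + 1 := by
  have h := eSq_cast r k
  have hr' : (1 : ℤ) ≤ r := by exact_mod_cast hr
  zify
  rw [h]
  rcases abs_cases k with ⟨h1, h2⟩ | ⟨h1, h2⟩ <;> rw [h1] <;> nlinarith [sq_nonneg k]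

theorem natAbs_le_ePr (hr : 0 < r) (k : ℤ) : k.natAbs ≤ ePr r k + 1 := by
  have h := ePr_cast r k
  have hr' : (1 : ℤ) ≤ r := by exact_mod_cast hr
  have h0 : 0 ≤ k * (k + 1) := by
    rcases le_or_gt 0 k with h | h
    · positivity
    · nlinarith
  zify
  rw [h]
  rcases abs_cases k with ⟨h1, h2⟩ | ⟨h1, h2⟩ <;> rw [h1] <;> nlinarith

theorem th4_cong {A : Type*} [CommRing A] (hr : 0 < r) (n : ℕ) (x : Aˣ) :
    PCong n (th4 r x) (qfac A (2 * r) n * oddP r n x) := by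
  have h := triple_product_cong (A := A) (s := 2 * r) (by omega)
    (PowerSeries.C ((-x ^ 2 : Aˣ) : A) * PowerSeries.X ^ r)
    (PowerSeries.C (((-x ^ 2)⁻¹ : Aˣ) : A) * PowerSeries.X ^ r) ?_
    (natAbs_le_eSq hr) (fun k => ((-x ^ 2) ^ k : Aˣ)) ?_ n
  · convert h using 1
    · simp only [th4, th4w]
      congr 1; funext k
      rw [one_mul, ← neg_one_mul (x ^ 2), mul_zpow, ← zpow_natCast x, ← zpow_mul]; rfl
    · rw [oddP]; congr 1
      refine Finset.prod_congr rfl fun i _ => ?_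
      rw [inv_neg, Units.val_neg, Units.val_neg, map_neg, map_neg]; ring
  · rw [mul_mul_mul_comm, ← map_mul, ← Units.val_mul, mul_inv_cancel]; simp; ring
  · intro k
    rw [thetaTerm_C_mul_X]; congr 2
    zify
    rw [Int.toNat_of_nonneg (half_mul_succ k).1, Int.toNat_of_nonneg (half_mul_pred k).1, eSq_cast]
    linear_combination (by
      have h1 := (half_mul_succ k).2
      have h2 := (half_mul_pred k).2
      have : 2 * (k * (k + 1) / 2 + k * (k - 1) / 2) = 2 * k ^ 2 := by rw [mul_add, h1, h2]; ring
      have h3 : k * (k + 1) / 2 + k * (k - 1) / 2 = k ^ 2 := by linarith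
      linear_combination (r : ℤ) * h3 : (r : ℤ) * (k * (k + 1) / 2) + r * (k * (k - 1) / 2) =
        r * k ^ 2)

theorem evenP_succ_cong {A : Type*} [CommRing A] (hr : 0 < r) (n : ℕ) (x : Aˣ) :
    PCong n ((1 - PowerSeries.C (((x ^ 2)⁻¹ : Aˣ) : A)) * evenP r n x)
      (∏ i ∈ Finset.range n, ((1 - PowerSeries.X ^ (2 * r * (i + 1)) *
        PowerSeries.C ((x ^ 2 : Aˣ) : A)) *
        (1 - PowerSeries.X ^ (2 * r * i) * PowerSeries.C (((x ^ 2)⁻¹ : Aˣ) : A)))) := by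
  rw [evenP, Finset.prod_mul_distrib, Finset.prod_mul_distrib, mul_left_comm]
  refine (PCong.refl _ _).mul ?_
  have h := Finset.prod_range_succ' (fun i => 1 - (PowerSeries.X : PowerSeries A) ^ (2 * r * i) *
    PowerSeries.C (((x ^ 2)⁻¹ : Aˣ) : A)) n
  have h' := Finset.prod_range_succ (fun i => 1 - (PowerSeries.X : PowerSeries A) ^ (2 * r * i) *
    PowerSeries.C (((x ^ 2)⁻¹ : Aˣ) : A)) n
  rw [h'] at h
  rw [mul_zero, pow_zero, one_mul, mul_comm] at h
  rw [mul_comm (1 - PowerSeries.C _), ← h]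
  nth_rw 2 [← one_mul (∏ i ∈ Finset.range n, _)]
  exact (PCong_one_sub (by nlinarith) _).mul (PCong.refl _ _)

theorem one_sub_mul_Om_cong {A : Type*} [CommRing A] (hr : 0 < r) (n : ℕ) (x : Aˣ) :
    PCong n ((1 - PowerSeries.C (((x ^ 2)⁻¹ : Aˣ) : A)) * Om r x)
      ((1 - PowerSeries.C (((x ^ 2)⁻¹ : Aˣ) : A)) * (qfac A (2 * r) n * evenP r n x)) := by
  have h := triple_product_cong (A := A) (s := 2 * r) (by omega)
    (PowerSeries.C ((-x ^ 2 : Aˣ) : A) * PowerSeries.X ^ (2 * r))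
    (PowerSeries.C (((-x ^ 2)⁻¹ : Aˣ) : A) * PowerSeries.X ^ 0) ?_
    (natAbs_le_ePr hr) (fun k => ((-x ^ 2) ^ k : Aˣ)) ?_ n
  · have e1 : (1 - PowerSeries.C (((x ^ 2)⁻¹ : Aˣ) : A)) * Om r x =
        gf (ePr r) fun k => (((-x ^ 2) ^ k : Aˣ) : A) := by
      have : (1 - PowerSeries.C (((x ^ 2)⁻¹ : Aˣ) : A)) =
          PowerSeries.C (-((x⁻¹ : Aˣ) : A)) * PowerSeries.C (((x⁻¹ : Aˣ) : A) - x) := by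
        rw [← map_one PowerSeries.C, ← map_sub, ← map_mul]
        congr 1
        rw [mul_sub, neg_mul, neg_mul, ← Units.val_mul, ← Units.val_mul,
          inv_mul_cancel, ← mul_inv, ← sq, Units.val_one]; ring
      rw [this, mul_assoc, ← th1_eq_mul_Om hr, th1, th1w, C_mul_gf (finFib_ePr hr)]
      congr 1; funext k
      rw [one_mul, ← Units.val_neg, ← Units.val_mul, ← neg_one_mul (x ^ 2), mul_zpow,
        ← zpow_natCast x, ← zpow_mul, zpow_add (-1), zpow_add x]
      congr 1; push_cast
      simp [mul_comm]
      rw [mul_assoc x, inv_mul_cancel_left]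
    rw [e1, mul_left_comm]
    refine h.trans ?_
    refine (PCong.refl _ _).mul ?_
    refine PCong.trans ?_ (evenP_succ_cong hr n x).symm
    convert PCong.refl _ _ using 1
    refine Finset.prod_congr rfl fun i _ => ?_
    rw [inv_neg, Units.val_neg, Units.val_neg, map_neg, map_neg]; ring
  · rw [mul_mul_mul_comm, ← map_mul, ← Units.val_mul, mul_inv_cancel]; simp
  · intro k
    rw [thetaTerm_C_mul_X]; congr 2
    zify
    rw [Int.toNat_of_nonneg (half_mul_succ k).1, ePr_cast]
    linear_combination (r : ℤ) * (half_mul_succ k).2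

theorem map_Om {A B : Type*} [CommRing A] [CommRing B] (hr : 0 < r) (f : A →+* B) (x : Aˣ) :
    PowerSeries.map f (Om r x) = Om r (Units.map f x) := by
  rw [Om, Om, map_gf (finFib_ePr_nat hr)]
  congr 1; funext n
  rw [map_mul, map_sum]
  simp only [map_pow, map_neg, map_one, ← map_zpow]; rfl

/-- The product formula for `Om`. At a point with `x ^ 2 = 1` the factor `1 - x⁻²` of the triple
product vanishes; it is cancelled at the point `x (1 + ε)`, for a formal variable `ε`. -/
theorem Om_cong (hr : 0 < r) (n : ℕ) (x : ℂˣ) :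
    PCong n (Om r x) (qfac ℂ (2 * r) n * evenP r n x) := by
  have hu : IsUnit (1 + PowerSeries.X : PowerSeries ℂ) := by
    rw [PowerSeries.isUnit_iff_constantCoeff]; simp
  set y : (PowerSeries ℂ)ˣ := Units.map (PowerSeries.C : ℂ →+* PowerSeries ℂ) x * hu.unit with hy
  have hyx : Units.map ((PowerSeries.constantCoeff : PowerSeries ℂ →+* ℂ) : PowerSeries ℂ →* ℂ) y =
      x := by
    ext; simp [hy]
  have hy2 : (1 : PowerSeries ℂ) - (((y ^ 2)⁻¹ : (PowerSeries ℂ)ˣ) : PowerSeries ℂ) ≠ 0 := by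
    intro h
    have h1 : y ^ 2 = 1 := by
      have h2 : (y ^ 2)⁻¹ = 1 := by ext1; rw [← sub_eq_zero.1 h]; rfl
      rw [← inv_inv (y ^ 2), h2, inv_one]
    have h3 := congrArg (fun u : (PowerSeries ℂ)ˣ => PowerSeries.coeff 1 (u : PowerSeries ℂ)) h1
    have h4 : ((y ^ 2 : (PowerSeries ℂ)ˣ) : PowerSeries ℂ) =
        PowerSeries.C ((x : ℂ) ^ 2) * (1 + 2 * PowerSeries.X + PowerSeries.X ^ 2) := by
      rw [hy]; push_cast; simp; ring
    simp only [h4, PowerSeries.coeff_C_mul] at h3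
    rw [show (2 : PowerSeries ℂ) = PowerSeries.C 2 from (map_ofNat PowerSeries.C 2).symm] at h3
    simp [PowerSeries.coeff_one, PowerSeries.coeff_X_pow] at h3
  have h : PCong n (Om r y) (qfac _ (2 * r) n * evenP r n y) := by
    have h1 := one_sub_mul_Om_cong hr n y
    rw [PCong.iff_coeff] at h1 ⊢
    intro j hj
    have h2 := h1 j hj
    rw [← map_one PowerSeries.C, ← map_sub, PowerSeries.coeff_C_mul, PowerSeries.coeff_C_mul] at h2
    exact mul_left_cancel₀ hy2 h2
  have h5 := h.map PowerSeries.constantCoeff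
  rw [map_Om hr] at h5
  have e : ∀ k : ℕ, PowerSeries.constantCoeff (((y ^ k : (PowerSeries ℂ)ˣ) : PowerSeries ℂ)) =
      ((x ^ k : ℂˣ) : ℂ) := by
    intro k; rw [← hyx, ← map_pow]; rfl
  have e' : PowerSeries.constantCoeff ((((y ^ 2)⁻¹ : (PowerSeries ℂ)ˣ) : PowerSeries ℂ)) =
      (((x ^ 2)⁻¹ : ℂˣ) : ℂ) := by
    rw [← hyx, ← map_pow, ← map_inv]; rfl
  convert h5 using 2
  · exact hyx.symm
  · rw [map_mul, qfac, qfac, evenP, evenP, map_prod, map_prod]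
    simp only [map_mul, map_sub, map_one, map_pow, PowerSeries.map_X, PowerSeries.map_C, e, e']

/-! ### The theta quotient as a product -/

/-- The quotient `Om / th4`, which is `w` divided by its constant coefficient `x⁻¹ - x`. -/
noncomputable def W (r : ℕ) (x : ℂˣ) : PowerSeries ℂ := Om r x * (th4 r x)⁻¹

theorem W_mul_th4 (hr : 0 < r) (x : ℂˣ) : W r x * th4 r x = Om r x := by
  rw [W, mul_assoc, mul_comm _ (th4 r x), th4_mul_inv hr, mul_one]

theorem w_eq_mul_W (hr : 0 < r) (x : ℂˣ) :
    w r x = PowerSeries.C (((x⁻¹ : ℂˣ) : ℂ) - x) * W r x := by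
  rw [w, W, th1_eq_mul_Om hr, mul_assoc]

theorem W_mul_oddP_cong (hr : 0 < r) (n : ℕ) (x : ℂˣ) :
    PCong n (W r x * oddP r n x) (evenP r n x) := by
  refine PCong.of_unit_mul (isUnit_qfac (A := ℂ) (s := 2 * r) (by omega) n) ?_
  have h := (PCong.refl n (W r x)).mul (th4_cong hr n x).symm
  rw [W_mul_th4 hr] at h
  rw [mul_left_comm]
  exact h.trans (Om_cong hr n x)

theorem eq_of_mul_oddP_cong (hr : 0 < r) {f g : PowerSeries ℂ} {x : ℂˣ}
    (h : ∀ n, PCong n (f * oddP r n x) (g * oddP r n x)) : f = g :=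
  eq_of_forall_PCong fun n => PCong.of_unit_mul (isUnit_oddP hr n x) (by
    rw [mul_comm, mul_comm _ g]; exact h n)

theorem prod_one_sub_root {d : ℕ} (hd : 0 < d) {ω : ℂ} (hω : IsPrimitiveRoot ω d)
    (f : PowerSeries ℂ) :
    ∏ a ∈ Finset.range d, (1 - f * PowerSeries.C (ω ^ a)) = 1 - f ^ d := by
  have hω' : IsPrimitiveRoot (PowerSeries.C ω) d :=
    hω.map_of_injective PowerSeries.C_injective
  have h := hω'.pow_sub_pow_eq_prod_sub_mul 1 f hd
  rw [one_pow] at h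
  rw [h]
  have : NeZero d := ⟨hd.ne'⟩
  classical
  have himg : Polynomial.nthRootsFinset d (1 : PowerSeries ℂ) =
      (Finset.range d).image fun a => PowerSeries.C ω ^ a := by
    symm
    refine Finset.eq_of_subset_of_card_le (fun z hz => ?_) ?_
    · obtain ⟨a, _, rfl⟩ := Finset.mem_image.1 hz
      rw [Polynomial.mem_nthRootsFinset hd, ← pow_mul, mul_comm, pow_mul, hω'.pow_eq_one, one_pow]
    · rw [hω'.card_nthRootsFinset, Finset.card_image_of_injOn, Finset.card_range]
      intro a ha b hb hab
      exact hω'.pow_inj (Finset.mem_range.1 ha) (Finset.mem_range.1 hb) hab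
  rw [himg, Finset.prod_image]
  · exact Finset.prod_congr rfl fun a _ => by rw [map_pow, mul_comm]
  · intro a ha b hb hab
    exact hω'.pow_inj (Finset.mem_range.1 ha) (Finset.mem_range.1 hb) hab

end products

/-! ### The multiplication formula -/

section thetaMultiplication
variable {r : ℕ}

theorem prod_one_sub_root_mul {d : ℕ} (hd : 0 < d) {ζ : ℂˣ} (hζ : IsPrimitiveRoot (ζ ^ 2) d)
    (x : ℂˣ) (k : ℕ) :
    (∏ a ∈ Finset.range d, (1 - PowerSeries.X ^ k *
      PowerSeries.C ((((ζ ^ a * x) ^ 2 : ℂˣ)) : ℂ)) =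
      1 - PowerSeries.X ^ (k * d) * PowerSeries.C ((((x ^ d) ^ 2 : ℂˣ)) : ℂ)) ∧
    ∏ a ∈ Finset.range d, (1 - PowerSeries.X ^ k *
      PowerSeries.C (((((ζ ^ a * x) ^ 2)⁻¹ : ℂˣ)) : ℂ)) =
      1 - PowerSeries.X ^ (k * d) * PowerSeries.C (((((x ^ d) ^ 2)⁻¹ : ℂˣ)) : ℂ) := by
  have h1 : IsPrimitiveRoot ((ζ ^ 2 : ℂˣ) : ℂ) d := hζ.map_of_injective (f := Units.coeHom ℂ)
    Units.val_injective
  have h2 : IsPrimitiveRoot (((ζ ^ 2)⁻¹ : ℂˣ) : ℂ) d := hζ.inv.map_of_injective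
    (f := Units.coeHom ℂ) Units.val_injective
  constructor
  · rw [show PowerSeries.X ^ (k * d) * PowerSeries.C ((((x ^ d) ^ 2 : ℂˣ)) : ℂ) =
      (PowerSeries.X ^ k * PowerSeries.C (((x ^ 2 : ℂˣ)) : ℂ)) ^ d by
        rw [mul_pow, ← pow_mul, ← map_pow, ← Units.val_pow_eq_pow_val, ← pow_mul, ← pow_mul,
          mul_comm d 2], ← prod_one_sub_root hd h1]
    refine Finset.prod_congr rfl fun a _ => ?_
    rw [mul_assoc, ← map_mul, ← Units.val_pow_eq_pow_val, ← Units.val_mul]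
    congr 4
    rw [mul_pow, ← pow_mul, ← pow_mul, mul_comm a 2, mul_comm]
  · rw [show PowerSeries.X ^ (k * d) * PowerSeries.C (((((x ^ d) ^ 2)⁻¹ : ℂˣ)) : ℂ) =
      (PowerSeries.X ^ k * PowerSeries.C ((((x ^ 2)⁻¹ : ℂˣ)) : ℂ)) ^ d by
        rw [mul_pow, ← pow_mul, ← map_pow, ← Units.val_pow_eq_pow_val, inv_pow, ← pow_mul,
          ← pow_mul, mul_comm d 2], ← prod_one_sub_root hd h2]
    refine Finset.prod_congr rfl fun a _ => ?_
    rw [mul_assoc, ← map_mul, ← Units.val_pow_eq_pow_val, ← Units.val_mul]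
    congr 4
    rw [mul_pow, ← pow_mul, mul_inv, inv_pow, ← pow_mul, mul_comm a 2, mul_comm]

/-- The multiplication formula: a product of `W` over the translates by a cyclic group of roots
of unity is again a value of `W`, with `q` replaced by `q ^ d`. -/
theorem prod_W {d : ℕ} (hr : 0 < r) (hd : 0 < d) {ζ : ℂˣ} (hζ : IsPrimitiveRoot (ζ ^ 2) d)
    (x : ℂˣ) : ∏ a ∈ Finset.range d, W r (ζ ^ a * x) = W (r * d) (x ^ d) := by
  refine eq_of_mul_oddP_cong (r := r * d) (x := x ^ d) (by positivity) fun n => ?_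
  refine PCong.trans ?_ (W_mul_oddP_cong (by positivity) n (x ^ d)).symm
  have h1 : oddP (r * d) n (x ^ d) = ∏ a ∈ Finset.range d, oddP r n (ζ ^ a * x) := by
    simp only [oddP]
    rw [Finset.prod_comm]
    refine Finset.prod_congr rfl fun i _ => ?_
    rw [Finset.prod_mul_distrib, (prod_one_sub_root_mul hd hζ x _).1,
      (prod_one_sub_root_mul hd hζ x _).2, show r * d * (2 * i + 1) = r * (2 * i + 1) * d by ring]
  have h2 : evenP (r * d) n (x ^ d) = ∏ a ∈ Finset.range d, evenP r n (ζ ^ a * x) := by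
    simp only [evenP]
    rw [Finset.prod_comm]
    refine Finset.prod_congr rfl fun i _ => ?_
    rw [Finset.prod_mul_distrib, (prod_one_sub_root_mul hd hζ x _).1,
      (prod_one_sub_root_mul hd hζ x _).2, show 2 * (r * d) * (i + 1) = 2 * r * (i + 1) * d by ring]
  rw [h1, h2, ← Finset.prod_mul_distrib]
  exact PCong.prod fun a _ => W_mul_oddP_cong hr n _

/-! ### The generating series of triangular numbers -/

/-- The generating series `∑ q^(s n (n + 1) / 2)` of triangular numbers, in the variable `q^s`. -/
noncomputable def psi (s : ℕ) : PowerSeries ℂ := gf (fun n : ℕ => s * (n * (n + 1) / 2)) fun _ => 1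

/-- The exponents `s * (k * (k + 1) / 2)` over the integers. -/
def eTri (s : ℕ) (k : ℤ) : ℕ := s * (k * (k + 1) / 2).toNat

theorem natAbs_le_eTri {s : ℕ} (hs : 0 < s) (k : ℤ) : k.natAbs ≤ eTri s k + 1 := by
  have h1 := half_mul_succ k
  have : k.natAbs ≤ (k * (k + 1) / 2).toNat + 1 := by
    zify
    rw [Int.toNat_of_nonneg h1.1]
    rcases abs_cases k with ⟨h2, h3⟩ | ⟨h2, h3⟩ <;> rw [h2] <;> nlinarith [sq_nonneg (k - 1)]
  rw [eTri]
  nlinarith [Nat.le_mul_of_pos_left (k * (k + 1) / 2).toNat hs]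

theorem eTri_natCast (s n : ℕ) : eTri s n = s * (n * (n + 1) / 2) := by
  rw [eTri]; congr 1

theorem finFib_tri {s : ℕ} (hs : 0 < s) : FinFib fun n : ℕ => s * (n * (n + 1) / 2) := by
  have := (finFib_int_of_natAbs_le (natAbs_le_eTri hs)).comp_injective Nat.cast_injective
  simpa [Function.comp_def, eTri_natCast] using this

theorem qfac_two_mul {A : Type*} [CommRing A] (s n : ℕ) :
    qfac A s (2 * n) = qfac A (2 * s) n *
      ∏ i ∈ Finset.range n, (1 - PowerSeries.X ^ (s * (2 * i + 1))) := by
  induction n with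
  | zero => simp [qfac]
  | succ n ih =>
    rw [show 2 * (n + 1) = 2 * n + 1 + 1 by ring]
    simp only [qfac] at ih ⊢
    rw [Finset.prod_range_succ _ (2 * n + 1), Finset.prod_range_succ _ (2 * n), ih,
      Finset.prod_range_succ, Finset.prod_range_succ,
      show s * (2 * n + 1 + 1) = 2 * s * (n + 1) by ring]
    ring

theorem two_psi {s : ℕ} (hs : 0 < s) : 2 * psi s = gf (eTri s) fun _ => 1 := by
  have hF := finFib_int_of_natAbs_le (natAbs_le_eTri hs)
  rw [gf_int_fold hF, psi, show (2 : PowerSeries ℂ) = PowerSeries.C 2 from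
    (map_ofNat PowerSeries.C 2).symm, C_mul_gf (finFib_tri hs)]
  · refine gf_equiv (Equiv.refl _) (fun n => (eTri_natCast s n).symm) fun n => by norm_num
  · intro n
    rw [eTri, eTri, Int.negSucc_eq, show -((n : ℤ) + 1) * (-((n : ℤ) + 1) + 1) = n * (n + 1) by ring]

/-- Gauss's product for the generating series of triangular numbers. -/
theorem psi_mul_cong {s : ℕ} (hs : 0 < s) (n : ℕ) :
    PCong n (psi s * ∏ i ∈ Finset.range n, (1 - PowerSeries.X ^ (s * (2 * i + 1))))
      (qfac ℂ (2 * s) n) := by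
  have h := triple_product_cong (A := ℂ) hs (PowerSeries.C ((1 : ℂˣ) : ℂ) * PowerSeries.X ^ s)
    (PowerSeries.C (((1 : ℂˣ)⁻¹ : ℂˣ) : ℂ) * PowerSeries.X ^ 0) (by simp)
    (natAbs_le_eTri hs) (fun k => (((1 : ℂˣ) ^ k : ℂˣ) : ℂ)) (fun k => by
      rw [thetaTerm_C_mul_X, eTri]; simp) n
  simp only [one_zpow, inv_one, Units.val_one, map_one, one_mul, pow_zero, ← pow_add,
    Finset.prod_mul_distrib] at h
  rw [← two_psi hs] at h
  set P := ∏ i ∈ Finset.range n, (1 + (PowerSeries.X : PowerSeries ℂ) ^ (s + s * i)) with hP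
  set O := ∏ i ∈ Finset.range n, (1 - (PowerSeries.X : PowerSeries ℂ) ^ (s * (2 * i + 1))) with hO
  have h1 : PCong n (∏ i ∈ Finset.range n, (1 + (PowerSeries.X : PowerSeries ℂ) ^ (s * i)))
      (2 * P) := by
    have e1 := Finset.prod_range_succ (fun i => 1 + (PowerSeries.X : PowerSeries ℂ) ^ (s * i)) n
    have e2 := Finset.prod_range_succ' (fun i => 1 + (PowerSeries.X : PowerSeries ℂ) ^ (s * i)) n
    rw [e1, mul_zero, pow_zero, one_add_one_eq_two, mul_comm _ (2 : PowerSeries ℂ)] at e2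
    have e3 : ∀ i, s * (i + 1) = s + s * i := fun i => by ring
    simp only [e3] at e2
    rw [hP, ← e2]
    nth_rw 1 [← mul_one (∏ i ∈ Finset.range n, _)]
    refine (PCong.refl _ _).mul ?_
    have := PCong_one_sub (A := ℂ) (n := n) (k := s * n) (by nlinarith) (-1)
    simpa using this.symm
  have h2 : PCong n (psi s) (qfac ℂ s n * P * P) := by
    have h3 : PCong n (PowerSeries.C 2 * psi s) (PowerSeries.C 2 * (qfac ℂ s n * P * P)) := by
      rw [map_ofNat]
      refine h.trans ?_
      rw [show 2 * (qfac ℂ s n * P * P) = qfac ℂ s n * (P * (2 * P)) by ring]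
      exact (PCong.refl _ _).mul ((PCong.refl _ _).mul h1)
    refine PCong.of_unit_mul ?_ h3
    rw [PowerSeries.isUnit_iff_constantCoeff]; simp
  have h4 : qfac ℂ s n * P = qfac ℂ (2 * s) n := by
    rw [qfac, qfac, hP, ← Finset.prod_mul_distrib]
    refine Finset.prod_congr rfl fun i _ => ?_
    rw [show 2 * s * (i + 1) = (s + s * i) + (s + s * i) by ring,
      show s * (i + 1) = s + s * i by ring, pow_add _ (s + s * i)]
    ring
  -- Euler's identity `∏ (1 + q^i) ∏ (1 - q^(2i-1)) = 1`
  have h5 : PCong n (P * O) 1 := by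
    refine PCong.of_unit_mul (isUnit_qfac (A := ℂ) hs n) ?_
    rw [← mul_assoc, h4, hO, ← qfac_two_mul, mul_one]
    exact (qfac_cong hs (by omega)).mono (by omega)
  have h6 := (h2.mul (PCong.refl n O))
  rw [h4, mul_assoc] at h6
  refine h6.trans ?_
  nth_rw 2 [← mul_one (qfac ℂ (2 * s) n)]
  exact (PCong.refl _ _).mul h5

theorem W_one (hr : 0 < r) : W r 1 = psi r ^ 2 := by
  refine eq_of_mul_oddP_cong (x := 1) hr fun n => ?_
  refine (W_mul_oddP_cong hr n 1).trans (PCong.symm ?_)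
  have h1 : oddP r n (1 : ℂˣ) = (∏ i ∈ Finset.range n,
      (1 - PowerSeries.X ^ (r * (2 * i + 1)))) ^ 2 := by
    rw [oddP, ← Finset.prod_pow]; simp [sq]
  have h2 : evenP r n (1 : ℂˣ) = qfac ℂ (2 * r) n ^ 2 := by
    rw [evenP, qfac, ← Finset.prod_pow]; simp [sq]
  rw [h1, h2, ← mul_pow]
  exact (psi_mul_cong hr n).pow 2

end thetaMultiplication

/-! ### The logarithmic derivative of the even theta series -/

section logderiv
variable {r : ℕ}

/-- The Lambert series `∑ q^(r k l) (x^(2k) - x^(-2k))` over `k ≥ 1` and odd `l ≥ 1`. -/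
noncomputable def T2 (r : ℕ) (x : ℂˣ) : PowerSeries ℂ :=
  gf (fun p : ℕ × ℕ => r * ((p.1 + 1) * (2 * p.2 + 1))) fun p =>
    ((x ^ (2 * ((p.1 : ℤ) + 1)) : ℂˣ) : ℂ) - ((x ^ (-(2 * ((p.1 : ℤ) + 1))) : ℂˣ) : ℂ)

theorem finFib_lambert (hr : 0 < r) :
    FinFib fun p : ℕ × ℕ => r * ((p.1 + 1) * (2 * p.2 + 1)) := fun N =>
  ((Finset.range (N + 1) ×ˢ Finset.range (N + 1)).finite_toSet).subset fun p
      (hp : r * ((p.1 + 1) * (2 * p.2 + 1)) ≤ N) => by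
    have h1 : (p.1 + 1) * (2 * p.2 + 1) ≤ N := le_trans (Nat.le_mul_of_pos_left _ hr) hp
    simp only [Finset.coe_product, Set.mem_prod, Finset.coe_range, Set.mem_Iio]
    constructor <;> nlinarith

/-- The geometric series `∑ (q^m z)^k` over `k ≥ 1`. -/
noncomputable def geo (m : ℕ) (z : ℂ) : PowerSeries ℂ :=
  gf (fun k : ℕ => m * (k + 1)) fun k => z ^ (k + 1)

theorem finFib_geo {m : ℕ} (hm : 0 < m) : FinFib fun k : ℕ => m * (k + 1) := fun N =>
  (Set.finite_Iic N).subset fun k (hk : m * (k + 1) ≤ N) => by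
    rw [Set.mem_Iic]; nlinarith

theorem one_sub_mul_geo {m : ℕ} (hm : 0 < m) (z : ℂ) :
    (1 - PowerSeries.X ^ m * PowerSeries.C z) * geo m z = PowerSeries.X ^ m * PowerSeries.C z := by
  have h1 : PowerSeries.X ^ m * PowerSeries.C z * geo m z =
      gf (fun k : ℕ => m * (k + 1 + 1)) fun k => z ^ (k + 1 + 1) := by
    rw [mul_assoc, geo, C_mul_gf (finFib_geo hm), X_pow_mul_gf (finFib_geo hm)]
    congr 1 <;> funext k <;> ring
  have h2 : geo m z = PowerSeries.X ^ m * PowerSeries.C z +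
      gf (fun k : ℕ => m * (k + 1 + 1)) fun k => z ^ (k + 1 + 1) := by
    have h3 := gf_sum (e := fun _ : Unit => m) (e' := fun k : ℕ => m * (k + 1 + 1))
      (finFib_of_finite _) ((finFib_geo hm).of_le fun k => by nlinarith)
      (Sum.elim (fun _ => z) fun k => z ^ (k + 1 + 1))
    simp only [Sum.elim_inl, Sum.elim_inr] at h3
    rw [gf_unique (ι := Unit), PowerSeries.monomial_eq_C_mul_X_pow] at h3
    rw [mul_comm, ← h3, geo]
    refine gf_equiv (Equiv.natSumPUnitEquivNat.symm.trans (Equiv.sumComm _ _)) ?_ ?_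
    · rintro (_ | k)
      · exact Nat.mul_one m
      · rfl
    · rintro (_ | k)
      · exact pow_one z
      · rfl
  rw [sub_mul, h1, one_mul]
  nth_rw 1 [h2]
  ring

theorem T2_cong (hr : 0 < r) (n : ℕ) (x : ℂˣ) :
    PCong n (T2 r x) (∑ i ∈ Finset.range n, (geo (r * (2 * i + 1)) ((x ^ 2 : ℂˣ) : ℂ) -
      geo (r * (2 * i + 1)) (((x ^ 2)⁻¹ : ℂˣ) : ℂ))) := by
  rw [PCong.iff_coeff]
  intro j hj
  rw [T2, coeff_gf_eq_sum _ (Finset.range n ×ˢ Finset.range n), map_sum, Finset.sum_filter,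
    Finset.sum_product_right]
  · refine Finset.sum_congr rfl fun i _ => ?_
    have hs : ∀ k, r * (2 * i + 1) * (k + 1) = j → k ∈ Finset.range n := by
      intro k hk
      rw [Finset.mem_range]
      have : k + 1 ≤ j := hk ▸ Nat.le_mul_of_pos_left _ (by positivity)
      omega
    rw [map_sub, geo, geo, coeff_gf_eq_sum _ _ hs, coeff_gf_eq_sum _ _ hs, ← Finset.sum_sub_distrib,
      Finset.sum_filter]
    refine Finset.sum_congr rfl fun k _ => ?_
    rw [show r * (2 * i + 1) * (k + 1) = r * ((k + 1) * (2 * i + 1)) by ring]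
    congr 1
    rw [← Units.val_pow_eq_pow_val, ← Units.val_pow_eq_pow_val, inv_pow, ← pow_mul, zpow_neg]
    rfl
  · intro p hp
    have h1 : (p.1 + 1) * (2 * p.2 + 1) ≤ j := hp ▸ Nat.le_mul_of_pos_left _ hr
    rw [Finset.mem_product, Finset.mem_range, Finset.mem_range]
    constructor <;> nlinarith

open scoped DualNumber

/-- The unit `1 + c ε` of the dual numbers. -/
def dualUnit (c : ℂ) : (ℂ[ε])ˣ where
  val := 1 + TrivSqZeroExt.inr c
  inv := 1 - TrivSqZeroExt.inr c
  val_inv := by ext <;> simp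
  inv_val := by ext <;> simp

theorem dualUnit_zpow (n : ℤ) : dualUnit 1 ^ n = dualUnit n := by
  have hadd : ∀ a b, dualUnit (a + b) = dualUnit a * dualUnit b := by
    intro a b; ext <;> simp [dualUnit, add_comm]
  have hsub : ∀ a b, dualUnit (a - b) = dualUnit a * (dualUnit b)⁻¹ := by
    intro a b; rw [eq_mul_inv_iff_mul_eq, ← hadd, sub_add_cancel]
  induction n using Int.induction_on with
  | zero => ext <;> simp [dualUnit]
  | succ n ih => rw [zpow_add_one, ih, ← hadd]; push_cast; rfl
  | pred n ih => rw [zpow_sub_one, ih, ← hsub]; push_cast; rfl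

/-- The inclusion of `ℂ` in the dual numbers. -/
noncomputable abbrev inlC : ℂ →+* ℂ[ε] := TrivSqZeroExt.inlHom ℂ ℂ

/-- The point `x (1 + ε)`. -/
noncomputable def dualPt (x : ℂˣ) : (ℂ[ε])ˣ := Units.map (inlC : ℂ →* ℂ[ε]) x * dualUnit 1

theorem dualPt_zpow (x : ℂˣ) (n : ℤ) : ((dualPt x ^ n : (ℂ[ε])ˣ) : ℂ[ε]) =
    inlC ((x ^ n : ℂˣ) : ℂ) + TrivSqZeroExt.inr 1 * inlC (n * ((x ^ n : ℂˣ) : ℂ)) := by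
  rw [dualPt, (Commute.all (Units.map (inlC : ℂ →* ℂ[ε]) x) (dualUnit 1)).mul_zpow, dualUnit_zpow,
    ← map_zpow, Units.val_mul, Units.coe_map]
  generalize x ^ n = y
  ext <;> simp [dualUnit, mul_comm]

theorem map_gf_inl {ι : Type*} {e : ι → ℕ} (h : FinFib e) (a b : ι → ℂ) :
    gf e (fun i => inlC (a i) + TrivSqZeroExt.inr 1 * inlC (b i)) =
      PowerSeries.map inlC (gf e a) + PowerSeries.C (TrivSqZeroExt.inr 1 : ℂ[ε]) *
        PowerSeries.map inlC (gf e b) := by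
  rw [map_gf h, map_gf h, C_mul_gf h, gf_add h]

theorem th4_dualPt (hr : 0 < r) (x : ℂˣ) : th4 r (dualPt x) = PowerSeries.map inlC (th4 r x) +
    PowerSeries.C (TrivSqZeroExt.inr 1 : ℂ[ε]) * PowerSeries.map inlC (dth4 r x) := by
  simp only [th4, dth4, th4w]
  rw [← map_gf_inl (finFib_eSq hr)]
  congr 1; funext n
  rw [Units.val_mul, dualPt_zpow]
  have : (((-1) ^ n : (ℂ[ε])ˣ) : ℂ[ε]) = inlC (((-1) ^ n : ℂˣ) : ℂ) := by
    have : ((-1 : (ℂ[ε])ˣ)) = Units.map (inlC : ℂ →* ℂ[ε]) (-1) := by ext <;> simp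
    rw [this, ← map_zpow]; rfl
  rw [this]
  ext
  · simp
  · simp
    ring

theorem eps_mul_eps : (PowerSeries.C (TrivSqZeroExt.inr 1 : ℂ[ε])) *
    PowerSeries.C (TrivSqZeroExt.inr 1 : ℂ[ε]) = 0 := by
  rw [← map_mul, TrivSqZeroExt.inr_mul_inr, map_zero]

theorem one_sub_dual {m : ℕ} (hm : 0 < m) (z c : ℂ) :
    (1 : PowerSeries ℂ[ε]) - PowerSeries.X ^ m *
      PowerSeries.C (inlC z + TrivSqZeroExt.inr 1 * inlC (c * z)) =
    PowerSeries.map inlC (1 - PowerSeries.X ^ m * PowerSeries.C z) *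
      (1 - PowerSeries.C (TrivSqZeroExt.inr 1 : ℂ[ε]) *
        PowerSeries.map inlC (PowerSeries.C c * geo m z)) := by
  have h := congrArg (PowerSeries.map inlC) (one_sub_mul_geo hm z)
  simp only [map_mul, map_sub, map_one, map_pow, PowerSeries.map_X, PowerSeries.map_C, map_add]
    at h ⊢
  linear_combination (PowerSeries.C (TrivSqZeroExt.inr 1 : ℂ[ε]) * PowerSeries.C (inlC c)) * h

/-- The logarithmic derivative of the product for `th4` is a Lambert series. -/
theorem dth4_eq (hr : 0 < r) (x : ℂˣ) : dth4 r x = -2 * T2 r x * th4 r x := by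
  set E : PowerSeries ℂ[ε] := PowerSeries.C (TrivSqZeroExt.inr 1 : ℂ[ε]) with hE
  have hEE : E * E = 0 := eps_mul_eps
  refine eq_of_forall_PCong fun n => ?_
  set G := ∑ i ∈ Finset.range n, (geo (r * (2 * i + 1)) ((x ^ 2 : ℂˣ) : ℂ) -
      geo (r * (2 * i + 1)) (((x ^ 2)⁻¹ : ℂˣ) : ℂ)) with hG
  have h2 : oddP r n (dualPt x) = PowerSeries.map inlC (oddP r n x) *
      (1 - E * PowerSeries.map inlC (2 * G)) := by
    rw [oddP, oddP, hG]
    have e2 : (((dualPt x) ^ 2 : (ℂ[ε])ˣ) : ℂ[ε]) = inlC ((x ^ 2 : ℂˣ) : ℂ) +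
        TrivSqZeroExt.inr 1 * inlC (2 * ((x ^ 2 : ℂˣ) : ℂ)) := by
      simpa using dualPt_zpow x 2
    have e3 : ((((dualPt x) ^ 2)⁻¹ : (ℂ[ε])ˣ) : ℂ[ε]) = inlC (((x ^ 2)⁻¹ : ℂˣ) : ℂ) +
        TrivSqZeroExt.inr 1 * inlC (-2 * (((x ^ 2)⁻¹ : ℂˣ) : ℂ)) := by
      have := dualPt_zpow x (-2)
      rw [zpow_neg, zpow_neg] at this
      simpa using this
    rw [e2, e3]
    clear hG G
    induction n with
    | zero => simp
    | succ n ih =>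
      rw [Finset.prod_range_succ, Finset.prod_range_succ, Finset.sum_range_succ, ih,
        one_sub_dual (by positivity), one_sub_dual (by positivity)]
      simp only [map_mul, map_neg, map_add, map_sub, map_ofNat]
      generalize PowerSeries.map inlC (∏ i ∈ Finset.range n, _) = P
      rw [← hE]
      generalize PowerSeries.map inlC (∑ i ∈ Finset.range n, _) = S
      generalize PowerSeries.map inlC (geo _ ((x ^ 2 : ℂˣ) : ℂ)) = a
      generalize PowerSeries.map inlC (geo _ (((x ^ 2)⁻¹ : ℂˣ) : ℂ)) = b
      generalize PowerSeries.map inlC 1 - _ * PowerSeries.map inlC (PowerSeries.C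
        ((x ^ 2 : ℂˣ) : ℂ)) = M
      generalize PowerSeries.map inlC 1 - _ * PowerSeries.map inlC (PowerSeries.C
        (((x ^ 2)⁻¹ : ℂˣ) : ℂ)) = M'
      linear_combination (P * M * M' * (4 * S * a - 4 * S * b - 4 * a * b + 8 * E * S * a * b)) *
        hEE
  have h1 := th4_cong hr n (dualPt x)
  rw [h2, th4_dualPt hr, ← hE] at h1
  have h3 := (th4_cong hr n x).map inlC
  have hq : qfac ℂ[ε] (2 * r) n = PowerSeries.map inlC (qfac ℂ (2 * r) n) := by
    simp [qfac, map_prod]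
  have h4 : PCong n (E * PowerSeries.map inlC (dth4 r x))
      (E * PowerSeries.map inlC (-2 * G * th4 r x)) := by
    have h5 := h1.sub h3
    have h6 := (PCong.refl n (E * PowerSeries.map inlC (-2 * G))).mul h3
    rw [hq, map_mul] at h5
    have h7 : E * PowerSeries.map inlC (-2 * G) * PowerSeries.map inlC (th4 r x) =
        E * PowerSeries.map inlC (-2 * G * th4 r x) := by rw [map_mul _ _ (th4 r x), mul_assoc]
    rw [h7] at h6
    refine PCong.trans ?_ h6.symm
    convert h5 using 1
    · ring
    · simp only [map_mul, map_neg]; ring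
  have h8 : PCong n (dth4 r x) (-2 * G * th4 r x) := by
    rw [PCong.iff_coeff] at h4 ⊢
    intro j hj
    have h9 := h4 j hj
    rw [hE, PowerSeries.coeff_C_mul, PowerSeries.coeff_C_mul, PowerSeries.coeff_map,
      PowerSeries.coeff_map] at h9
    have h10 := congrArg TrivSqZeroExt.snd h9
    simpa using h10
  refine h8.trans (((PCong.refl _ _).mul (T2_cong hr n x).symm).mul (PCong.refl _ _))

/-- The addition theorem for the Lambert series `T2`, which is the logarithmic derivative of `th4`
up to the factor `-2`. -/
theorem T2_three_term (hr : 0 < r) (a b : ℂˣ) : T2 r a + T2 r b - T2 r (a * b) =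
    PowerSeries.X ^ r * psi r ^ 2 * (w r a * w r b * w r (a * b)) := by
  have h := dth4_three_term hr a b
  rw [dth4_eq hr, dth4_eq hr, dth4_eq hr, dth1_one hr, ← W_mul_th4 hr, W_one hr,
    ← w_mul_th4 hr a, ← w_mul_th4 hr b, ← w_mul_th4 hr (a * b)] at h
  have hne : (-2 : PowerSeries ℂ) * (th4 r a * th4 r b * th4 r (a * b) * th4 r 1) ≠ 0 :=
    mul_ne_zero (neg_ne_zero.2 two_powerSeries_ne_zero) (mul_ne_zero (mul_ne_zero (mul_ne_zero
      (th4_ne_zero hr _) (th4_ne_zero hr _)) (th4_ne_zero hr _)) (th4_ne_zero hr _))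
  refine mul_left_cancel₀ hne ?_
  linear_combination h

end logderiv

/-! ### The Lambert series over odd indices -/

section lambert

/-- The Lambert series `∑ q^(k l) (x^k - x^(-k))` over odd `k, l ≥ 1`. -/
noncomputable def S1 (x : ℂˣ) : PowerSeries ℂ :=
  gf (fun p : ℕ × ℕ => (2 * p.1 + 1) * (2 * p.2 + 1)) fun p =>
    ((x ^ (2 * (p.1 : ℤ) + 1) : ℂˣ) : ℂ) - ((x ^ (-(2 * (p.1 : ℤ) + 1)) : ℂˣ) : ℂ)

/-- The imaginary unit as a unit. -/
noncomputable def unitI : ℂˣ := Units.mk0 Complex.I Complex.I_ne_zero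

theorem unitI_sq : unitI ^ 2 = -1 := by ext; simp [unitI]

theorem unitI_zpow_two_mul (n : ℤ) : unitI ^ (2 * n) = (-1) ^ n := by
  rw [zpow_mul, zpow_ofNat, unitI_sq]

theorem T2_unitI (r : ℕ) : T2 r unitI = 0 := by
  rw [T2, ← gf_zero]
  congr 1; funext p
  rw [← mul_neg, unitI_zpow_two_mul, unitI_zpow_two_mul, neg_one_zpow_neg, sub_self]

/-- Pairs with even first entry. -/
def evenFstEquiv : ℕ × ℕ ≃ {p : ℕ × ℕ // Even p.1} where
  toFun p := ⟨(2 * p.1, p.2), even_two_mul _⟩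
  invFun p := (p.1.1 / 2, p.1.2)
  left_inv p := by ext <;> simp
  right_inv := by
    rintro ⟨⟨a, b⟩, c, hc⟩
    ext <;> simp at hc ⊢; omega

theorem T2_sub_T2 (y : ℂˣ) : T2 1 y - T2 1 (y * unitI) = 2 * S1 (y ^ 2) := by
  have h := finFib_lambert one_pos
  rw [T2, T2, gf_sub h, gf_split h (fun p => Even p.1), ← map_ofNat PowerSeries.C 2, S1, C_mul_gf]
  · rw [gf_equiv (ι := {p : ℕ × ℕ // ¬Even p.1}) (Equiv.refl _) (fun _ => rfl)
      (b := fun _ => (0 : ℂ)), gf_zero, add_zero]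
    · refine (gf_equiv evenFstEquiv (fun p => by simp [evenFstEquiv]) fun p => ?_).symm
      simp only [evenFstEquiv, Equiv.coe_fn_mk]
      rw [← mul_neg, mul_zpow, mul_zpow, unitI_zpow_two_mul, unitI_zpow_two_mul, neg_one_zpow_neg,
        Odd.neg_one_zpow (by push_cast; exact odd_two_mul_add_one _), ← zpow_natCast y 2,
        ← zpow_mul, ← zpow_mul]
      push_cast
      ring
    · rintro ⟨p, hp⟩
      rw [← mul_neg, mul_zpow, mul_zpow, unitI_zpow_two_mul, unitI_zpow_two_mul, neg_one_zpow_neg,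
        Even.neg_one_zpow (by exact_mod_cast Odd.add_one (Nat.not_even_iff_odd.1 hp))]
      simp
  · refine ((finFib_lambert one_pos).comp_injective
      (f := fun p : ℕ × ℕ => (2 * p.1, p.2)) ?_).of_le fun p => ?_
    · rintro ⟨a, b⟩ ⟨c, d⟩ h
      simpa using h
    · simp

theorem isPrimitiveRoot_unitI_sq : IsPrimitiveRoot (unitI ^ 2) 2 := by
  rw [unitI_sq]
  rw [← IsPrimitiveRoot.coe_units_iff, Units.val_neg, Units.val_one]
  exact IsPrimitiveRoot.neg_one 0 two_ne_zero.symm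

theorem W_mul_W_unitI (y : ℂˣ) : W 1 y * W 1 (y * unitI) = W 2 (y ^ 2) := by
  have h := prod_W one_pos (d := 2) two_pos isPrimitiveRoot_unitI_sq y
  rw [Finset.prod_range_succ, Finset.prod_range_one] at h
  simpa [mul_comm] using h

theorem unitI_mul_self : (unitI : ℂ) * unitI = -1 := Complex.I_mul_I

/-- The Lambert series over odd indices is a multiple of a theta quotient: `2 * S1 (y ^ 2)` is the
difference of `T2` at `y` and at `y * i`, which the addition theorem for `T2` evaluates. -/
theorem S1_eq (x : ℂˣ) : S1 x = -(PowerSeries.X * psi 2 ^ 2 * w 2 x) := by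
  obtain ⟨y, rfl⟩ := exists_sq_eq_unit x
  have h := T2_three_term one_pos y unitI
  rw [T2_unitI, add_zero, T2_sub_T2] at h
  have h1 := W_mul_W_unitI 1
  rw [one_mul, W_one one_pos, one_pow, W_one two_pos] at h1
  have hI : ((unitI⁻¹ : ℂˣ) : ℂ) = -unitI := by simp [unitI]
  have h2 := w_eq_mul_W one_pos unitI
  have h3 := w_eq_mul_W one_pos (y * unitI)
  have h4 := w_eq_mul_W two_pos (y ^ 2)
  rw [w_eq_mul_W one_pos y, h2, h3, pow_one] at h
  refine mul_left_cancel₀ two_powerSeries_ne_zero ?_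
  rw [h4, ← W_mul_W_unitI, ← h1, h]
  rw [mul_inv, Units.val_mul, Units.val_mul, hI]
  simp only [map_mul, map_sub, map_neg, ← inv_pow, Units.val_pow_eq_pow_val]
  have hI2 : PowerSeries.C (unitI : ℂ) * PowerSeries.C (unitI : ℂ) = -1 := by
    rw [← map_mul, unitI_mul_self]; simp
  simp only [map_pow]
  generalize PowerSeries.C (unitI : ℂ) = I at *
  generalize PowerSeries.C (y : ℂ) = a
  generalize PowerSeries.C ((y⁻¹ : ℂˣ) : ℂ) = b
  linear_combination (2 * PowerSeries.X * psi 1 ^ 2 * W 1 unitI * W 1 y * W 1 (y * unitI) *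
    (b ^ 2 - a ^ 2)) * hI2

end lambert

/-! ### Sums over points of an Edwards curve -/

section edwards
open Polynomial
variable {L : Type*} [Field L]

/-- Polynomials expressing `(sⁿ - s'ⁿ) / (s - s')`, for `s s' = lam`, in terms of the `B` with
`B + B⁻¹ = κ (s + s')`. -/
noncomputable def dickson' (κ lam : L) : ℕ → L[X]
  | 0 => 0
  | 1 => 1
  | n + 2 => C κ⁻¹ * (X ^ 2 + 1) * dickson' κ lam (n + 1) - C lam * X ^ 2 * dickson' κ lam n

theorem natDegree_dickson'_le (κ lam : L) (n : ℕ) :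
    (dickson' κ lam n).natDegree ≤ 2 * n - 2 := by
  induction n using Nat.strong_induction_on with
  | _ n ih =>
    match n with
    | 0 => simp [dickson']
    | 1 => simp [dickson']
    | 2 => simp only [dickson', mul_one, mul_zero, sub_zero]; compute_degree
    | n + 3 =>
      rw [dickson']
      have h1 := ih (n + 2) (by omega)
      have h2 := ih (n + 1) (by omega)
      refine (natDegree_sub_le _ _).trans (max_le (natDegree_mul_le.trans ?_)
        (natDegree_mul_le.trans ?_))
      · have : (C κ⁻¹ * (X ^ 2 + 1) : L[X]).natDegree ≤ 2 := by compute_degree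
        rw [show n + 1 + 1 = n + 2 from rfl]
        omega
      · have : (C lam * X ^ 2 : L[X]).natDegree ≤ 2 := by compute_degree
        omega

theorem eval_dickson' {κ lam s s' B : L} (hκ : κ ≠ 0) (hs : s * s' = lam)
    (hB : B ^ 2 + 1 = κ * (s + s') * B) (n : ℕ) :
    B * (s - s') * (dickson' κ lam n).eval B = B ^ n * (s ^ n - s' ^ n) := by
  induction n using Nat.strong_induction_on with
  | _ n ih =>
    match n with
    | 0 => simp [dickson']
    | 1 => simp [dickson']
    | n + 2 =>
      have h1 := ih (n + 1) (by omega)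
      have h2 := ih n (by omega)
      rw [dickson']
      simp only [eval_sub, eval_mul, eval_C, eval_add, eval_pow, eval_X, eval_one]
      rw [hB, show κ⁻¹ * (κ * (s + s') * B) = (s + s') * B by field_simp]
      linear_combination (s + s') * B * h1 - lam * B ^ 2 * h2 +
        B ^ (n + 2) * (s ^ n - s' ^ n) * hs

variable {ι : Type*} [Fintype ι] [DecidableEq ι]

/-- A vanishing sum over an even number of points `(A, B)` of the curve
`B + B⁻¹ = κ (A⁻¹ + lam A)`: by the symmetry of the curve under `A ↦ (lam A)⁻¹` the summand is a
value at `B` of a polynomial of small degree, divided by the derivative of the nodal polynomial. -/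
theorem edwards_sum {κ lam : L} (hκ : κ ≠ 0) (hlam : lam ≠ 0) {m : ℕ}
    (hcard : Fintype.card ι = 2 * m + 2) (A B : ι → L) (hA : ∀ j, A j ≠ 0) (hB : ∀ j, B j ≠ 0)
    (hinj : Function.Injective B) (hA2 : ∀ j, lam * A j ^ 2 ≠ 1)
    (hcurve : ∀ j, B j ^ 2 + 1 = κ * ((A j)⁻¹ + lam * A j) * B j) :
    ∑ j, (B j / A j) ^ m *
      ∏ k ∈ Finset.univ.erase j, ((1 - lam * A j * A k) / (B k - B j)) = 0 := by
  -- With `s = (A j)⁻¹` and `s' = lam * A j`, the summand is `sᵐ⁺¹ q (s⁻¹) - s'ᵐ⁺¹ q (s'⁻¹)` up to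
  -- simple factors, because `q` vanishes at `s'⁻¹`. This is antisymmetric in `s, s'`, hence
  -- divisible by `s - s'`; the quotient, rewritten in terms of `B j`, is the value at `B j` of
  -- `D`.
  set q : L[X] := ∏ k, (1 - C (lam * A k) * X) with hq
  have hqd : q.natDegree < 2 * m + 3 := by
    have : q.natDegree ≤ ∑ k : ι, 1 :=
      (natDegree_prod_le _ _).trans (Finset.sum_le_sum fun k _ => by compute_degree)
    simp [hcard] at this
    omega
  set D : L[X] := ∑ i ∈ Finset.range (2 * m + 3), C (q.coeff i) *
    (if i ≤ m + 1 then X ^ i * dickson' κ lam (m + 1 - i) else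
      -C ((lam⁻¹) ^ (i - (m + 1))) * (X ^ (2 * m + 2 - i) * dickson' κ lam (i - (m + 1)))) with hD
  have hDd : D.natDegree ≤ 2 * m := by
    refine natDegree_sum_le_of_forall_le _ _ fun i hi => ?_
    rw [Finset.mem_range] at hi
    refine (natDegree_C_mul_le _ _).trans ?_
    split_ifs with h
    · rcases h.eq_or_lt with rfl | h'
      · simp [dickson']
      · refine natDegree_mul_le.trans ?_
        have := natDegree_dickson'_le κ lam (m + 1 - i)
        rw [natDegree_X_pow]; omega
    · rw [← C_neg]
      refine (natDegree_C_mul_le _ _).trans (natDegree_mul_le.trans ?_)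
      have := natDegree_dickson'_le κ lam (i - (m + 1))
      rw [natDegree_X_pow]; omega
  have hval : ∀ j, D.eval (B j) = (B j / A j) ^ m *
      ∏ k ∈ Finset.univ.erase j, (1 - lam * A j * A k) := by
    intro j
    have hAj := hA j
    have hBj := hB j
    set s := (A j)⁻¹ with hs
    set s' := lam * A j with hs'
    have hss : s * s' = lam := by rw [hs, hs']; field_simp
    have hs'0 : s' ≠ 0 := mul_ne_zero hlam hAj
    have hsA : s * A j = 1 := inv_mul_cancel₀ hAj
    have hsi : s' * s'⁻¹ = 1 := mul_inv_cancel₀ hs'0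
    have hls : lam⁻¹ * s' = A j := by rw [hs', ← mul_assoc, inv_mul_cancel₀ hlam, one_mul]
    have hls' : lam⁻¹ * s = s'⁻¹ := by rw [hs', hs, mul_inv]
    have h0 : q.eval (s'⁻¹) = 0 := by
      rw [hq, eval_prod]
      refine Finset.prod_eq_zero (Finset.mem_univ j) ?_
      simp only [eval_sub, eval_one, eval_mul, eval_C, eval_X]
      rw [mul_inv_cancel₀ hs'0, sub_self]
    have h1 : q.eval (A j) = (1 - lam * A j ^ 2) *
        ∏ k ∈ Finset.univ.erase j, (1 - lam * A j * A k) := by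
      rw [hq, eval_prod, ← Finset.mul_prod_erase _ _ (Finset.mem_univ j)]
      simp only [eval_sub, eval_one, eval_mul, eval_C, eval_X]
      congr 1
      · ring
      · exact Finset.prod_congr rfl fun k _ => by ring
    have h2 : B j * (s - s') * D.eval (B j) = B j ^ (m + 1) * (s ^ (m + 1) * q.eval (A j) -
        s' ^ (m + 1) * q.eval (s'⁻¹)) := by
      rw [hD, eval_finsetSum, eval_eq_sum_range' hqd, eval_eq_sum_range' hqd, Finset.mul_sum,
        Finset.mul_sum, Finset.mul_sum, ← Finset.sum_sub_distrib, Finset.mul_sum]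
      refine Finset.sum_congr rfl fun i hi => ?_
      rw [Finset.mem_range] at hi
      have key := eval_dickson' hκ hss (hcurve j)
      split_ifs with h
      · obtain ⟨n, hn⟩ := Nat.exists_eq_add_of_le h
        have key := key n
        rw [hn, Nat.add_sub_cancel_left]
        simp only [eval_mul, eval_C, eval_pow, eval_X]
        have e1 : s ^ (i + n) * A j ^ i = s ^ n := by
          rw [pow_add, mul_right_comm, ← mul_pow, hsA, one_pow, one_mul]
        have e2 : s' ^ (i + n) * s'⁻¹ ^ i = s' ^ n := by
          rw [pow_add, mul_right_comm, ← mul_pow, hsi, one_pow, one_mul]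
        linear_combination q.coeff i * B j ^ i * key - q.coeff i * B j ^ (i + n) * e1 +
          q.coeff i * B j ^ (i + n) * e2
      · obtain ⟨n, hn⟩ := Nat.exists_eq_add_of_le (not_le.1 h).le
        have key := key n
        rw [show i - (m + 1) = n by omega]
        simp only [eval_mul, eval_C, eval_pow, eval_X, eval_neg]
        have e0 : B j ^ (2 * m + 2 - i) * B j ^ n = B j ^ (m + 1) := by
          rw [← pow_add]; congr 1; omega
        have e1 : s ^ (m + 1) * A j ^ i = lam⁻¹ ^ n * s' ^ n := by
          rw [← mul_pow, hls, hn, pow_add _ (m + 1) n, ← mul_assoc, ← mul_pow, hsA, one_pow, one_mul]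
        have e2 : s' ^ (m + 1) * s'⁻¹ ^ i = lam⁻¹ ^ n * s ^ n := by
          rw [← mul_pow, hls', hn, pow_add _ (m + 1) n, ← mul_assoc, ← mul_pow, hsi, one_pow, one_mul]
        linear_combination -q.coeff i * lam⁻¹ ^ n * B j ^ (2 * m + 2 - i) * key -
          q.coeff i * lam⁻¹ ^ n * (s ^ n - s' ^ n) * e0 -
          q.coeff i * B j ^ (m + 1) * e1 + q.coeff i * B j ^ (m + 1) * e2
    rw [h0, h1, mul_zero, sub_zero] at h2
    have h3 : 1 - lam * A j ^ 2 ≠ 0 := sub_ne_zero.2 (hA2 j).symm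
    have h4 : s - s' = (1 - lam * A j ^ 2) * s := by rw [hs, hs']; field_simp
    rw [h4] at h2
    have h5 : B j * ((1 - lam * A j ^ 2) * s) ≠ 0 :=
      mul_ne_zero hBj (mul_ne_zero h3 (inv_ne_zero hAj))
    refine mul_left_cancel₀ h5 (h2.trans ?_)
    rw [div_eq_mul_inv, mul_pow]
    ring
  -- As `D` has degree at most `2 m`, its coefficient in degree `2 m + 1` vanishes; by Lagrange
  -- interpolation at the `2 m + 2` nodes `B j` that coefficient is the sum in question, up to sign.
  have hdeg : D.degree < (Finset.univ : Finset ι).card := by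
    rw [Finset.card_univ, hcard]
    exact (degree_le_of_natDegree_le hDd).trans_lt (by exact_mod_cast (by omega))
  have h := Lagrange.coeff_eq_sum (s := Finset.univ) (v := B) hinj.injOn hdeg
  rw [Finset.card_univ, hcard, coeff_eq_zero_of_natDegree_lt (by omega)] at h
  rw [← neg_eq_zero, ← Finset.sum_neg_distrib, h]
  refine Finset.sum_congr rfl fun j _ => ?_
  rw [hval, Finset.prod_div_distrib, ← neg_one_mul]
  have : ∏ k ∈ Finset.univ.erase j, (B k - B j) = -∏ k ∈ Finset.univ.erase j, (B j - B k) := by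
    rw [← neg_one_mul, show (-1 : L) = (-1) ^ (Finset.univ.erase j).card by
      rw [Finset.card_erase_of_mem (Finset.mem_univ _), Finset.card_univ, hcard,
        Odd.neg_one_pow ⟨m, by omega⟩], ← Finset.prod_const, ← Finset.prod_mul_distrib]
    exact Finset.prod_congr rfl fun k _ => by ring
  rw [this, div_neg]
  ring

end edwards

/-! ### Families with an addition formula -/

section additionFamily
variable {L : Type*} [Field L] {ι : Type*}

/-- A family `f` of pairwise quantities which is expressed by an addition formula through points
`(u, v)` of the curve `u² + v² = σ² (1 + lam u² v²)`, together with the non-degeneracy conditions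
that make all denominators below non-zero. -/
structure IsAdditionFamily (lam σ : L) (u v : ι → L) (f : ι → ι → L) : Prop where
  lam_ne : lam ≠ 0
  sigma_ne : σ ≠ 0
  u_ne : ∀ j, u j ≠ 0
  v_ne : ∀ j, v j ≠ 0
  add : ∀ j k, f j k * σ * (1 - lam * (u j * v j) * (u k * v k)) = u j * v k - v j * u k
  curve : ∀ j, u j ^ 2 + v j ^ 2 = σ ^ 2 * (1 + lam * u j ^ 2 * v j ^ 2)
  f_ne : ∀ j k, j ≠ k → f j k ≠ 0
  one_sub_ne : ∀ j k, 1 - lam * (u j * v j) * (u k * v k) ≠ 0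
  mul_ne : ∀ j k, j ≠ k → u j * u k ≠ v j * v k

namespace IsAdditionFamily
variable {lam σ : L} {u v : ι → L} {f : ι → ι → L}

theorem self (h : IsAdditionFamily lam σ u v f) (j : ι) : f j j = 0 := by
  have h1 := h.add j j
  rw [show u j * v j - v j * u j = 0 by ring] at h1
  exact ((mul_eq_zero.1 h1).resolve_right (h.one_sub_ne j j) |> mul_eq_zero.1).resolve_right
    h.sigma_ne

theorem antisymm (h : IsAdditionFamily lam σ u v f) (j k : ι) : f k j = -f j k := by
  refine mul_right_cancel₀ (mul_ne_zero h.sigma_ne (h.one_sub_ne j k)) ?_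
  linear_combination h.add j k + h.add k j

/-- The second form of the addition formula. -/
theorem add' (h : IsAdditionFamily lam σ u v f) (j k : ι) :
    f j k * (u j * u k - v j * v k) = σ * (u k * v k - u j * v j) := by
  refine mul_right_cancel₀ (mul_ne_zero h.sigma_ne (h.one_sub_ne j k)) ?_
  linear_combination (u j * u k - v j * v k) * h.add j k + u k * v k * h.curve j -
    u j * v j * h.curve k

theorem comp (h : IsAdditionFamily lam σ u v f) {κ : Type*} {g : κ → ι} (hg : g.Injective) :
    IsAdditionFamily lam σ (u ∘ g) (v ∘ g) fun j k => f (g j) (g k) where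
  lam_ne := h.lam_ne
  sigma_ne := h.sigma_ne
  u_ne _ := h.u_ne _
  v_ne _ := h.v_ne _
  add _ _ := h.add _ _
  curve _ := h.curve _
  f_ne _ _ hjk := h.f_ne _ _ (hg.ne hjk)
  one_sub_ne _ _ := h.one_sub_ne _ _
  mul_ne _ _ hjk := h.mul_ne _ _ (hg.ne hjk)

theorem sub_ne (h : IsAdditionFamily lam σ u v f) {j k : ι} (hjk : j ≠ k) :
    u j * v k - v j * u k ≠ 0 := by
  rw [← h.add]
  exact mul_ne_zero (mul_ne_zero (h.f_ne j k hjk) h.sigma_ne) (h.one_sub_ne j k)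

/-- In the coordinates `A = u v`, `B = v / u`, the factors of `edwards_sum` are the inverses of the
`f j k`, up to products of one-variable factors. -/
theorem edwards_factor (h : IsAdditionFamily lam σ u v f) {j k : ι} (hjk : j ≠ k) :
    (1 - lam * (u j * v j) * (u k * v k)) / (v k / u k - v j / u j) =
      (u j * u k / σ) * (f j k)⁻¹ := by
  have h1 := h.u_ne j
  have h2 := h.u_ne k
  have h3 := h.f_ne j k hjk
  have h4 := h.sigma_ne
  have h5 := h.sub_ne hjk
  rw [div_sub_div _ _ h2 h1, show v k * u j - u k * v j = u j * v k - v j * u k by ring,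
    div_div_eq_mul_div, div_eq_iff h5, ← h.add]
  field_simp

theorem curve_div (h : IsAdditionFamily lam σ u v f) (j : ι) :
    (v j / u j) ^ 2 + 1 = σ ^ 2 * ((u j * v j)⁻¹ + lam * (u j * v j)) * (v j / u j) := by
  have h1 := h.u_ne j
  have h2 := h.v_ne j
  have h3 := h.curve j
  field_simp
  linear_combination h3

theorem div_injective (h : IsAdditionFamily lam σ u v f) :
    Function.Injective fun j => v j / u j := fun j k hjk => by
  by_contra hne
  have h1 := h.u_ne j
  have h2 := h.u_ne k
  apply h.sub_ne hne
  have hjk : v j / u j = v k / u k := hjk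
  rw [div_eq_div_iff h1 h2] at hjk
  linear_combination -hjk

variable [Fintype ι] [DecidableEq ι]

theorem prod_erase_const_div {m : ℕ} (hcard : Fintype.card ι = 2 * m + 2)
    (j : ι) : (∏ k ∈ Finset.univ.erase j, (u j * u k / σ)) =
      (u j ^ 2) ^ m * (∏ k, u k) / σ ^ (2 * m + 1) := by
  rw [Finset.prod_div_distrib, Finset.prod_mul_distrib, Finset.prod_const, Finset.prod_const,
    Finset.card_erase_of_mem (Finset.mem_univ _), Finset.card_univ, hcard,
    ← Finset.mul_prod_erase _ _ (Finset.mem_univ j), show 2 * m + 2 - 1 = 2 * m + 1 by omega]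
  ring

/-- The analogue of the vanishing of `∑ j, ∏ k ≠ j, (x j - x k)⁻¹`; it holds only for an even number
of points. -/
theorem sum_prod_inv (h : IsAdditionFamily lam σ u v f) {m : ℕ}
    (hcard : Fintype.card ι = 2 * m + 2) :
    ∑ j, (∏ k ∈ Finset.univ.erase j, f j k)⁻¹ = 0 := by
  have key := edwards_sum (pow_ne_zero 2 h.sigma_ne) h.lam_ne hcard (fun j => u j * v j)
    (fun j => v j / u j) (fun j => mul_ne_zero (h.u_ne j) (h.v_ne j))
    (fun j => div_ne_zero (h.v_ne j) (h.u_ne j)) h.div_injective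
    (fun j hj => h.one_sub_ne j j (by linear_combination -hj)) h.curve_div
  have hP : (∏ k, u k) ≠ 0 := Finset.prod_ne_zero_iff.2 fun k _ => h.u_ne k
  have hc : (∏ k, u k) / σ ^ (2 * m + 1) ≠ 0 := div_ne_zero hP (pow_ne_zero _ h.sigma_ne)
  refine mul_left_cancel₀ hc ?_
  rw [mul_zero, ← key, Finset.mul_sum]
  refine Finset.sum_congr rfl fun j _ => ?_
  rw [Finset.prod_congr rfl fun k hk => h.edwards_factor (Finset.ne_of_mem_erase hk).symm,
    Finset.prod_mul_distrib, prod_erase_const_div hcard, Finset.prod_inv_distrib]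
  have h1 := h.u_ne j
  have h2 := h.v_ne j
  have : v j / u j / (u j * v j) = (u j ^ 2)⁻¹ := by field_simp
  rw [this, inv_pow]
  field_simp

/-- The sum of `edwards_sum` with the `i`-th point `(A, B)` of the curve replaced by its mirror
image `((lam A)⁻¹, B⁻¹)`; by the second form of the addition formula, this replaces `(f j i)⁻¹` by
a multiple of `f j i`. -/
theorem sum_sq_mul_prod_inv (h : IsAdditionFamily lam σ u v f) {m : ℕ}
    (hcard : Fintype.card ι = 2 * m + 2) (i : ι) :
    ∑ j, f i j ^ 2 * (∏ k ∈ Finset.univ.erase j, f j k)⁻¹ =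
      -lam ^ m * ∏ k ∈ Finset.univ.erase i, f i k := by
  have hui := h.u_ne i
  have hvi := h.v_ne i
  have hl := h.lam_ne
  have hσ := h.sigma_ne
  set A := fun j => u j * v j with hA
  set B := fun j => v j / u j with hB
  have hA0 : ∀ j, A j ≠ 0 := fun j => mul_ne_zero (h.u_ne j) (h.v_ne j)
  have hB0 : ∀ j, B j ≠ 0 := fun j => div_ne_zero (h.v_ne j) (h.u_ne j)
  have hBB : ∀ j, j ≠ i → B j ≠ (B i)⁻¹ := by
    intro j hj he
    apply h.mul_ne j i hj
    have := h.u_ne j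
    simp only [hB, inv_div] at he
    rw [div_eq_div_iff this hvi] at he
    linear_combination -he
  have hinj : Function.Injective (Function.update B i (B i)⁻¹) := by
    intro j k hjk
    by_cases hj : j = i <;> by_cases hk : k = i
    · rw [hj, hk]
    · subst hj
      rw [Function.update_self, Function.update_of_ne hk] at hjk
      exact absurd hjk.symm (hBB k hk)
    · subst hk
      rw [Function.update_self, Function.update_of_ne hj] at hjk
      exact absurd hjk (hBB j hj)
    · rw [Function.update_of_ne hj, Function.update_of_ne hk] at hjk
      exact h.div_injective hjk
  have hA2 : ∀ j, lam * A j ^ 2 ≠ 1 := fun j hj => h.one_sub_ne j j (by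
    simp only [hA] at hj
    linear_combination -hj)
  have key := edwards_sum (pow_ne_zero 2 hσ) hl hcard
    (Function.update A i (lam * A i)⁻¹) (Function.update B i (B i)⁻¹)
    (fun j => by
      by_cases hj : j = i
      · subst hj; rw [Function.update_self]; exact inv_ne_zero (mul_ne_zero hl (hA0 _))
      · rw [Function.update_of_ne hj]; exact hA0 j)
    (fun j => by
      by_cases hj : j = i
      · subst hj; rw [Function.update_self]; exact inv_ne_zero (hB0 _)
      · rw [Function.update_of_ne hj]; exact hB0 j) hinj
    (fun j => by
      by_cases hj : j = i
      · subst hj; rw [Function.update_self]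
        intro he
        have := hA0 j
        field_simp at he
        exact hA2 j he.symm
      · rw [Function.update_of_ne hj]; exact hA2 j)
    (fun j => by
      by_cases hj : j = i
      · subst hj; rw [Function.update_self, Function.update_self]
        have h1 := h.curve_div j
        have h2 := hA0 j
        have h3 := hB0 j
        change B j ^ 2 + 1 = σ ^ 2 * ((A j)⁻¹ + lam * A j) * B j at h1
        field_simp at h1 ⊢
        linear_combination h1
      · rw [Function.update_of_ne hj, Function.update_of_ne hj]; exact h.curve_div j)
  have hE : ∀ j, j ≠ i → (1 - lam * (lam * A i)⁻¹ * A j) / (B j - (B i)⁻¹) =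
      u j / (σ * u i) * f i j := by
    intro j hj
    have h1 := h.u_ne j
    have h2 := h.add' i j
    rw [div_eq_iff (sub_ne_zero.2 (hBB j hj))]
    simp only [hA, hB]
    field_simp
    linear_combination h2
  rw [← Finset.add_sum_erase _ _ (Finset.mem_univ i)] at key ⊢
  rw [h.self, zero_pow two_ne_zero, zero_mul, zero_add]
  have hP : (∏ k, u k) ≠ 0 := Finset.prod_ne_zero_iff.2 fun k _ => h.u_ne k
  have hc : (∏ k, u k) / σ ^ (2 * m + 1) ≠ 0 := div_ne_zero hP (pow_ne_zero _ h.sigma_ne)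
  have hcu : (∏ k, u k) / σ ^ (2 * m + 1) / u i ^ 2 ≠ 0 := div_ne_zero hc (pow_ne_zero _ hui)
  refine mul_left_cancel₀ hcu ?_
  have e1 : ∀ j ∈ Finset.univ.erase i,
      (Function.update B i (B i)⁻¹ j / Function.update A i (lam * A i)⁻¹ j) ^ m *
        ∏ k ∈ Finset.univ.erase j, ((1 - lam * Function.update A i (lam * A i)⁻¹ j *
          Function.update A i (lam * A i)⁻¹ k) /
          (Function.update B i (B i)⁻¹ k - Function.update B i (B i)⁻¹ j)) =
      (∏ k, u k) / σ ^ (2 * m + 1) / u i ^ 2 *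
        (f i j ^ 2 * (∏ k ∈ Finset.univ.erase j, f j k)⁻¹) := by
    intro j hj
    have hj := Finset.ne_of_mem_erase hj
    rw [Function.update_of_ne hj, Function.update_of_ne hj]
    have h1 := h.u_ne j
    have h2 := h.v_ne j
    have hf := h.f_ne i j hj.symm
    have e2 : ∀ k ∈ Finset.univ.erase j, ((1 - lam * A j * Function.update A i (lam * A i)⁻¹ k) /
          (Function.update B i (B i)⁻¹ k - B j)) =
        (u j * u k / σ) * (f j k)⁻¹ * (if k = i then f i j ^ 2 / u i ^ 2 else 1) := by
      intro k hk
      by_cases hki : k = i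
      · subst hki
        rw [Function.update_self, Function.update_self, if_pos rfl, h.antisymm k j,
          show (1 - lam * A j * (lam * A k)⁻¹) / ((B k)⁻¹ - B j) =
            -((1 - lam * (lam * A k)⁻¹ * A j) / (B j - (B k)⁻¹)) by
            rw [← div_neg, neg_sub, mul_right_comm], hE j hj]
        field_simp
      · rw [Function.update_of_ne hki, Function.update_of_ne hki, if_neg hki, mul_one,
          ← h.edwards_factor (Finset.ne_of_mem_erase hk).symm]
    rw [Finset.prod_congr rfl e2, Finset.prod_mul_distrib, Finset.prod_mul_distrib,
      Finset.prod_ite_eq', if_pos (Finset.mem_erase.2 ⟨hj.symm, Finset.mem_univ i⟩),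
      prod_erase_const_div hcard, Finset.prod_inv_distrib]
    have : B j / A j = (u j ^ 2)⁻¹ := by simp only [hA, hB]; field_simp
    rw [this, inv_pow]
    field_simp
  rw [Finset.sum_congr rfl e1, ← Finset.mul_sum, add_comm, ← eq_neg_iff_add_eq_zero] at key
  rw [key, Function.update_self, Function.update_self]
  have e3 : ∀ k ∈ Finset.univ.erase i, (1 - lam * (lam * A i)⁻¹ *
      Function.update A i (lam * A i)⁻¹ k) / (Function.update B i (B i)⁻¹ k - (B i)⁻¹) =
      u i * u k / σ * f i k / u i ^ 2 := by
    intro k hk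
    have hk := Finset.ne_of_mem_erase hk
    rw [Function.update_of_ne hk, Function.update_of_ne hk, hE k hk]
    field_simp
  rw [Finset.prod_congr rfl e3, Finset.prod_div_distrib, Finset.prod_mul_distrib,
    prod_erase_const_div hcard, Finset.prod_const,
    Finset.card_erase_of_mem (Finset.mem_univ _), Finset.card_univ, hcard,
    show 2 * m + 2 - 1 = 2 * m + 1 by omega]
  have : (B i)⁻¹ / (lam * A i)⁻¹ = lam * u i ^ 2 := by simp only [hA, hB]; field_simp
  rw [this, mul_pow]
  field_simp
  ring

end IsAdditionFamily
end additionFamily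

/-! ### The theta quotients as an addition family -/

section thetaFamily
variable {r : ℕ}

/-- A base point at which none of the theta quotients below degenerates. -/
theorem exists_generic_unit {ι : Type*} [Finite ι] (x : ι → ℂˣ) :
    ∃ o : ℂˣ, (∀ j, (x j / o) ^ 4 ≠ 1) ∧ ∀ j k, (x j / o) ^ 2 * (x k / o) ^ 2 ≠ -1 := by
  have : Infinite ℂˣ := Infinite.of_injective
    (fun n : ℕ => Units.mk0 ((n : ℂ) + 1) (Nat.cast_add_one_ne_zero n)) fun a b h => by
      simpa using congrArg Units.val h
  have hfin : (Set.range (fun j => x j ^ 4) ∪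
      Set.range fun p : ι × ι => -(x p.1 ^ 2 * x p.2 ^ 2)).Finite :=
    (Set.finite_range _).union (Set.finite_range _)
  obtain ⟨t, ht⟩ := hfin.exists_notMem
  obtain ⟨s, rfl⟩ := exists_sq_eq_unit t
  obtain ⟨o, rfl⟩ := exists_sq_eq_unit s
  refine ⟨o, fun j hj => ht (Or.inl ⟨j, ?_⟩), fun j k hjk => ht (Or.inr ⟨(j, k), ?_⟩)⟩
  · rw [div_pow, div_eq_one] at hj
    exact hj.trans (by rw [← pow_mul])
  · rw [div_pow, div_pow, div_mul_div_comm, div_eq_iff_eq_mul] at hjk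
    simp only
    rw [hjk, neg_mul, neg_neg, one_mul, ← pow_add, ← pow_mul]

theorem constantCoeff_one_sub_X_pow_mul (hr : 0 < r) (f : PowerSeries ℂ) :
    PowerSeries.constantCoeff (1 - PowerSeries.X ^ r * f) = 1 := by
  simp [hr.ne']

/-- The values `w (x j / x k)` form an addition family: `u` and `v` are the values of `w` at a
generic base point and at its multiple by the imaginary unit. -/
theorem exists_isAdditionFamily_w (hr : 0 < r) {ι : Type*} [Finite ι] (x : ι → ℂˣ)
    (hx : ∀ j k, j ≠ k → x j ^ 2 ≠ x k ^ 2) :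
    ∃ (σ : FractionRing (PowerSeries ℂ)) (u v : ι → FractionRing (PowerSeries ℂ)),
      IsAdditionFamily (algebraMap (PowerSeries ℂ) _ (PowerSeries.X ^ r)) σ u v
        fun j k => algebraMap (PowerSeries ℂ) _ (w r (x j / x k)) := by
  obtain ⟨o, ho1, ho2⟩ := exists_generic_unit x
  set φ := algebraMap (PowerSeries ℂ) (FractionRing (PowerSeries ℂ)) with hφ
  have hinj : Function.Injective φ := IsFractionRing.injective _ _
  have hne : ∀ {f}, f ≠ 0 → φ f ≠ 0 := fun h => (map_ne_zero_iff φ hinj).2 h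
  -- With `p = i o`, the four-term relation at `x j, x k, o, p` is the addition formula, and at
  -- `x j, i x j, o, p` it is the equation of the curve.
  set p := unitI * o with hp
  have hop : o / p = unitI⁻¹ := by rw [hp, div_mul_cancel_right]
  have hII : unitI * unitI = -1 := by rw [← sq, unitI_sq]
  have hIi : unitI⁻¹ = -unitI := inv_eq_of_mul_eq_one_right (by rw [mul_neg, hII, neg_neg])
  have hxp : ∀ j, x j / p = -unitI * (x j / o) := fun j => by
    rw [hp, ← hIi, div_eq_mul_inv, div_eq_mul_inv, mul_inv, mul_left_comm]
  refine ⟨φ (w r (o / p)), fun j => φ (w r (x j / o)), fun j => φ (w r (x j / p)), ?_⟩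
  refine ⟨hne (pow_ne_zero _ PowerSeries.X_ne_zero), hne ?_, fun j => hne ?_, fun j => hne ?_,
    fun j k => ?_, fun j => ?_, fun j k hjk => hne ?_, fun j k => ?_, fun j k hjk => ?_⟩
  · refine w_ne_zero hr ?_
    rw [hop, inv_pow, unitI_sq, inv_neg, inv_one]
    intro h
    have := congrArg Units.val h
    norm_num at this
  · exact w_ne_zero hr fun h => ho1 j (by rw [show 4 = 2 * 2 from rfl, pow_mul, h, one_pow])
  · refine w_ne_zero hr fun h => ho1 j ?_
    rw [hxp, mul_pow, neg_sq, unitI_sq, neg_one_mul, neg_eq_iff_eq_neg] at h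
    rw [show 4 = 2 * 2 from rfl, pow_mul, h, neg_one_sq]
  · have h := congrArg φ (w_four_term hr (x j) (x k) o p)
    simp only [map_add, map_sub, map_mul] at h
    linear_combination h
  · have h := congrArg φ (w_four_term hr (x j) (unitI * x j) o p)
    have e1 : x j / (unitI * x j) = o / p := by
      rw [hp, div_mul_cancel_right, div_mul_cancel_right]
    have e2 : unitI * x j / p = x j / o := by rw [hp, mul_div_mul_left_eq_div]
    have e3 : unitI * x j / o = -(x j / p) := by
      rw [hxp, neg_mul, neg_neg, mul_div_assoc]
    rw [e1, e2, e3, w_neg hr] at h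
    simp only [map_add, map_sub, map_mul, map_neg] at h
    linear_combination -h
  · refine w_ne_zero hr ?_
    rw [div_pow, Ne, div_eq_one]
    exact hx j k hjk
  · rw [← map_mul, ← map_mul, ← map_mul, ← map_mul, ← map_one φ, ← map_sub]
    refine hne fun h => ?_
    have h1 := constantCoeff_one_sub_X_pow_mul hr
      (w r (x j / o) * w r (x j / p) * (w r (x k / o) * w r (x k / p)))
    rw [← mul_assoc, h, map_zero] at h1
    exact zero_ne_one h1
  · rw [← map_mul, ← map_mul]
    refine hinj.ne fun h => ho2 j k ?_
    have h := congrArg PowerSeries.constantCoeff h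
    simp only [map_mul, constantCoeff_w hr, hxp] at h
    set a := x j / o
    set b := x k / o
    have ha : (a : ℂ) ≠ 0 := a.ne_zero
    have hb : (b : ℂ) ≠ 0 := b.ne_zero
    have hI : (unitI : ℂ) ≠ 0 := unitI.ne_zero
    have hI2 : (unitI : ℂ) * unitI = -1 := unitI_mul_self
    have hI4 : ((unitI⁻¹ : ℂˣ) : ℂ) = -unitI := by rw [hIi]; simp
    rw [mul_inv, mul_inv] at h
    push_cast [inv_neg] at h
    rw [Units.val_inv_eq_inv_val] at hI4
    rw [hI4] at h
    ext
    push_cast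
    field_simp at h
    have h5 : (2 : ℂ) * ((a : ℂ) ^ 2 * b ^ 2 + 1) = 0 := by
      linear_combination h + (1 + (a : ℂ) ^ 2) * (1 + (b : ℂ) ^ 2) * hI2
    linear_combination h5 / 2

end thetaFamily

/-! ### Alternating sums over two-column minors -/

section minors
variable {R : Type*} [CommRing R]

/-- The product of `f i j` over all pairs `i < j`. -/
def pairProd {N : ℕ} (f : Fin N → Fin N → R) : R := ∏ a, ∏ b, if a < b then f a b else 1

theorem prod_ite_castSucc_lt {n : ℕ} (i : Fin (n + 1)) :
    (∏ k : Fin n, if i.succAbove k < i then (-1 : R) else 1) = (-1) ^ (i : ℕ) := by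
  rw [Finset.prod_ite, Finset.prod_const, Finset.prod_const_one, mul_one]
  congr 1
  simp only [Fin.succAbove_lt_iff_castSucc_lt]
  rw [← Finset.card_map Fin.castSuccEmb]
  have : Finset.map Fin.castSuccEmb (Finset.univ.filter fun k : Fin n => k.castSucc < i) =
      Finset.Iio i := by
    ext a
    simp only [Finset.mem_map, Finset.mem_filter, Finset.mem_univ, true_and, Finset.mem_Iio]
    constructor
    · rintro ⟨k, hk, rfl⟩; exact hk
    · intro ha
      exact ⟨a.castPred (ne_of_lt (ha.trans_le (Fin.le_last i))), by simpa using ha, by simp⟩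
  rw [this, Fin.card_Iio]

/-- Expansion of the product over pairs with respect to the index `i`. -/
theorem pairProd_succAbove {n : ℕ} {f : Fin (n + 1) → Fin (n + 1) → R}
    (hf : ∀ i j, f j i = -f i j) (i : Fin (n + 1)) :
    pairProd f = (-1) ^ (i : ℕ) * (∏ k, f i (i.succAbove k)) *
      pairProd fun a b => f (i.succAbove a) (i.succAbove b) := by
  rw [pairProd, Fin.prod_univ_succAbove _ i, Fin.prod_univ_succAbove _ i]
  simp only [Fin.prod_univ_succAbove _ i, lt_irrefl, if_false, one_mul, Finset.prod_mul_distrib,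
    Fin.succAbove_lt_succAbove_iff]
  rw [← mul_assoc, ← Finset.prod_mul_distrib, ← prod_ite_castSucc_lt, ← Finset.prod_mul_distrib,
    pairProd]
  rw [← Finset.prod_mul_distrib, ← Finset.prod_mul_distrib]
  refine Finset.prod_congr rfl fun k _ => congrArg₂ (· * ·) ?_ rfl
  rcases lt_or_gt_of_ne (Fin.succAbove_ne i k) with h | h
  · rw [if_neg h.not_gt, if_pos h, if_pos h, hf]; ring
  · rw [if_pos h, if_neg h.not_gt, if_neg h.not_gt]; ring

theorem prod_erase_eq_succAbove {n : ℕ} (g : Fin (n + 1) → R) (i : Fin (n + 1)) :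
    ∏ a ∈ Finset.univ.erase i, g a = ∏ l, g (i.succAbove l) := by
  rw [Fin.univ_succAbove n i, Finset.erase_cons, Finset.prod_map]; rfl

theorem prod_erase_succAbove {n : ℕ} (g : Fin (n + 1) → R) (i : Fin (n + 1)) (k : Fin n) :
    ∏ a ∈ Finset.univ.erase (i.succAbove k), g a =
      g i * ∏ l ∈ Finset.univ.erase k, g (i.succAbove l) := by
  have h1 : ∀ {n : ℕ} (j : Fin n) (g : Fin n → R), ∏ a ∈ Finset.univ.erase j, g a =
      ∏ a, if a = j then (1 : R) else g a := by
    intro n j g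
    rw [Finset.prod_ite, Finset.prod_const_one, one_mul]
    refine Finset.prod_congr ?_ fun _ _ => rfl
    ext a; simp
  rw [h1, h1, Fin.prod_univ_succAbove _ i, if_neg (Fin.succAbove_ne i k).symm]
  simp only [Fin.succAbove_right_inj]

end minors

section minorsField
variable {L : Type*} [Field L]

/-- An alternating sum over the pairs of rows of a two-column minor, as a sum over pairs. -/
theorem two_mul_sum_minors {n : ℕ} {f U S : Fin (n + 2) → Fin (n + 2) → L}
    (hf : ∀ i j, f j i = -f i j) (h0 : ∀ i, f i i = 0) (hne : ∀ i j, i ≠ j → f i j ≠ 0)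
    (hS : ∀ i j, U i j - U j i = S i j) :
    2 * ∑ i : Fin (n + 2), ∑ j : Fin (n + 1), (-1) ^ ((i : ℕ) + j) * U i (i.succAbove j) *
        pairProd (fun a b : Fin n => f (i.succAbove (j.succAbove a)) (i.succAbove (j.succAbove b)))
      = pairProd f * ∑ i, ∑ j, S i j * f j i * (∏ k ∈ Finset.univ.erase i, f i k)⁻¹ *
          (∏ k ∈ Finset.univ.erase j, f j k)⁻¹ := by
  set R : Fin (n + 2) → L := fun i => ∏ k ∈ Finset.univ.erase i, f i k with hR
  have hR0 : ∀ i, R i ≠ 0 := fun i =>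
    Finset.prod_ne_zero_iff.2 fun k hk => hne i k (Finset.ne_of_mem_erase hk).symm
  have h1 : ∑ i : Fin (n + 2), ∑ j : Fin (n + 1), (-1) ^ ((i : ℕ) + j) * U i (i.succAbove j) *
        pairProd (fun a b : Fin n => f (i.succAbove (j.succAbove a)) (i.succAbove (j.succAbove b)))
      = pairProd f * ∑ i, ∑ j, U i j * f j i * (R i)⁻¹ * (R j)⁻¹ := by
    rw [Finset.mul_sum]
    refine Finset.sum_congr rfl fun i _ => ?_
    rw [Fin.sum_univ_succAbove _ i, h0, mul_zero, zero_mul, zero_mul, zero_add, Finset.mul_sum]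
    refine Finset.sum_congr rfl fun j _ => ?_
    have e1 := pairProd_succAbove hf i
    have e2 := pairProd_succAbove (f := fun a b => f (i.succAbove a) (i.succAbove b))
      (fun a b => hf _ _) j
    have e3 : R (i.succAbove j) = f (i.succAbove j) i *
        ∏ l, f (i.succAbove j) (i.succAbove (j.succAbove l)) := by
      simp only [hR]
      rw [prod_erase_succAbove, prod_erase_eq_succAbove]
    have e4 : R i = ∏ k, f i (i.succAbove k) := prod_erase_eq_succAbove _ _
    rw [e1, e2, ← e4]
    have h5 : ∏ l, f (i.succAbove j) (i.succAbove (j.succAbove l)) ≠ 0 := fun h =>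
      hR0 (i.succAbove j) (by rw [e3, h, mul_zero])
    have h6 := hne _ _ (Fin.succAbove_ne i j)
    have h7 := hR0 i
    rw [e3, pow_add]
    field_simp
  rw [h1, two_mul]
  nth_rw 2 [Finset.sum_comm]
  rw [← mul_add, ← Finset.sum_add_distrib]
  congr 1
  refine Finset.sum_congr rfl fun i _ => ?_
  rw [← Finset.sum_add_distrib]
  refine Finset.sum_congr rfl fun j _ => ?_
  rw [← hS, hf j i]
  ring

/-- The evaluation that carries the induction on the size of determinants with odd exponents: there
`U i j` is the generating function of `(y i / y j) ^ k`, and `hU` is the Lambert series `S1`. -/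
theorem sum_minors_even {m n : ℕ} (hn : n = 2 * m) {lam σ c : L} {u v : Fin (n + 2) → L}
    {f U : Fin (n + 2) → Fin (n + 2) → L} (h : IsAdditionFamily lam σ u v f)
    (hU : ∀ i j, U i j - U j i = -c * f i j) :
    2 * ∑ i : Fin (n + 2), ∑ j : Fin (n + 1), (-1) ^ ((i : ℕ) + j) * U i (i.succAbove j) *
        pairProd (fun a b : Fin n => f (i.succAbove (j.succAbove a)) (i.succAbove (j.succAbove b)))
      = -(c * lam ^ m * (2 * m + 2) * pairProd f) := by
  subst hn
  rw [two_mul_sum_minors h.antisymm h.self h.f_ne hU]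
  have hR0 : ∀ i, (∏ k ∈ Finset.univ.erase i, f i k) ≠ 0 := fun i =>
    Finset.prod_ne_zero_iff.2 fun k hk => h.f_ne i k (Finset.ne_of_mem_erase hk).symm
  have key : ∀ i, ∑ j, -c * f i j * f j i * (∏ k ∈ Finset.univ.erase i, f i k)⁻¹ *
      (∏ k ∈ Finset.univ.erase j, f j k)⁻¹ = -c * lam ^ m := by
    intro i
    have h1 := h.sum_sq_mul_prod_inv (m := m) (by simp) i
    have h2 : ∀ j, -c * f i j * f j i * (∏ k ∈ Finset.univ.erase i, f i k)⁻¹ *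
      (∏ k ∈ Finset.univ.erase j, f j k)⁻¹ = c * (∏ k ∈ Finset.univ.erase i, f i k)⁻¹ *
        (f i j ^ 2 * (∏ k ∈ Finset.univ.erase j, f j k)⁻¹) := by
      intro j; rw [h.antisymm i j]; ring
    rw [Finset.sum_congr rfl fun j _ => h2 j, ← Finset.mul_sum, h1]
    have := hR0 i
    field_simp
  rw [Finset.sum_congr rfl fun i _ => key i, Finset.sum_const, Finset.card_univ, Fintype.card_fin]
  simp only [nsmul_eq_mul]
  push_cast
  ring

/-- The evaluation that carries the induction for even exponents; here `hU` is the addition theorem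
for the Lambert series `T2`, with the point of index `0` as base point. -/
theorem sum_minors_odd {m n : ℕ} (hn : n = 2 * m + 1) {lam σ c : L} {u v : Fin (n + 2) → L}
    {f U : Fin (n + 2) → Fin (n + 2) → L} (h : IsAdditionFamily lam σ u v f) (T : Fin (n + 2) → L)
    (hU : ∀ i j, U i j - U j i = T i - T j + c * f i j * f i 0 * f j 0) :
    2 * ∑ i : Fin (n + 2), ∑ j : Fin (n + 1), (-1) ^ ((i : ℕ) + j) * U i (i.succAbove j) *
        pairProd (fun a b : Fin n => f (i.succAbove (j.succAbove a)) (i.succAbove (j.succAbove b)))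
      = c * lam ^ m * (2 * m + 2) * pairProd f := by
  subst hn
  rw [two_mul_sum_minors h.antisymm h.self h.f_ne hU]
  set R : Fin (2 * m + 3) → L := fun i => ∏ k ∈ Finset.univ.erase i, f i k with hR
  have hR0 : ∀ i, R i ≠ 0 := fun i =>
    Finset.prod_ne_zero_iff.2 fun k hk => h.f_ne i k (Finset.ne_of_mem_erase hk).symm
  have hsucc : ∀ i k, R (i.succAbove k) =
      f (i.succAbove k) i * ∏ l ∈ Finset.univ.erase k, f (i.succAbove k) (i.succAbove l) :=
    fun i k => prod_erase_succAbove _ _ _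
  have hE : ∀ i, ∑ j, f j i * (R j)⁻¹ = 0 := by
    intro i
    have h1 := (h.comp (Fin.succAbove_right_injective (p := i))).sum_prod_inv (m := m) (by simp)
    rw [Fin.sum_univ_succAbove _ i, h.self, zero_mul, zero_add, ← h1]
    refine Finset.sum_congr rfl fun k _ => ?_
    have := h.f_ne _ _ (Fin.succAbove_ne i k)
    rw [hsucc, mul_inv, ← mul_assoc, mul_inv_cancel₀ this, one_mul]
  -- The terms with `T` cancel by `hE`. In the remaining term the index `0` drops out, which
  -- leaves an even number of points, to which the second evaluation applies.
  have h3 : ∀ i j, (T i - T j + c * f i j * f i 0 * f j 0) * f j i * (R i)⁻¹ * (R j)⁻¹ =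
      T i * (R i)⁻¹ * (f j i * (R j)⁻¹) + T j * (R j)⁻¹ * (f i j * (R i)⁻¹) -
        c * (f i 0 * (R i)⁻¹) * (f i j ^ 2 * (f j 0 * (R j)⁻¹)) := by
    intro i j; rw [h.antisymm i j]; ring
  have h4 : ∑ i, ∑ j, (c * (f i 0 * (R i)⁻¹) * (f i j ^ 2 * (f j 0 * (R j)⁻¹))) =
      -(c * lam ^ m * (2 * m + 2)) := by
    rw [Fin.sum_univ_succAbove _ 0]
    have : ∑ j, c * (f 0 0 * (R 0)⁻¹) * (f 0 j ^ 2 * (f j 0 * (R j)⁻¹)) = 0 :=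
      Finset.sum_eq_zero fun j _ => by rw [h.self]; ring
    rw [this, zero_add]
    have hc := h.comp (Fin.succAbove_right_injective (p := (0 : Fin (2 * m + 3))))
    have key : ∀ i, ∑ j, c * (f (Fin.succAbove 0 i) 0 * (R (Fin.succAbove 0 i))⁻¹) *
        (f (Fin.succAbove 0 i) j ^ 2 * (f j 0 * (R j)⁻¹)) = -c * lam ^ m := by
      intro i
      rw [Fin.sum_univ_succAbove _ 0, h.self 0, zero_mul, mul_zero, mul_zero, zero_add]
      have h1 := hc.sum_sq_mul_prod_inv (m := m) (by simp) i
      have h2 : ∀ k, f (Fin.succAbove 0 k) 0 * (R (Fin.succAbove 0 k))⁻¹ =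
          (∏ l ∈ Finset.univ.erase k, f (Fin.succAbove 0 k) (Fin.succAbove 0 l))⁻¹ := by
        intro k
        have := h.f_ne _ _ (Fin.succAbove_ne 0 k)
        rw [hsucc, mul_inv, ← mul_assoc, mul_inv_cancel₀ this, one_mul]
      simp only [h2]
      rw [← Finset.mul_sum, h1]
      have : ∏ l ∈ Finset.univ.erase i, f (Fin.succAbove 0 i) (Fin.succAbove 0 l) ≠ 0 :=
        Finset.prod_ne_zero_iff.2 fun k hk => hc.f_ne i k (Finset.ne_of_mem_erase hk).symm
      field_simp
    rw [Finset.sum_congr rfl fun i _ => key i, Finset.sum_const, Finset.card_univ,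
      Fintype.card_fin]
    simp only [nsmul_eq_mul]
    push_cast
    ring
  change pairProd f * ∑ i, ∑ j, (T i - T j + c * f i j * f i 0 * f j 0) * f j i * (R i)⁻¹ *
    (R j)⁻¹ = _
  simp only [h3, Finset.sum_sub_distrib, Finset.sum_add_distrib]
  rw [h4]
  have h5 : ∑ i, ∑ j, T i * (R i)⁻¹ * (f j i * (R j)⁻¹) = 0 :=
    Finset.sum_eq_zero fun i _ => by rw [← Finset.mul_sum, hE, mul_zero]
  rw [h5, Finset.sum_comm]
  have h6 : ∑ j, ∑ i, T j * (R j)⁻¹ * (f i j * (R i)⁻¹) = 0 := h5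
  rw [h6]
  ring

end minorsField

/-! ### Generating functions of generalised Vandermonde determinants -/

section genDet

/-- The generalised Vandermonde determinant `det (yᵢ ^ Kⱼ)` with integer exponents. -/
noncomputable def zvander {N : ℕ} (y : Fin N → ℂˣ) (K : Fin N → ℤ) : ℂ :=
  (Matrix.of fun i j => ((y i ^ K j : ℂˣ) : ℂ)).det

/-- The exponents `(k₁, -k₁, k₂, -k₂, …)`, followed by `ε` zeros. -/
def pmVec (ε : ℕ) : (m : ℕ) → (Fin m → ℤ) → Fin (ε + 2 * m) → ℤ
  | 0, _ => 0
  | m + 1, k => (Fin.cons (k 0) (Fin.cons (-k 0) (pmVec ε m (Fin.tail k)) :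
      Fin (ε + 2 * m + 1) → ℤ) : Fin (ε + 2 * m + 1 + 1) → ℤ)

/-- Expansion of a generalised Vandermonde determinant along its first two columns. -/
theorem zvander_cons_cons {N : ℕ} (y : Fin (N + 2) → ℂˣ) (a b : ℤ) (K : Fin N → ℤ) :
    zvander y (Fin.cons a (Fin.cons b K : Fin (N + 1) → ℤ)) =
      ∑ i : Fin (N + 2), ∑ j : Fin (N + 1), (-1) ^ ((i : ℕ) + j) *
        (((y i ^ a * y (i.succAbove j) ^ b : ℂˣ) : ℂ) *
          zvander (fun l => y (i.succAbove (j.succAbove l))) K) := by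
  rw [zvander, Matrix.det_succ_column_zero]
  refine Finset.sum_congr rfl fun i _ => ?_
  rw [Matrix.det_succ_column_zero, Finset.mul_sum]
  refine Finset.sum_congr rfl fun j _ => ?_
  simp only [Matrix.of_apply, Matrix.submatrix_apply, Matrix.submatrix_submatrix, Fin.cons_zero,
    Fin.cons_succ, Units.val_mul, zvander, pow_add]
  have : ((Matrix.of fun (i : Fin (N + 2)) (j : Fin (N + 2)) => ((y i ^
      (Fin.cons a (Fin.cons b K : Fin (N + 1) → ℤ) : Fin (N + 2) → ℤ) j : ℂˣ) : ℂ)).submatrix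
        (i.succAbove ∘ j.succAbove) (Fin.succ ∘ Fin.succ)) =
      Matrix.of fun i' j' => ((y (i.succAbove (j.succAbove i')) ^ K j' : ℂˣ) : ℂ) := by
    ext i' j'
    simp
  rw [this]
  ring

variable {κ : Type*}

theorem FinFib.pi {e : κ → ℕ} (h : FinFib e) (m : ℕ) :
    FinFib fun s : Fin m → κ => ∑ i, e (s i) := fun N =>
  (Set.Finite.pi' fun _ : Fin m => h N).subset fun s (hs : ∑ i, e (s i) ≤ N) i =>
    (Finset.single_le_sum (f := fun i => e (s i)) (fun _ _ => Nat.zero_le _)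
      (Finset.mem_univ i)).trans hs

/-- The generating function, over `m`-tuples `s` of indices, of the generalised Vandermonde
determinants with exponents `± a (sᵢ)`. -/
noncomputable def genDet (e : κ → ℕ) (a : κ → ℤ) (ε m : ℕ) (y : Fin (ε + 2 * m) → ℂˣ) :
    PowerSeries ℂ :=
  gf (fun s : Fin m → κ => ∑ i, e (s i)) fun s => zvander y (pmVec ε m fun i => a (s i))

theorem genDet_zero (e : κ → ℕ) (a : κ → ℤ) {ε : ℕ} (hε : ε ≤ 1) (y : Fin (ε + 2 * 0) → ℂˣ) :
    genDet e a ε 0 y = 1 := by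
  rw [genDet, gf_unique]
  simp only [Finset.univ_eq_empty, Finset.sum_empty, zvander, pmVec]
  have : (Matrix.of fun (i : Fin (ε + 2 * 0)) (j : Fin (ε + 2 * 0)) =>
      ((y i ^ (0 : Fin (ε + 2 * 0) → ℤ) j : ℂˣ) : ℂ)).det = 1 := by
    interval_cases ε
    · exact Matrix.det_isEmpty (n := Fin 0)
    · exact (Matrix.det_unique (n := Fin 1) _).trans (by simp)
  rw [this]
  simp

/-- Expansion along the two columns that belong to the first index: a sum over pairs of rows, in
which that index enters through a single series alone. -/
theorem genDet_succ {e : κ → ℕ} (h : FinFib e) (a : κ → ℤ) (ε m : ℕ)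
    (y : Fin (ε + 2 * m + 2) → ℂˣ) :
    genDet e a ε (m + 1) y = ∑ i : Fin (ε + 2 * m + 2), ∑ j : Fin (ε + 2 * m + 1),
      (-1) ^ ((i : ℕ) + j) * gf e (fun p => (((y i / y (i.succAbove j)) ^ a p : ℂˣ) : ℂ)) *
        genDet e a ε m (fun l => y (i.succAbove (j.succAbove l))) := by
  have hC : ∀ n : ℕ, (-1 : PowerSeries ℂ) ^ n = PowerSeries.C ((-1) ^ n) := by
    intro n; simp
  have hs := h.add (h.pi m)
  simp only [genDet]
  simp only [hC, mul_assoc, gf_mul h (h.pi m), C_mul_gf hs, gf_finsetSum hs]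
  refine (gf_equiv (Fin.consEquiv fun _ : Fin (m + 1) => κ) (fun p => ?_) fun p => ?_).symm
  · simp [Fin.consEquiv, Fin.sum_univ_succ]
  · change _ = zvander y (Fin.cons (a p.1) (Fin.cons (-a p.1) (pmVec ε m fun i => a (p.2 i)) :
      Fin (ε + 2 * m + 1) → ℤ))
    rw [zvander_cons_cons]
    refine Finset.sum_congr rfl fun i _ => Finset.sum_congr rfl fun j _ => ?_
    rw [zpow_neg, div_zpow, div_eq_mul_inv]

theorem gf_sub_gf_inv {e : κ → ℕ} (h : FinFib e) (a : κ → ℤ) (x : ℂˣ) :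
    gf e (fun p => ((x ^ a p : ℂˣ) : ℂ)) - gf e (fun p => ((x⁻¹ ^ a p : ℂˣ) : ℂ)) =
      gf e fun p => ((x ^ a p : ℂˣ) : ℂ) - ((x ^ (-a p) : ℂˣ) : ℂ) := by
  rw [gf_sub h]
  simp only [inv_zpow, zpow_neg]

theorem finFib_oddLambert : FinFib fun p : ℕ × ℕ => (2 * p.1 + 1) * (2 * p.2 + 1) := by
  have h := (finFib_lambert one_pos).comp_injective (f := fun p : ℕ × ℕ => (2 * p.1, p.2))
    (by rintro ⟨a, b⟩ ⟨c, d⟩ h; simpa using h)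
  simpa [Function.comp_def] using h

theorem map_pairProd {R S : Type*} [CommRing R] [CommRing S] (φ : R →+* S) {N : ℕ}
    (f : Fin N → Fin N → R) : φ (pairProd f) = pairProd fun i j => φ (f i j) := by
  simp only [pairProd, map_prod]
  refine Finset.prod_congr rfl fun i _ => Finset.prod_congr rfl fun j _ => ?_
  split_ifs <;> simp

/-- The generating function of generalised Vandermonde determinants with odd exponents. The
induction expands along two columns; the two-column minors are values of the Lambert series `S1`.
-/
theorem genDet_odd (m : ℕ) (y : Fin (0 + 2 * m) → ℂˣ) (hy : ∀ i j, i ≠ j → y i ^ 2 ≠ y j ^ 2) :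
    genDet (fun p : ℕ × ℕ => (2 * p.1 + 1) * (2 * p.2 + 1)) (fun p => 2 * (p.1 : ℤ) + 1) 0 m y =
      (-1) ^ m * (m.factorial : PowerSeries ℂ) * PowerSeries.X ^ (m ^ 2) * psi 2 ^ (2 * m) *
        pairProd fun i j => w 2 (y i / y j) := by
  induction m with
  | zero => rw [genDet_zero _ _ zero_le_one]; simp [pairProd]
  | succ m ih =>
    have hy' : ∀ (i : Fin (0 + 2 * m + 2)) (j : Fin (0 + 2 * m + 1)), ∀ a b, a ≠ b →
        y (i.succAbove (j.succAbove a)) ^ 2 ≠ y (i.succAbove (j.succAbove b)) ^ 2 :=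
      fun i j a b hab => hy _ _ (Fin.succAbove_right_injective.ne
        (Fin.succAbove_right_injective.ne hab))
    rw [genDet_succ finFib_oddLambert]
    simp only [ih _ (hy' _ _)]
    obtain ⟨σ, u, v, hfam⟩ := exists_isAdditionFamily_w two_pos y hy
    set φ := algebraMap (PowerSeries ℂ) (FractionRing (PowerSeries ℂ)) with hφ
    have hinj : Function.Injective φ := IsFractionRing.injective _ _
    set U : Fin (0 + 2 * m + 2) → Fin (0 + 2 * m + 2) → PowerSeries ℂ := fun i j =>
      gf (fun p : ℕ × ℕ => (2 * p.1 + 1) * (2 * p.2 + 1))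
        (fun p => (((y i / y j) ^ (2 * (p.1 : ℤ) + 1) : ℂˣ) : ℂ)) with hU
    have key := sum_minors_even (n := 0 + 2 * m) (m := m) (by omega) hfam
      (U := fun i j => φ (U i j)) (c := φ (PowerSeries.X * psi 2 ^ 2)) (by
        intro i j
        rw [← map_sub, ← map_neg, ← map_mul, hU]
        simp only
        rw [← inv_div (y i) (y j), gf_sub_gf_inv finFib_oddLambert, neg_mul]
        exact congrArg φ (S1_eq _))
    have keyR : 2 * ∑ i : Fin (0 + 2 * m + 2), ∑ j : Fin (0 + 2 * m + 1), (-1) ^ ((i : ℕ) + j) *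
        U i (i.succAbove j) * pairProd (fun a b : Fin (0 + 2 * m) => w 2
          (y (i.succAbove (j.succAbove a)) / y (i.succAbove (j.succAbove b)))) =
        -(PowerSeries.X * psi 2 ^ 2 * (PowerSeries.X ^ 2) ^ m * (2 * (m : PowerSeries ℂ) + 2) *
          pairProd fun i j => w 2 (y i / y j)) := by
      refine hinj ?_
      simpa only [map_mul, map_sum, map_pow, map_neg, map_add, map_one, map_pairProd, map_natCast,
        map_ofNat] using key
    refine mul_left_cancel₀ two_powerSeries_ne_zero ?_
    have h1 : ∀ (i : Fin (0 + 2 * m + 2)) (j : Fin (0 + 2 * m + 1)) (P : PowerSeries ℂ),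
        (-1) ^ ((i : ℕ) + j) * U i (i.succAbove j) * ((-1) ^ m * (m.factorial : PowerSeries ℂ) *
          PowerSeries.X ^ (m ^ 2) * psi 2 ^ (2 * m) * P) = (-1) ^ m * (m.factorial : PowerSeries ℂ)
          * PowerSeries.X ^ (m ^ 2) * psi 2 ^ (2 * m) * ((-1) ^ ((i : ℕ) + j) *
          U i (i.succAbove j) * P) := fun i j P => by ring
    change 2 * ∑ i : Fin (0 + 2 * m + 2), ∑ j : Fin (0 + 2 * m + 1), (-1) ^ ((i : ℕ) + j) *
      U i (i.succAbove j) * _ = _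
    simp only [h1, ← Finset.mul_sum]
    rw [Nat.factorial_succ]
    push_cast
    linear_combination ((-1) ^ m * (m.factorial : PowerSeries ℂ) * PowerSeries.X ^ (m ^ 2) *
      psi 2 ^ (2 * m)) * keyR

/-- The generating function of generalised Vandermonde determinants with even exponents and one
constant column; the two-column minors are values of the Lambert series `T2`. -/
theorem genDet_even (m : ℕ) (y : Fin (1 + 2 * m) → ℂˣ) (hy : ∀ i j, i ≠ j → y i ^ 2 ≠ y j ^ 2) :
    genDet (fun p : ℕ × ℕ => 1 * ((p.1 + 1) * (2 * p.2 + 1))) (fun p => 2 * ((p.1 : ℤ) + 1)) 1 m y =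
      (m.factorial : PowerSeries ℂ) * PowerSeries.X ^ (m * (m + 1) / 2) * psi 1 ^ (2 * m) *
        pairProd fun i j => w 1 (y i / y j) := by
  induction m with
  | zero => rw [genDet_zero _ _ le_rfl]; simp [pairProd]
  | succ m ih =>
    have hy' : ∀ (i : Fin (1 + 2 * m + 2)) (j : Fin (1 + 2 * m + 1)), ∀ a b, a ≠ b →
        y (i.succAbove (j.succAbove a)) ^ 2 ≠ y (i.succAbove (j.succAbove b)) ^ 2 :=
      fun i j a b hab => hy _ _ (Fin.succAbove_right_injective.ne
        (Fin.succAbove_right_injective.ne hab))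
    rw [genDet_succ (finFib_lambert one_pos)]
    simp only [ih _ (hy' _ _)]
    obtain ⟨σ, u, v, hfam⟩ := exists_isAdditionFamily_w one_pos y hy
    set φ := algebraMap (PowerSeries ℂ) (FractionRing (PowerSeries ℂ)) with hφ
    have hinj : Function.Injective φ := IsFractionRing.injective _ _
    set U : Fin (1 + 2 * m + 2) → Fin (1 + 2 * m + 2) → PowerSeries ℂ := fun i j =>
      gf (fun p : ℕ × ℕ => 1 * ((p.1 + 1) * (2 * p.2 + 1)))
        (fun p => (((y i / y j) ^ (2 * ((p.1 : ℤ) + 1)) : ℂˣ) : ℂ)) with hU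
    have key := sum_minors_odd (n := 1 + 2 * m) (m := m) (by omega) hfam
      (U := fun i j => φ (U i j)) (c := φ (PowerSeries.X * psi 1 ^ 2))
      (fun i => φ (T2 1 (y i / y (0 : Fin (1 + 2 * m + 2))))) (by
        intro i j
        rw [← map_sub, ← map_mul, ← map_mul, ← map_mul, ← map_sub, ← map_add, hU]
        simp only
        rw [← inv_div (y i) (y j), gf_sub_gf_inv (finFib_lambert one_pos)]
        have h1 := T2_three_term one_pos (y i / y j) (y j / y (0 : Fin (1 + 2 * m + 2)))
        rw [div_mul_div_cancel, pow_one] at h1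
        refine congrArg φ ?_
        change T2 1 (y i / y j) = _
        linear_combination h1)
    have keyR : 2 * ∑ i : Fin (1 + 2 * m + 2), ∑ j : Fin (1 + 2 * m + 1), (-1) ^ ((i : ℕ) + j) *
        U i (i.succAbove j) * pairProd (fun a b : Fin (1 + 2 * m) => w 1
          (y (i.succAbove (j.succAbove a)) / y (i.succAbove (j.succAbove b)))) =
        PowerSeries.X * psi 1 ^ 2 * (PowerSeries.X ^ 1) ^ m * (2 * (m : PowerSeries ℂ) + 2) *
          pairProd fun i j => w 1 (y i / y j) := by
      refine hinj ?_
      simpa only [map_mul, map_sum, map_pow, map_neg, map_add, map_one, map_pairProd, map_natCast,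
        map_ofNat] using key
    refine mul_left_cancel₀ two_powerSeries_ne_zero ?_
    have h1 : ∀ (i : Fin (1 + 2 * m + 2)) (j : Fin (1 + 2 * m + 1)) (P : PowerSeries ℂ),
        (-1) ^ ((i : ℕ) + j) * U i (i.succAbove j) * ((m.factorial : PowerSeries ℂ) *
          PowerSeries.X ^ (m * (m + 1) / 2) * psi 1 ^ (2 * m) * P) = (m.factorial : PowerSeries ℂ)
          * PowerSeries.X ^ (m * (m + 1) / 2) * psi 1 ^ (2 * m) * ((-1) ^ ((i : ℕ) + j) *
          U i (i.succAbove j) * P) := fun i j P => by ring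
    change 2 * ∑ i : Fin (1 + 2 * m + 2), ∑ j : Fin (1 + 2 * m + 1), (-1) ^ ((i : ℕ) + j) *
      U i (i.succAbove j) * _ = _
    simp only [h1, ← Finset.mul_sum]
    have h2 : (m + 1) * (m + 1 + 1) / 2 = m * (m + 1) / 2 + (m + 1) := by
      rw [show (m + 1) * (m + 1 + 1) = m * (m + 1) + (m + 1) * 2 by ring,
        Nat.add_mul_div_right _ _ two_pos]
    rw [Nat.factorial_succ, h2]
    push_cast
    linear_combination ((m.factorial : PowerSeries ℂ) * PowerSeries.X ^ (m * (m + 1) / 2) *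
      psi 1 ^ (2 * m)) * keyR

end genDet

/-! ### Products over pairs -/

section pairProd
variable {R : Type*} [CommRing R] {N : ℕ}

theorem pairProd_congr {f g : Fin N → Fin N → R} (h : ∀ i j, i < j → f i j = g i j) :
    pairProd f = pairProd g := by
  refine Finset.prod_congr rfl fun i _ => Finset.prod_congr rfl fun j _ => ?_
  split_ifs with hij
  · exact h i j hij
  · rfl

theorem pairProd_mul (f g : Fin N → Fin N → R) :
    (pairProd fun i j => f i j * g i j) = pairProd f * pairProd g := by
  simp only [pairProd, ← Finset.prod_mul_distrib]
  refine Finset.prod_congr rfl fun i _ => Finset.prod_congr rfl fun j _ => ?_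
  split_ifs <;> simp

/-- For symmetric `f`, the square of the product over pairs, times the diagonal, is the product over
all ordered pairs. -/
theorem pairProd_sq {f : Fin N → Fin N → R} (hf : ∀ i j, f i j = f j i) :
    pairProd f ^ 2 * ∏ i, f i i = ∏ i, ∏ j, f i j := by
  have h1 : pairProd f = ∏ a, ∏ b, if b < a then f a b else 1 := by
    rw [pairProd, Finset.prod_comm]
    refine Finset.prod_congr rfl fun i _ => Finset.prod_congr rfl fun j _ => ?_
    rw [hf]
  have h2 : ∏ i, f i i = ∏ a, ∏ b, if a = b then f a b else 1 :=
    Finset.prod_congr rfl fun i _ => by rw [Finset.prod_ite_eq, if_pos (Finset.mem_univ _)]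
  rw [sq, h2]
  nth_rw 2 [h1]
  rw [pairProd]
  simp only [← Finset.prod_mul_distrib]
  refine Finset.prod_congr rfl fun i _ => Finset.prod_congr rfl fun j _ => ?_
  rcases lt_trichotomy i j with h | h | h
  · simp [h, h.not_gt, h.ne]
  · simp [h]
  · simp [h, h.not_gt, h.ne']

theorem pairProd_succ (f : Fin (N + 1) → Fin (N + 1) → R) :
    pairProd f = (∏ j : Fin N, f 0 j.succ) * pairProd fun i j => f i.succ j.succ := by
  simp only [pairProd, Fin.prod_univ_succ, if_false, Fin.succ_pos, if_true, one_mul,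
    Fin.not_lt_zero, Fin.succ_lt_succ_iff]

end pairProd

/-! ### Confluent limits of determinants -/

section confluent
open Filter Topology
variable {N : ℕ}

/-- The divided difference of the monomial `X ^ e` at the nodes `z j`, `j ∈ S`. -/
noncomputable def divDiff (z : Fin N → ℂ) (S : Finset (Fin N)) (e : ℕ) : ℂ :=
  ∑ j ∈ S, z j ^ e / ∏ l ∈ S.erase j, (z j - z l)

/-- The recursion of divided differences, for `X ^ (e + 1) = (X - z a) * X ^ e + z a * X ^ e`. -/
theorem divDiff_succ {z : Fin N → ℂ} {S : Finset (Fin N)} (hz : Set.InjOn z S) {a : Fin N}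
    (ha : a ∈ S) (e : ℕ) :
    divDiff z S (e + 1) = z a * divDiff z S e + divDiff z (S.erase a) e := by
  simp only [divDiff]
  rw [← Finset.add_sum_erase _ _ ha, ← Finset.add_sum_erase S (fun j => z j ^ e / _) ha, mul_add,
    add_assoc, Finset.mul_sum, ← Finset.sum_add_distrib]
  congr 1
  · ring
  · refine Finset.sum_congr rfl fun j hj => ?_
    have hja := Finset.ne_of_mem_erase hj
    have hjS := Finset.mem_of_mem_erase hj
    rw [← Finset.mul_prod_erase (S.erase j) _ (Finset.mem_erase.2 ⟨hja.symm, ha⟩),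
      Finset.erase_right_comm]
    have h1 : z j - z a ≠ 0 := sub_ne_zero.2 (hz.ne hjS ha hja)
    have h2 : ∏ l ∈ (S.erase a).erase j, (z j - z l) ≠ 0 := Finset.prod_ne_zero_iff.2 fun l hl =>
      sub_ne_zero.2 (hz.ne hjS (Finset.mem_of_mem_erase (Finset.mem_of_mem_erase hl))
        (Finset.ne_of_mem_erase hl).symm)
    field_simp
    ring

theorem divDiff_zero {z : Fin N → ℂ} {S : Finset (Fin N)} (hz : Set.InjOn z S) (hS : S.Nonempty) :
    divDiff z S 0 = if S.card = 1 then 1 else 0 := by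
  have hc : 0 < S.card := hS.card_pos
  have h := Lagrange.coeff_eq_sum (P := (1 : Polynomial ℂ)) hz
    (by rw [Polynomial.degree_one]; exact_mod_cast hc)
  rw [Polynomial.coeff_one] at h
  simp only [divDiff, pow_zero]
  simp only [Polynomial.eval_one] at h
  rw [← h]
  congr 1
  rw [eq_iff_iff]
  omega

/-- The limit of the divided difference of `X ^ e` at `k` nodes tending to `1`. -/
def divDiffLim (e : ℕ) : ℕ → ℂ
  | 0 => 0
  | k + 1 => e.choose k

theorem tendsto_divDiff {α : Type*} {l : Filter α} {z : α → Fin N → ℂ}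
    (hz : ∀ j, Tendsto (fun h => z h j) l (𝓝 1)) (e : ℕ) (S : Finset (Fin N))
    (hinj : ∀ᶠ h in l, Set.InjOn (z h) S) :
    Tendsto (fun h => divDiff (z h) S e) l (𝓝 (divDiffLim e S.card)) := by
  induction e generalizing S with
  | zero =>
    rcases S.eq_empty_or_nonempty with rfl | hS
    · simpa [divDiff, divDiffLim] using tendsto_const_nhds
    · have : divDiffLim 0 S.card = if S.card = 1 then 1 else 0 := by
        obtain ⟨k, hk⟩ := Nat.exists_eq_add_of_le' hS.card_pos
        rw [hk]
        rcases k with _ | k <;> simp [divDiffLim]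
      rw [this]
      refine tendsto_const_nhds.congr' ?_
      filter_upwards [hinj] with h hh
      rw [divDiff_zero hh hS]
  | succ e ih =>
    rcases S.eq_empty_or_nonempty with rfl | ⟨a, ha⟩
    · simpa [divDiff, divDiffLim] using tendsto_const_nhds
    · have h1 := ih S hinj
      have h2 := ih (S.erase a) (hinj.mono fun h hh => hh.mono (Finset.erase_subset a S))
      have h3 := ((hz a).mul h1).add h2
      have : divDiffLim (e + 1) S.card = 1 * divDiffLim e S.card +
          divDiffLim e (S.erase a).card := by
        rw [Finset.card_erase_of_mem ha]
        obtain ⟨k, hk⟩ := Nat.exists_eq_add_of_le' (Finset.card_pos.2 ⟨a, ha⟩)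
        rw [hk]
        rcases k with _ | k
        · simp [divDiffLim]
        · simp [divDiffLim, Nat.choose_succ_succ]; ring
      rw [this]
      refine h3.congr' ?_
      filter_upwards [hinj] with h hh
      rw [divDiff_succ hh ha]

variable {β : Type*} [DecidableEq β]

/-- The indices up to `j` in the class of `j`. -/
def classUpTo (cl : Fin N → β) (j : Fin N) : Finset (Fin N) :=
  Finset.univ.filter fun l => l ≤ j ∧ cl l = cl j

/-- The value at coinciding nodes of `det (A i (cl j) z_j ^ e i)`, divided by the Vandermonde
products of the classes. -/
noncomputable def confluentDet (cl : Fin N → β) (A : Fin N → β → ℂ) (e : Fin N → ℕ) : ℂ :=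
  (Matrix.of fun i j => A i (cl j) * divDiffLim (e i) (classUpTo cl j).card).det

/-- Column operations within the classes turn powers of the nodes into divided differences; their
determinant is the inverse of the product of the Vandermonde determinants of the classes. -/
theorem det_eq_pairProd_mul {z : Fin N → ℂ} (cl : Fin N → β) (A : Fin N → β → ℂ) (e : Fin N → ℕ)
    (hz : ∀ i j, i ≠ j → cl i = cl j → z i ≠ z j) :
    (Matrix.of fun i j => A i (cl j) * z j ^ e i).det =
      (pairProd fun a b => if cl a = cl b then z b - z a else 1) *
        (Matrix.of fun i j => A i (cl j) * divDiff z (classUpTo cl j) (e i)).det := by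
  -- The upper triangular matrix of the column operations.
  set T : Matrix (Fin N) (Fin N) ℂ := Matrix.of fun i j =>
    if i ∈ classUpTo cl j then (∏ l ∈ (classUpTo cl j).erase i, (z i - z l))⁻¹ else 0 with hT
  have h1 : (Matrix.of fun i j => A i (cl j) * z j ^ e i) * T =
      Matrix.of fun i j => A i (cl j) * divDiff z (classUpTo cl j) (e i) := by
    ext i j
    simp only [Matrix.mul_apply, Matrix.of_apply, hT, mul_ite, mul_zero, divDiff, Finset.mul_sum]
    rw [Finset.sum_ite_mem, Finset.univ_inter]
    refine Finset.sum_congr rfl fun k hk => ?_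
    rw [(Finset.mem_filter.1 hk).2.2]
    ring
  have h2 : T.det = ∏ j, (∏ l ∈ (classUpTo cl j).erase j, (z j - z l))⁻¹ := by
    rw [Matrix.det_of_isUpperTriangular]
    · refine Finset.prod_congr rfl fun j _ => ?_
      rw [hT, Matrix.of_apply, if_pos]
      simp [classUpTo]
    · intro i j hij
      rw [hT, Matrix.of_apply, if_neg]
      simp only [classUpTo, Finset.mem_filter, not_and]
      intro _ h
      exact absurd hij (not_lt.2 h)
  have h3 : (pairProd fun a b => if cl a = cl b then z b - z a else 1) =
      ∏ j, ∏ l ∈ (classUpTo cl j).erase j, (z j - z l) := by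
    rw [pairProd, Finset.prod_comm]
    refine Finset.prod_congr rfl fun j _ => ?_
    have : (classUpTo cl j).erase j = Finset.univ.filter fun l => l < j ∧ cl l = cl j := by
      ext l
      simp only [classUpTo, Finset.mem_erase, Finset.mem_filter, Finset.mem_univ, true_and,
        lt_iff_le_and_ne]
      tauto
    rw [this, Finset.prod_filter]
    refine Finset.prod_congr rfl fun l _ => ?_
    by_cases h1 : l < j <;> by_cases h2 : cl l = cl j <;> simp [h1, h2]
  have h4 : ∏ j, ∏ l ∈ (classUpTo cl j).erase j, (z j - z l) ≠ 0 := by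
    refine Finset.prod_ne_zero_iff.2 fun j _ => Finset.prod_ne_zero_iff.2 fun l hl => ?_
    have h5 := Finset.mem_erase.1 hl
    exact sub_ne_zero.2 (hz _ _ h5.1.symm (Finset.mem_filter.1 h5.2).2.2.symm)
  rw [← h1, Matrix.det_mul, h2, h3, Finset.prod_inv_distrib]
  field_simp

theorem tendsto_confluent {α : Type*} {l : Filter α} {z : α → Fin N → ℂ}
    (hz : ∀ j, Tendsto (fun h => z h j) l (𝓝 1)) (cl : Fin N → β) (A : Fin N → β → ℂ)
    (e : Fin N → ℕ) (hinj : ∀ᶠ h in l, ∀ i j, i ≠ j → z h i ≠ z h j) :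
    Tendsto (fun h => (Matrix.of fun i j => A i (cl j) * divDiff (z h) (classUpTo cl j) (e i)).det)
      l (𝓝 (confluentDet cl A e)) := by
  have hc : Continuous fun M : Matrix (Fin N) (Fin N) ℂ => M.det := continuous_id.matrix_det
  refine (hc.tendsto _).comp ?_
  refine tendsto_pi_nhds.2 fun i => tendsto_pi_nhds.2 fun j => ?_
  refine Tendsto.const_mul _ (tendsto_divDiff hz _ _ ?_)
  filter_upwards [hinj] with h hh a _ b _ hab
  by_contra hne
  exact hh a b hne hab

end confluent

/-! ### Determinants at points tending to roots of unity -/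

section expLimit
open Filter Topology
variable {N : ℕ}

/-- The unit `exp h`. -/
noncomputable def expUnit (h : ℝ) : ℂˣ := Units.mk0 (Complex.exp h) (Complex.exp_ne_zero _)

theorem expUnit_zpow (h : ℝ) (k : ℤ) : ((expUnit h ^ k : ℂˣ) : ℂ) = Complex.exp (k * h) := by
  rw [Units.val_zpow_eq_zpow_val, expUnit, Units.val_mk0, ← Complex.exp_int_mul]

theorem expUnit_zpow_inj {h : ℝ} (hh : h ≠ 0) {a b : ℤ} (hab : expUnit h ^ a = expUnit h ^ b) :
    a = b := by
  have h1 := congrArg Units.val hab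
  rw [expUnit_zpow, expUnit_zpow] at h1
  have h2 : Real.exp (a * h) = Real.exp (b * h) := by
    have := congrArg Complex.re h1
    rwa [show (a : ℂ) * (h : ℂ) = ((a * h : ℝ) : ℂ) by push_cast; rfl,
      show (b : ℂ) * (h : ℂ) = ((b * h : ℝ) : ℂ) by push_cast; rfl, ← Complex.ofReal_exp,
      ← Complex.ofReal_exp, Complex.ofReal_re, Complex.ofReal_re] at this
  have h3 := mul_right_cancel₀ hh (Real.exp_injective h2)
  exact_mod_cast h3

theorem tendsto_expUnit_zpow (k : ℤ) :
    Tendsto (fun h => ((expUnit h ^ k : ℂˣ) : ℂ)) (𝓝[≠] 0) (𝓝 1) := by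
  simp only [expUnit_zpow]
  have : Continuous fun h : ℝ => Complex.exp (k * h) := by fun_prop
  have h1 := this.tendsto 0
  simp only [Complex.ofReal_zero, mul_zero, Complex.exp_zero] at h1
  exact h1.mono_left nhdsWithin_le_nhds

theorem tendsto_expUnit_sub (a b : ℤ) :
    Tendsto (fun h : ℝ => (((expUnit h ^ b : ℂˣ) : ℂ) - ((expUnit h ^ a : ℂˣ) : ℂ)) / h) (𝓝[≠] 0)
      (𝓝 ((b : ℂ) - a)) := by
  have hd : ∀ k : ℤ, HasDerivAt (fun h : ℝ => Complex.exp (k * h)) k 0 := by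
    intro k
    have h1 : HasDerivAt (fun h : ℝ => (k : ℂ) * (h : ℂ)) (k * 1) 0 :=
      (Complex.ofRealCLM.hasDerivAt (x := (0 : ℝ))).const_mul (k : ℂ)
    have h2 := h1.cexp
    simpa using h2
  have h3 := ((hd b).sub (hd a)).tendsto_slope_zero
  refine h3.congr fun h => ?_
  simp only [expUnit_zpow, zero_add, Complex.ofReal_zero, mul_zero, Pi.sub_apply, sub_self,
    sub_zero]
  rw [Complex.real_smul, Complex.ofReal_inv, div_eq_inv_mul]

/-- The number of pairs of indices in the same class. -/
def pairCount {β : Type*} [DecidableEq β] (cl : Fin N → β) : ℕ :=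
  ∑ a, ∑ b, if a < b ∧ cl a = cl b then 1 else 0

theorem pairProd_ite_const {β : Type*} [DecidableEq β] (cl : Fin N → β) (c : ℂ) :
    (pairProd fun a b => if cl a = cl b then c else 1) = c ^ pairCount cl := by
  simp only [pairProd, pairCount, ← Finset.prod_pow_eq_pow_sum]
  refine Finset.prod_congr rfl fun a _ => Finset.prod_congr rfl fun b _ => ?_
  by_cases h1 : a < b <;> by_cases h2 : cl a = cl b <;> simp [h1, h2]

theorem tendsto_pairProd {R α : Type*} [CommRing R] [TopologicalSpace R] [ContinuousMul R]
    {l : Filter α} {f : α → Fin N → Fin N → R} {g : Fin N → Fin N → R}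
    (h : ∀ i j, i < j → Tendsto (fun t => f t i j) l (𝓝 (g i j))) :
    Tendsto (fun t => pairProd (f t)) l (𝓝 (pairProd g)) := by
  simp only [pairProd]
  refine tendsto_finsetProd _ fun i _ => tendsto_finsetProd _ fun j _ => ?_
  split_ifs with hij
  · exact h i j hij
  · exact tendsto_const_nhds

/-- The points `ζⁱ t^⌊i/d⌋` with `t = exp h`. -/
noncomputable def specPt (ζ : ℂˣ) (d : ℕ) (h : ℝ) (i : Fin N) : ℂˣ :=
  ζ ^ (i : ℕ) * expUnit h ^ ((i : ℕ) / d)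

/-- The class of an exponent: its residue modulo the order of `ζ`. -/
noncomputable def zcl (ζ : ℂˣ) (K : Fin N → ℤ) (j : Fin N) : ℂ := ((ζ ^ K j : ℂˣ) : ℂ)

/-- The product of `K b - K a` over the pairs of indices in the same class. -/
noncomputable def classVander (ζ : ℂˣ) (K : Fin N → ℤ) : ℂ :=
  pairProd fun a b => if zcl ζ K a = zcl ζ K b then (K b : ℂ) - K a else 1

theorem zvander_eq_zero {y : Fin N → ℂˣ} {K : Fin N → ℤ} {a b : Fin N} (hab : a ≠ b)
    (hK : K a = K b) : zvander y K = 0 :=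
  Matrix.det_zero_of_column_eq hab fun i => by simp [hK]

theorem pairProd_eq_zero {R : Type*} [CommRing R] {f : Fin N → Fin N → R} {a b : Fin N}
    (hab : a < b) (h : f a b = 0) : pairProd f = 0 :=
  Finset.prod_eq_zero (Finset.mem_univ a)
    (Finset.prod_eq_zero (Finset.mem_univ b) (by rw [if_pos hab, h]))

/-- The leading behaviour, as `h → 0`, of a generalised Vandermonde determinant at the points
`ζⁱ t^⌊i/d⌋`: the columns in the same class become confluent. -/
theorem tendsto_zvander_specPt (ζ : ℂˣ) (d : ℕ) (K : Fin N → ℤ) :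
    Tendsto (fun h : ℝ => zvander (specPt ζ d h) K / (h : ℂ) ^ pairCount (zcl ζ K)) (𝓝[≠] 0)
      (𝓝 (confluentDet (zcl ζ K) (fun i c => c ^ (i : ℕ)) (fun i => (i : ℕ) / d) *
        classVander ζ K)) := by
  by_cases hK : Function.Injective K
  · have hne : ∀ᶠ h : ℝ in 𝓝[≠] 0, h ≠ 0 := eventually_mem_nhdsWithin
    have h1 := tendsto_confluent (z := fun h j => ((expUnit h ^ K j : ℂˣ) : ℂ))
      (fun j => tendsto_expUnit_zpow (K j)) (zcl ζ K) (fun i c => c ^ (i : ℕ))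
      (fun i => (i : ℕ) / d) (by
        filter_upwards [hne] with h hh i j hij he
        exact hij (hK (expUnit_zpow_inj hh (Units.val_injective he))))
    have h2 : Tendsto (fun h : ℝ => pairProd fun a b => if zcl ζ K a = zcl ζ K b then
        (((expUnit h ^ K b : ℂˣ) : ℂ) - ((expUnit h ^ K a : ℂˣ) : ℂ)) / h else 1) (𝓝[≠] 0)
        (𝓝 (classVander ζ K)) := by
      refine tendsto_pairProd fun a b _ => ?_
      split_ifs
      · exact tendsto_expUnit_sub _ _
      · exact tendsto_const_nhds
    refine (h1.mul h2).congr' ?_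
    filter_upwards [hne] with h hh
    have hh' : (h : ℂ) ≠ 0 := by exact_mod_cast hh
    have h3 := det_eq_pairProd_mul (z := fun j => ((expUnit h ^ K j : ℂˣ) : ℂ)) (zcl ζ K)
      (fun i c => c ^ (i : ℕ)) (fun i => (i : ℕ) / d)
      (fun i j hij _ he => hij (hK (expUnit_zpow_inj hh (Units.val_injective he))))
    have h4 : zvander (specPt ζ d h) K = (Matrix.of fun i j : Fin N =>
        zcl ζ K j ^ (i : ℕ) * ((expUnit h ^ K j : ℂˣ) : ℂ) ^ ((i : ℕ) / d)).det := by
      rw [zvander]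
      congr 1
      ext i j
      simp only [Matrix.of_apply, specPt, zcl, mul_zpow, Units.val_mul]
      rw [← Units.val_pow_eq_pow_val, ← Units.val_pow_eq_pow_val, ← zpow_natCast, ← zpow_mul,
        ← zpow_natCast (expUnit h), ← zpow_mul, ← zpow_natCast (ζ ^ K j), ← zpow_mul,
        ← zpow_natCast (expUnit h ^ K j), ← zpow_mul, mul_comm (K j), mul_comm (K j)]
    rw [h4, h3, ← pairProd_ite_const]
    have h5 : (pairProd fun a b : Fin N => if zcl ζ K a = zcl ζ K b then
        ((expUnit h ^ K b : ℂˣ) : ℂ) - ((expUnit h ^ K a : ℂˣ) : ℂ) else 1) =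
        (pairProd fun a b => if zcl ζ K a = zcl ζ K b then
        (((expUnit h ^ K b : ℂˣ) : ℂ) - ((expUnit h ^ K a : ℂˣ) : ℂ)) / h else 1) *
        pairProd fun a b => if zcl ζ K a = zcl ζ K b then (h : ℂ) else 1 := by
      rw [← pairProd_mul]
      refine pairProd_congr fun a b _ => ?_
      split_ifs
      · field_simp
      · ring
    have h6 : (pairProd fun a b => if zcl ζ K a = zcl ζ K b then (h : ℂ) else 1) ≠ 0 := by
      rw [pairProd_ite_const]; exact pow_ne_zero _ hh'
    rw [h5]
    field_simp
  · have : ∃ a b, a < b ∧ K a = K b := by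
      simp only [Function.Injective, not_forall] at hK
      obtain ⟨a, b, hab, hne⟩ := hK
      rcases lt_or_gt_of_ne hne with h | h
      · exact ⟨a, b, h, hab⟩
      · exact ⟨b, a, h, hab.symm⟩
    obtain ⟨a, b, hab, hK⟩ := this
    have h1 : classVander ζ K = 0 := pairProd_eq_zero hab (by simp [zcl, hK])
    simp only [zvander_eq_zero hab.ne hK, h1, zero_div, mul_zero]
    exact tendsto_const_nhds

end expLimit

/-! ### Exponents in pairs of opposite sign -/

section pmVec

theorem pmVec_eq {ε m : ℕ} (k : Fin m → ℤ) (j : Fin (ε + 2 * m)) :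
    pmVec ε m k j = if h : (j : ℕ) < 2 * m then
      (if (j : ℕ) % 2 = 0 then k ⟨j / 2, by omega⟩ else -k ⟨j / 2, by omega⟩) else 0 := by
  induction m with
  | zero => simp [pmVec]
  | succ m ih =>
    obtain ⟨n, hn⟩ := j
    match n with
    | 0 => simp [show 0 < 2 * (m + 1) by omega]; rfl
    | 1 => simp [show 1 < 2 * (m + 1) by omega]; rfl
    | n + 2 =>
      have h1 : pmVec ε (m + 1) k ⟨n + 2, hn⟩ = pmVec ε m (Fin.tail k) ⟨n, by omega⟩ := rfl
      rw [h1, ih]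
      simp only [show n + 2 < 2 * (m + 1) ↔ n < 2 * m by omega, Nat.add_mod_right]
      split_ifs
      · simp only [Fin.tail]; congr 1; ext; simp
      · simp only [Fin.tail]; congr 2; ext; simp
      · rfl

/-- Positions in `pmVec`: an index with a sign, or one of the trailing zeros. -/
noncomputable def pmEquiv (ε m : ℕ) : (Fin m × Bool) ⊕ Fin ε ≃ Fin (ε + 2 * m) :=
  Equiv.ofBijective (Sum.elim (fun p => ⟨2 * p.1 + (if p.2 then 1 else 0), by
      have := p.1.2; split_ifs <;> omega⟩) fun e => ⟨2 * m + e, by omega⟩) <| by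
    rw [Fintype.bijective_iff_injective_and_card]
    constructor
    · rintro (⟨⟨i, hi⟩, b⟩ | ⟨e, he⟩) (⟨⟨j, hj⟩, c⟩ | ⟨e', he'⟩) h <;>
        simp only [Sum.elim_inl, Sum.elim_inr, Fin.mk.injEq] at h
      · cases b <;> cases c <;> simp at h ⊢ <;> omega
      · split_ifs at h <;> omega
      · split_ifs at h <;> omega
      · simp; omega
    · simp; omega

theorem pmVec_pmEquiv_inl {ε m : ℕ} (k : Fin m → ℤ) (i : Fin m) (b : Bool) :
    pmVec ε m k (pmEquiv ε m (Sum.inl (i, b))) = if b then -k i else k i := by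
  rw [pmVec_eq]
  obtain ⟨i, hi⟩ := i
  cases b
  · have : ((pmEquiv ε m (Sum.inl (⟨i, hi⟩, false)) : Fin _) : ℕ) = 2 * i := rfl
    simp only [this]
    rw [dif_pos (by omega), if_pos (by omega)]
    simp
  · have : ((pmEquiv ε m (Sum.inl (⟨i, hi⟩, true)) : Fin _) : ℕ) = 2 * i + 1 := rfl
    simp only [this]
    rw [dif_pos (by omega), if_neg (by omega)]
    simp only [if_true]
    congr 2
    ext
    show (2 * i + 1) / 2 = i
    omega

theorem pmVec_pmEquiv_inr {ε m : ℕ} (k : Fin m → ℤ) (e : Fin ε) :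
    pmVec ε m k (pmEquiv ε m (Sum.inr e)) = 0 := by
  rw [pmVec_eq, dif_neg]
  have : ((pmEquiv ε m (Sum.inr e) : Fin _) : ℕ) = 2 * m + e := rfl
  omega

@[to_additive]
theorem prod_pmVec {M : Type*} [CommMonoid M] {ε m : ℕ} (k : Fin m → ℤ) (G : ℤ → M) :
    ∏ j, G (pmVec ε m k j) = (∏ i, G (k i) * G (-k i)) * G 0 ^ ε := by
  rw [← Equiv.prod_comp (pmEquiv ε m), Fintype.prod_sum_type, Fintype.prod_prod_type]
  simp only [pmVec_pmEquiv_inl, pmVec_pmEquiv_inr, Fintype.prod_bool, Finset.prod_const,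
    Finset.card_univ, Fintype.card_fin, if_true, Bool.false_eq_true, if_false]
  congr 1
  exact Finset.prod_congr rfl fun i _ => mul_comm _ _

theorem zvander_comp_perm {N : ℕ} (y : Fin N → ℂˣ) (K : Fin N → ℤ) (τ : Equiv.Perm (Fin N)) :
    zvander y (K ∘ τ) = ((Equiv.Perm.sign τ : ℤ) : ℂ) * zvander y K := by
  rw [zvander, zvander, ← Matrix.det_permute']
  rfl

theorem zvander_pmVec_comp {ε m : ℕ} (y : Fin (ε + 2 * m) → ℂˣ) (k : Fin m → ℤ)
    (σ : Equiv.Perm (Fin m)) :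
    zvander y (pmVec ε m (k ∘ σ)) = zvander y (pmVec ε m k) := by
  set τ : Equiv.Perm (Fin (ε + 2 * m)) := (pmEquiv ε m).permCongr
    (Equiv.sumCongr (Equiv.prodCongrLeft fun _ : Bool => σ) (Equiv.refl (Fin ε))) with hτ
  have h1 : pmVec ε m (k ∘ σ) = pmVec ε m k ∘ τ := by
    funext j
    obtain ⟨c, rfl⟩ := (pmEquiv ε m).surjective j
    rcases c with ⟨i, b⟩ | e
    · simp [hτ, pmVec_pmEquiv_inl]
    · simp [hτ, pmVec_pmEquiv_inr]
  rw [h1, zvander_comp_perm, hτ, Equiv.Perm.sign_permCongr, Equiv.Perm.sign_sumCongr,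
    Equiv.Perm.sign_prodCongrLeft]
  simp

theorem zvander_pmVec_sign {ε m : ℕ} (y : Fin (ε + 2 * m) → ℂˣ) (k s : Fin m → ℤ)
    (hs : ∀ i, s i = 1 ∨ s i = -1) :
    zvander y (pmVec ε m fun i => s i * k i) = ((∏ i, s i : ℤ) : ℂ) * zvander y (pmVec ε m k) := by
  set τ : Equiv.Perm (Fin (ε + 2 * m)) := (pmEquiv ε m).permCongr
    (Equiv.sumCongr (Equiv.prodCongrRight fun i : Fin m =>
      if s i = 1 then Equiv.refl Bool else Equiv.swap false true) (Equiv.refl (Fin ε))) with hτ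
  have h1 : (pmVec ε m fun i => s i * k i) = pmVec ε m k ∘ τ := by
    funext j
    obtain ⟨c, rfl⟩ := (pmEquiv ε m).surjective j
    rcases c with ⟨i, b⟩ | e
    · rcases hs i with h | h <;> cases b <;> simp [hτ, pmVec_pmEquiv_inl, h]
    · simp [hτ, pmVec_pmEquiv_inr]
  have h2 : ∀ i, ((Equiv.Perm.sign (if s i = 1 then Equiv.refl Bool else Equiv.swap false true) :
      ℤˣ) : ℤ) = s i := by
    intro i
    rcases hs i with h | h
    · simp [h]
    · rw [if_neg (by omega), Equiv.Perm.sign_swap (by simp), h]; rfl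
  rw [h1, zvander_comp_perm, hτ, Equiv.Perm.sign_permCongr, Equiv.Perm.sign_sumCongr,
    Equiv.Perm.sign_prodCongrRight]
  simp only [Equiv.Perm.sign_refl, mul_one, Units.coe_prod, h2]

/-- A product over pairs of entries of `pmVec`, collected by pairs of indices. -/
theorem pairProd_pmVec {R : Type*} [CommRing R] {ε m : ℕ} (hε : ε ≤ 1) (k : Fin m → ℤ)
    (g : ℤ → ℤ → R) :
    (pairProd fun a b => g (pmVec ε m k a) (pmVec ε m k b)) =
      (∏ i, g (k i) (-k i) * (g (k i) 0 * g (-k i) 0) ^ ε) *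
        pairProd fun i j => g (k i) (k j) * g (k i) (-k j) * (g (-k i) (k j) * g (-k i) (-k j)) := by
  induction m with
  | zero =>
    have : ∀ {N : ℕ} (_ : N ≤ 1) (f : Fin N → Fin N → R), pairProd f = 1 := by
      intro N hN f
      interval_cases N <;> simp [pairProd]
    rw [this (by omega), this (by omega)]
    simp
  | succ m ih =>
    have h1 := ih (Fin.tail k)
    have h2 := prod_pmVec (ε := ε) (Fin.tail k) (fun b => g (k 0) b)
    have h3 := prod_pmVec (ε := ε) (Fin.tail k) (fun b => g (-k 0) b)
    change (pairProd (N := ε + 2 * m + 1 + 1) _) = _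
    rw [pairProd_succ, pairProd_succ, pairProd_succ (N := m), Fin.prod_univ_succ (n := m)]
    have h4 : (∏ j : Fin (ε + 2 * m + 1), g (k 0) ((Fin.cons (-k 0) (pmVec ε m (Fin.tail k)) :
        Fin (ε + 2 * m + 1) → ℤ) j)) =
        g (k 0) (-k 0) * ∏ j : Fin (ε + 2 * m), g (k 0) (pmVec ε m (Fin.tail k) j) :=
      Fin.prod_univ_succ _
    change (∏ j : Fin (ε + 2 * m + 1), g (k 0) ((Fin.cons (-k 0) (pmVec ε m (Fin.tail k)) :
        Fin (ε + 2 * m + 1) → ℤ) j)) * _ = _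
    rw [h4]
    change (g (k 0) (-k 0) * ∏ j : Fin (ε + 2 * m), g (k 0) (pmVec ε m (Fin.tail k) j)) *
      ((∏ j : Fin (ε + 2 * m), g (-k 0) (pmVec ε m (Fin.tail k) j)) *
        pairProd fun a b => g (pmVec ε m (Fin.tail k) a) (pmVec ε m (Fin.tail k) b)) = _
    rw [h1, h2, h3]
    simp only [Finset.prod_mul_distrib, mul_pow, Fin.tail]
    ring

end pmVec

/-! ### The weight of a tuple of exponents -/

section weight

theorem neg_emod_eq {M : ℤ} (hM : 0 < M) (a : ℤ) :
    (-a) % M = if a % M = 0 then 0 else M - a % M := by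
  have h1 := Int.emod_nonneg a hM.ne'
  have h2 := Int.emod_lt_of_pos a hM
  have h3 := Int.emod_add_mul_ediv a M
  split_ifs with h
  · have : -a = M * (-(a / M)) := by rw [h] at h3; linarith
    rw [this, Int.mul_emod_right]
  · have : -a = (M - a % M) + M * (-(a / M) - 1) := by linarith
    rw [this, Int.add_mul_emod_self_left]
    exact Int.emod_eq_of_lt (by omega) (by omega)

theorem emod_eq_neg_emod_comm {M : ℤ} (hM : 0 < M) (a b : ℤ) :
    (-a) % M = b % M ↔ a % M = (-b) % M := by
  have h1 := Int.emod_nonneg a hM.ne'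
  have h2 := Int.emod_lt_of_pos a hM
  have h3 := Int.emod_nonneg b hM.ne'
  have h4 := Int.emod_lt_of_pos b hM
  rw [neg_emod_eq hM, neg_emod_eq hM]
  split_ifs <;> omega

theorem neg_emod_eq_neg_emod {M : ℤ} (hM : 0 < M) (a b : ℤ) :
    (-a) % M = (-b) % M ↔ a % M = b % M := by
  rw [emod_eq_neg_emod_comm hM, neg_neg]

/-- The sign of an exponent: negative if its residue modulo `2d` exceeds `d`. -/
def expSign (d : ℕ) (a : ℤ) : ℚ := if (d : ℤ) + 1 ≤ a % (2 * d) then -1 else 1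

/-- The contribution of a single exponent to the absolute weight. -/
def expSelf (d : ℕ) (a : ℤ) : ℚ :=
  if a % (2 * d) = d then a else if a % (2 * d) = 0 then a ^ 3 / 4 else 1

/-- The contribution of a pair of exponents to the weight. -/
def expPair (d : ℕ) (a b : ℤ) : ℚ :=
  (if a % (2 * d) = b % (2 * d) then (((b : ℚ) - a) / 2) ^ 2 else 1) *
    if a % (2 * d) = (-b) % (2 * d) then (((b : ℚ) + a) / 2) ^ 2 else 1

/-- The common form of the weights in both identities, as a function of the exponents. -/
def expWeight {m : ℕ} (d : ℕ) (K : Fin m → ℤ) : ℚ :=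
  (∏ i, expSign d (K i) * expSelf d (K i)) * pairProd fun i j => expPair d (K i) (K j)

variable {d : ℕ}

theorem expSign_mul_expSelf_neg (hd : 0 < d) (a : ℤ) :
    expSign d (-a) * expSelf d (-a) = -(expSign d a * expSelf d a) := by
  have hM : (0 : ℤ) < 2 * d := by positivity
  have h1 := Int.emod_nonneg a hM.ne'
  have h2 := Int.emod_lt_of_pos a hM
  simp only [expSign, expSelf, neg_emod_eq hM]
  generalize a % (2 * d) = r at *
  by_cases hr : r = 0
  · subst hr
    have hd' : (0 : ℤ) ≠ d := by exact_mod_cast hd.ne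
    have hd2 : ¬((d : ℤ) + 1 ≤ 0) := by omega
    simp [hd', hd2]; ring
  · simp only [if_neg hr]
    rcases lt_trichotomy r d with h | h | h
    · rw [if_pos (by omega), if_neg (by omega), if_neg (by omega), if_neg (by omega),
        if_neg (by omega)]
      ring
    · rw [if_neg (by omega), if_pos (by omega), if_neg (by omega), if_pos (by omega)]
      push_cast; ring
    · rw [if_neg (by omega), if_neg (by omega), if_neg (by omega), if_pos (by omega),
        if_neg (by omega)]
      ring

theorem expPair_comm (hd : 0 < d) (a b : ℤ) : expPair d a b = expPair d b a := by
  have hM : (0 : ℤ) < 2 * d := by positivity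
  have h1 : (a % (2 * d) = b % (2 * d)) ↔ (b % (2 * d) = a % (2 * d)) := eq_comm
  have h2 : (a % (2 * d) = (-b) % (2 * d)) ↔ (b % (2 * d) = (-a) % (2 * d)) := by
    rw [← emod_eq_neg_emod_comm hM, eq_comm]
  simp only [expPair, h1, h2]
  rw [add_comm (b : ℚ), ← neg_sub (a : ℚ) b, neg_div, neg_sq]

theorem expPair_neg_left (hd : 0 < d) (a b : ℤ) : expPair d (-a) b = expPair d a b := by
  have hM : (0 : ℤ) < 2 * d := by positivity
  simp only [expPair, emod_eq_neg_emod_comm hM a b, neg_emod_eq_neg_emod hM a b]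
  rw [mul_comm]
  push_cast
  congr 3
  · ring
  · ring

theorem expPair_neg_right (hd : 0 < d) (a b : ℤ) : expPair d a (-b) = expPair d a b := by
  rw [expPair_comm hd, expPair_neg_left hd, expPair_comm hd]

theorem expPair_nonneg (a b : ℤ) : 0 ≤ expPair d a b := by
  rw [expPair]
  refine mul_nonneg ?_ ?_ <;> split_ifs <;> positivity

theorem pairProd_nonneg {m : ℕ} {f : Fin m → Fin m → ℚ} (hf : ∀ i j, 0 ≤ f i j) :
    0 ≤ pairProd f := by
  refine Finset.prod_nonneg fun i _ => Finset.prod_nonneg fun j _ => ?_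
  split_ifs
  · exact hf i j
  · exact zero_le_one

/-- A product of non-negative symmetric factors over pairs does not depend on the order; it is
determined by its square, which runs over all ordered pairs. -/
theorem pairProd_eq_of_perm {m : ℕ} {f g : Fin m → Fin m → ℚ} (hf : ∀ i j, f i j = f j i)
    (hf0 : ∀ i j, 0 ≤ f i j) (σ : Equiv.Perm (Fin m)) (hg : ∀ i j, g i j = f (σ i) (σ j)) :
    pairProd g = pairProd f := by
  have key : ∀ {h : Fin m → Fin m → ℚ}, (∀ i j, h i j = h j i) →
      pairProd h ^ 2 = ∏ i, ∏ j, if i = j then 1 else h i j := by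
    intro h hh
    rw [← pairProd_sq (f := fun i j => if i = j then 1 else h i j)]
    · have h1 : (pairProd fun i j => if i = j then 1 else h i j) = pairProd h :=
        pairProd_congr fun i j hij => if_neg hij.ne
      rw [h1]; simp
    · intro i j
      simp only [eq_comm (a := i), hh i j]
  have hgs : ∀ i j, g i j = g j i := fun i j => by rw [hg, hg, hf]
  have hg0 : ∀ i j, 0 ≤ g i j := fun i j => by rw [hg]; exact hf0 _ _
  refine (sq_eq_sq₀ (pairProd_nonneg hg0) (pairProd_nonneg hf0)).1 ?_
  rw [key hf, key hgs, ← Equiv.prod_comp σ fun i => ∏ j, if i = j then 1 else f i j]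
  refine Finset.prod_congr rfl fun i _ => ?_
  rw [← Equiv.prod_comp σ fun j => if σ i = j then 1 else f (σ i) j]
  refine Finset.prod_congr rfl fun j _ => ?_
  rw [hg]
  simp

theorem expWeight_comp {m : ℕ} (hd : 0 < d) (K : Fin m → ℤ) (σ : Equiv.Perm (Fin m)) :
    expWeight d (K ∘ σ) = expWeight d K := by
  rw [expWeight, expWeight, ← Equiv.prod_comp σ fun i => expSign d (K i) * expSelf d (K i)]
  congr 1
  exact pairProd_eq_of_perm (fun i j => expPair_comm hd _ _) (fun i j => expPair_nonneg _ _) σ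
    fun _ _ => rfl

theorem expWeight_sign {m : ℕ} (hd : 0 < d) (K s : Fin m → ℤ) (hs : ∀ i, s i = 1 ∨ s i = -1) :
    expWeight d (fun i => s i * K i) = ((∏ i, s i : ℤ) : ℚ) * expWeight d K := by
  rw [expWeight, expWeight, Int.cast_prod, ← mul_assoc, ← Finset.prod_mul_distrib]
  congr 1
  · refine Finset.prod_congr rfl fun i _ => ?_
    rcases hs i with h | h
    · simp [h]
    · simp [h, expSign_mul_expSelf_neg hd]
  · refine pairProd_congr fun i j _ => ?_
    rcases hs i with h | h <;> rcases hs j with h' | h' <;>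
      simp [h, h', expPair_neg_left hd, expPair_neg_right hd]

theorem expWeight_eq_zero {m : ℕ} {K : Fin m → ℤ} {i j : Fin m} (hij : i ≠ j) (h : K i = K j) :
    expWeight d K = 0 := by
  rw [expWeight]
  have : ∀ {a b}, a < b → K a = K b → (pairProd fun i j => expPair d (K i) (K j)) = 0 :=
    fun hab hK => pairProd_eq_zero hab (by simp [expPair, hK])
  rcases lt_or_gt_of_ne hij with h1 | h1
  · rw [this h1 h, mul_zero]
  · rw [this h1 h.symm, mul_zero]

theorem zpow_eq_zpow_iff_emod {ζ : ℂˣ} (hζ : IsPrimitiveRoot ζ (2 * d)) (a b : ℤ) :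
    ζ ^ a = ζ ^ b ↔ a % (2 * d) = b % (2 * d) := by
  rw [← mul_inv_eq_one, ← zpow_sub, hζ.zpow_eq_one_iff_dvd,
    Int.emod_eq_emod_iff_emod_sub_eq_zero, Int.dvd_iff_emod_eq_zero]
  push_cast
  rfl

/-- The difference `b - a` of two exponents in the same class. -/
def classDiff (d : ℕ) (a b : ℤ) : ℂ := if a % (2 * d) = b % (2 * d) then (b : ℂ) - a else 1

theorem classVander_pmVec {ζ : ℂˣ} (hζ : IsPrimitiveRoot ζ (2 * d)) {ε m : ℕ}
    (hε : ε ≤ 1) (K : Fin m → ℤ) : classVander ζ (pmVec ε m K) =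
      (∏ i, classDiff d (K i) (-K i) * (classDiff d (K i) 0 * classDiff d (-K i) 0) ^ ε) *
        pairProd fun i j => classDiff d (K i) (K j) * classDiff d (K i) (-K j) *
          (classDiff d (-K i) (K j) * classDiff d (-K i) (-K j)) := by
  rw [← pairProd_pmVec hε]
  refine pairProd_congr fun a b _ => ?_
  simp only [zcl, classDiff, Units.val_inj, zpow_eq_zpow_iff_emod hζ]

/-- The factors of `classVander` that involve a single index depend on the exponent, within its
class, as the sign and absolute weight do. -/
theorem classDiff_self_mul (hd : 0 < d) {ε : ℕ} {a b : ℤ} (hε : ε = 1 ∨ ε = 0 ∧ a % (2 * d) ≠ 0)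
    (hab : a % (2 * d) = b % (2 * d)) :
    classDiff d a (-a) * (classDiff d a 0 * classDiff d (-a) 0) ^ ε *
      ((expSign d b * expSelf d b : ℚ) : ℂ) =
    classDiff d b (-b) * (classDiff d b 0 * classDiff d (-b) 0) ^ ε *
      ((expSign d a * expSelf d a : ℚ) : ℂ) := by
  have hM : (0 : ℤ) < 2 * d := by positivity
  have h1 := Int.emod_nonneg a hM.ne'
  have h2 := Int.emod_lt_of_pos a hM
  simp only [classDiff, expSign, expSelf, neg_emod_eq hM, ← hab, Int.zero_emod]
  generalize a % (2 * d) = r at *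
  by_cases hr : r = 0
  · subst hr
    have hε : ε = 1 := by tauto
    subst hε
    have hd' : (0 : ℤ) ≠ d := by exact_mod_cast hd.ne
    have hd2 : ¬((d : ℤ) + 1 ≤ 0) := by omega
    simp only [hd', hd2, if_true, if_false, pow_one]
    push_cast; ring
  · have h3 : ¬(2 * (d : ℤ) - r = 0) := by omega
    simp only [hr, h3, if_false, one_pow, mul_one]
    by_cases h : r = d
    · have h4 : r = 2 * d - r := by omega
      rw [if_pos h4, if_pos h, if_pos h4, if_pos h]
      push_cast; ring
    · have h4 : ¬(r = 2 * d - r) := by omega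
      rw [if_neg h4, if_neg h, if_neg h4, if_neg h]

/-- The factors of `classVander` that involve two indices depend on the exponents, within their
classes, as `expPair` does. -/
theorem classDiff_pair_mul (hd : 0 < d) {a b a' b' : ℤ} (ha : a % (2 * d) = a' % (2 * d))
    (hb : b % (2 * d) = b' % (2 * d)) :
    classDiff d a b * classDiff d a (-b) * (classDiff d (-a) b * classDiff d (-a) (-b)) *
      ((expPair d a' b' : ℚ) : ℂ) =
    classDiff d a' b' * classDiff d a' (-b') * (classDiff d (-a') b' * classDiff d (-a') (-b')) *
      ((expPair d a b : ℚ) : ℂ) := by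
  have hM : (0 : ℤ) < 2 * d := by positivity
  have hb2 : (-b) % (2 * d) = (-b') % (2 * d) := (neg_emod_eq_neg_emod hM _ _).2 hb
  simp only [classDiff, expPair, emod_eq_neg_emod_comm hM, neg_neg, hb2, ha, hb]
  split_ifs <;> push_cast <;> ring

/-- For exponents in fixed classes, `classVander` is proportional to the weight. -/
theorem classVander_mul_expWeight (hd : 0 < d) {ζ : ℂˣ} (hζ : IsPrimitiveRoot ζ (2 * d)) {ε m : ℕ}
    {K L : Fin m → ℤ} (hε : ε = 1 ∨ ε = 0 ∧ ∀ i, L i % (2 * d) ≠ 0)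
    (hKL : ∀ i, K i % (2 * d) = L i % (2 * d)) :
    classVander ζ (pmVec ε m K) * ((expWeight d L : ℚ) : ℂ) =
      classVander ζ (pmVec ε m L) * ((expWeight d K : ℚ) : ℂ) := by
  have hε1 : ε ≤ 1 := by omega
  rw [classVander_pmVec hζ hε1, classVander_pmVec hζ hε1, expWeight, expWeight]
  have hc : ∀ K : Fin m → ℤ, (((pairProd fun i j => expPair d (K i) (K j)) : ℚ) : ℂ) =
      pairProd fun i j => ((expPair d (K i) (K j) : ℚ) : ℂ) :=
    fun K => map_pairProd (Rat.castHom ℂ) _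
  simp only [Rat.cast_mul (∏ _, _), Rat.cast_prod, hc]
  refine (mul_mul_mul_comm _ _ _ _).trans (Eq.trans ?_ (mul_mul_mul_comm _ _ _ _).symm)
  rw [← Finset.prod_mul_distrib, ← Finset.prod_mul_distrib,
    ← pairProd_mul, ← pairProd_mul]
  congr 1
  · refine Finset.prod_congr rfl fun i _ => classDiff_self_mul hd ?_ (hKL i)
    rcases hε with h | ⟨h, h'⟩
    · exact Or.inl h
    · exact Or.inr ⟨h, by rw [hKL]; exact h' i⟩
  · exact pairProd_congr fun i j _ => classDiff_pair_mul hd (hKL i) (hKL j)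

end weight

/-! ### Counting exponents in residue classes -/

section counting

theorem two_mul_pairCount {N : ℕ} {β : Type*} [DecidableEq β] (cl : Fin N → β) :
    2 * pairCount cl + N = ∑ i, ∑ j, if cl i = cl j then 1 else 0 := by
  have h1 := pairProd_sq (R := ℂ) (f := fun i j => if cl i = cl j then 2 else 1)
    fun i j => by simp only [eq_comm (a := cl i)]
  rw [pairProd_ite_const] at h1
  simp only [if_true, Finset.prod_const, Finset.card_univ, Fintype.card_fin] at h1
  have h2 : ∀ i, (∏ j, if cl i = cl j then (2 : ℂ) else 1) =
      2 ^ ∑ j, if cl i = cl j then 1 else 0 := by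
    intro i
    rw [← Finset.prod_pow_eq_pow_sum]
    exact Finset.prod_congr rfl fun j _ => by split_ifs <;> simp
  simp only [h2, Finset.prod_pow_eq_pow_sum] at h1
  rw [← pow_mul, ← pow_add] at h1
  have h3 : (2 : ℕ) ^ (pairCount cl * 2 + N) =
      2 ^ ∑ i, ∑ j, if cl i = cl j then 1 else 0 := by exact_mod_cast h1
  have := Nat.pow_right_injective le_rfl h3
  omega

theorem sum_sum_ite_eq_sum_sq {N : ℕ} {β : Type*} [DecidableEq β] [Fintype β] (b : Fin N → β) :
    ((∑ i, ∑ j, if b i = b j then 1 else 0 : ℕ) : ℤ) =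
      ∑ c, (∑ j, if b j = c then (1 : ℤ) else 0) ^ 2 := by
  have h1 : ∀ c, (∑ j, if b j = c then (1 : ℤ) else 0) ^ 2 =
      ∑ i, ∑ j, (if b i = c then (1 : ℤ) else 0) * if b j = c then (1 : ℤ) else 0 := by
    intro c; rw [sq, Finset.sum_mul_sum]
  have h2 : ∀ i j c, ((if b i = c then (1 : ℤ) else 0) * if b j = c then (1 : ℤ) else 0) =
      if b i = c then (if b j = c then 1 else 0) else 0 := fun i j c => by split_ifs <;> rfl
  have h3 : ∀ i j, (∑ c, if b i = c then (if b j = c then (1 : ℤ) else 0) else 0) =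
      if b i = b j then 1 else 0 := fun i j => by
    simp only [Finset.sum_ite_eq, Finset.mem_univ, if_true, eq_comm (a := b j)]
  calc ((∑ i, ∑ j, if b i = b j then 1 else 0 : ℕ) : ℤ)
      = ∑ i, ∑ j, if b i = b j then (1 : ℤ) else 0 := by push_cast; rfl
    _ = ∑ i, ∑ j, ∑ c, (if b i = c then (1 : ℤ) else 0) * if b j = c then (1 : ℤ) else 0 :=
      Finset.sum_congr rfl fun i _ => Finset.sum_congr rfl fun j _ => by
        simp only [h2, h3]
    _ = ∑ i, ∑ c, ∑ j, (if b i = c then (1 : ℤ) else 0) * if b j = c then (1 : ℤ) else 0 :=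
      Finset.sum_congr rfl fun i _ => Finset.sum_comm
    _ = ∑ c, ∑ i, ∑ j, (if b i = c then (1 : ℤ) else 0) * if b j = c then (1 : ℤ) else 0 :=
      Finset.sum_comm
    _ = _ := Finset.sum_congr rfl fun c _ => (h1 c).symm

/-- Symmetric integer counts `n'` within squared distance one of a constant `ν` strictly minimise
the sum of squares among the symmetric counts with the same total and the same parities at the
fixed points of the symmetry. -/
theorem eq_of_sum_sq_le {β : Type*} [Fintype β] [DecidableEq β] {n n' : β → ℤ} {τ : β → β}
    (hn : ∀ c, n (τ c) = n c) (hn' : ∀ c, n' (τ c) = n' c)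
    (hpar : ∀ c, τ c = c → Even (n c - n' c)) (hsum : ∑ c, n c = ∑ c, n' c) {ν : ℤ}
    (hν : ∑ c, (n' c - ν) ^ 2 ≤ 1) (hle : ∑ c, n c ^ 2 ≤ ∑ c, n' c ^ 2) : n = n' := by
  have hν2 : ∑ c, (n c - ν) ^ 2 ≤ 1 := by
    have e : ∀ n : β → ℤ, ∑ c, (n c - ν) ^ 2 =
        ∑ c, n c ^ 2 - 2 * ν * ∑ c, n c + Fintype.card β * ν ^ 2 := by
      intro n
      rw [Finset.mul_sum, ← Finset.sum_sub_distrib, ← nsmul_eq_mul, ← Finset.card_univ,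
        ← Finset.sum_const, ← Finset.sum_add_distrib]
      exact Finset.sum_congr rfl fun c _ => by ring
    rw [e] at hν ⊢
    rw [hsum]
    linarith
  have pair : ∀ {f : β → ℤ}, ∑ c, f c ^ 2 ≤ 1 → ∀ {c c'}, c ≠ c' → f c ^ 2 + f c' ^ 2 ≤ 1 := by
    intro f hf c c' hne
    refine le_trans ?_ hf
    rw [← Finset.sum_pair (f := fun c => f c ^ 2) hne]
    exact Finset.sum_le_sum_of_subset_of_nonneg (Finset.subset_univ _) fun _ _ _ => sq_nonneg _
  have single : ∀ {f : β → ℤ}, ∑ c, f c ^ 2 ≤ 1 → ∀ c, f c ^ 2 ≤ 1 := by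
    intro f hf c
    exact (Finset.single_le_sum (f := fun c => f c ^ 2) (fun _ _ => sq_nonneg _)
      (Finset.mem_univ c)).trans hf
  have zero : ∀ {f : β → ℤ}, ∑ c, f c ^ 2 ≤ 1 → ∀ {c}, f c ≠ 0 → ∀ c', c' ≠ c → f c' = 0 := by
    intro f hf c hc c' hne
    have h1 := pair hf hne
    have h2 : 0 < f c ^ 2 := by positivity
    have h3 : f c' ^ 2 ≤ 0 := by linarith
    exact pow_eq_zero_iff two_ne_zero |>.1 (le_antisymm h3 (sq_nonneg _))
  funext c
  by_contra hne
  by_cases hτ : τ c = c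
  · obtain ⟨e, he⟩ := hpar c hτ
    have h1 := abs_le.1 (abs_le_of_sq_le_sq' (single hν2 c |>.trans (one_pow 2).ge) zero_le_one
      |> abs_le.2)
    have h2 := abs_le.1 (abs_le_of_sq_le_sq' (single hν c |>.trans (one_pow 2).ge) zero_le_one
      |> abs_le.2)
    have h3 : n c - ν ≠ 0 := by omega
    have h4 : n' c - ν ≠ 0 := by omega
    have h5 : ∑ c, (n c - ν) = n c - ν := Finset.sum_eq_single c
      (fun c' _ hc' => zero (f := fun c => n c - ν) hν2 h3 c' hc') (by simp)
    have h6 : ∑ c, (n' c - ν) = n' c - ν := Finset.sum_eq_single c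
      (fun c' _ hc' => zero (f := fun c => n' c - ν) hν h4 c' hc') (by simp)
    rw [Finset.sum_sub_distrib] at h5 h6
    rw [hsum] at h5
    omega
  · have h1 := pair (f := fun c => n c - ν) hν2 hτ
    have h2 := pair (f := fun c => n' c - ν) hν hτ
    simp only [hn, hn'] at h1 h2
    have h3 : n c - ν = 0 := by
      have : (n c - ν) ^ 2 = 0 := by have := sq_nonneg (n c - ν); omega
      exact pow_eq_zero_iff two_ne_zero |>.1 this
    have h4 : n' c - ν = 0 := by
      have : (n' c - ν) ^ 2 = 0 := by have := sq_nonneg (n' c - ν); omega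
      exact pow_eq_zero_iff two_ne_zero |>.1 this
    omega

/-- For `N` within one of a multiple `d * n` of `d`, the sizes of the residue classes of
`{0, …, N - 1}` modulo `d` are within squared distance one of the constant `n`. -/
theorem sum_sq_count_le_one {d : ℕ} [NeZero d] {N n : ℕ}
    (hN : N = d * n ∨ N = d * n + 1 ∨ N + 1 = d * n) :
    ∑ c : ZMod d, ((∑ i : Fin N, if ((i : ℕ) : ZMod d) = c then (1 : ℤ) else 0) - n) ^ 2 ≤ 1 := by
  have h0 : ∀ c : ZMod d, ∑ i ∈ Finset.range (d * n), (if (i : ZMod d) = c then (1 : ℤ) else 0) =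
      n := by
    intro c
    induction n generalizing N with
    | zero => simp
    | succ n ih =>
      rw [mul_add_one, Finset.sum_range_add, ih (Or.inl rfl)]
      have : ∀ i : ℕ, ((d * n + i : ℕ) : ZMod d) = i := by intro i; simp
      simp only [this]
      rw [← Fin.sum_univ_eq_sum_range (fun i => if (i : ZMod d) = c then (1 : ℤ) else 0)]
      have : ∑ i : Fin d, (if ((i : ℕ) : ZMod d) = c then (1 : ℤ) else 0) = 1 := by
        have hlt := ZMod.val_lt c
        rw [Finset.sum_eq_single ⟨c.val, hlt⟩]
        · simp
        · intro b _ hb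
          rw [if_neg]
          rintro rfl
          apply hb
          ext
          simp [ZMod.val_natCast, Nat.mod_eq_of_lt b.2]
        · simp
      rw [this]; push_cast; ring
  have h1 : ∀ x : ZMod d, ∑ c : ZMod d, (if x = c then (1 : ℤ) else 0) ^ 2 = 1 := by
    intro x
    simp only [ite_pow, one_pow, zero_pow two_ne_zero, Finset.sum_ite_eq, Finset.mem_univ, if_true]
  have h2 : ∀ c : ZMod d, (∑ i : Fin N, if ((i : ℕ) : ZMod d) = c then (1 : ℤ) else 0) =
      ∑ i ∈ Finset.range N, if (i : ZMod d) = c then (1 : ℤ) else 0 := fun c =>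
    Fin.sum_univ_eq_sum_range (fun i => if (i : ZMod d) = c then (1 : ℤ) else 0) N
  simp only [h2]
  rcases hN with rfl | rfl | hN
  · simp [h0]
  · simp only [Finset.sum_range_succ, h0, add_sub_cancel_left]
    exact (h1 _).le
  · have : ∀ c : ZMod d, ∑ i ∈ Finset.range N, (if (i : ZMod d) = c then (1 : ℤ) else 0) - n =
        -if (N : ZMod d) = c then (1 : ℤ) else 0 := by
      intro c
      have := h0 c
      rw [← hN, Finset.sum_range_succ] at this
      linarith
    simp only [this, neg_sq]
    exact (h1 _).le

end counting

/-! ### Residue classes of exponents -/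

section classes

variable {d : ℕ}

/-- The class of an exponent `a` of the parity of `N - 1`, as a residue modulo `d`: the residue
of `(a + N - 1) / 2`. It sends the exponents `1 - N, 3 - N, …, N - 1` to `0, 1, …, N - 1`. -/
def expClass (d N : ℕ) (a : ℤ) : ZMod d := ((a + N - 1) / 2 : ℤ)

theorem expClass_eq_iff {N : ℕ} {a b : ℤ} (ha : 2 ∣ a + N - 1) (hb : 2 ∣ b + N - 1) :
    expClass d N a = expClass d N b ↔ a % (2 * d) = b % (2 * d) := by
  obtain ⟨u, hu⟩ := ha
  obtain ⟨v, hv⟩ := hb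
  rw [expClass, expClass, hu, hv, Int.mul_ediv_cancel_left _ two_ne_zero,
    Int.mul_ediv_cancel_left _ two_ne_zero, ZMod.intCast_eq_intCast_iff_dvd_sub,
    Int.emod_eq_emod_iff_emod_sub_eq_zero, ← Int.dvd_iff_emod_eq_zero,
    ← dvd_neg (a := (2 * d : ℤ)),
    show -(a - b) = 2 * (v - u) by linarith, mul_dvd_mul_iff_left two_ne_zero]

theorem expClass_neg {N : ℕ} {a : ℤ} (ha : 2 ∣ a + N - 1) :
    expClass d N (-a) = (N : ZMod d) - 1 - expClass d N a := by
  obtain ⟨u, hu⟩ := ha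
  rw [expClass, expClass, hu, show -a + N - 1 = 2 * (N - 1 - u) by linarith,
    Int.mul_ediv_cancel_left _ two_ne_zero, Int.mul_ediv_cancel_left _ two_ne_zero]
  push_cast
  ring

/-- The number of entries of `pmVec ε m K` in a class. -/
def classCount (d ε m : ℕ) (K : Fin m → ℤ) (c : ZMod d) : ℤ :=
  ∑ j, if expClass d (ε + 2 * m) (pmVec ε m K j) = c then 1 else 0

/-- The class count in terms of the `m` indices: negation acts on the classes as `c ↦ N - 1 - c`. -/
theorem classCount_eq {ε m : ℕ} {K : Fin m → ℤ} (hK : ∀ i, 2 ∣ K i + (ε + 2 * m : ℕ) - 1)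
    (c : ZMod d) : classCount d ε m K c =
      (∑ i, ((if expClass d (ε + 2 * m) (K i) = c then 1 else 0) +
        if expClass d (ε + 2 * m) (K i) = ((ε + 2 * m : ℕ) : ZMod d) - 1 - c then 1 else 0)) +
      ε * if expClass d (ε + 2 * m) 0 = c then 1 else 0 := by
  rw [classCount, sum_pmVec K fun a => if expClass d (ε + 2 * m) a = c then (1 : ℤ) else 0,
    nsmul_eq_mul]
  congr 1
  refine Finset.sum_congr rfl fun i _ => ?_
  congr 1
  refine if_congr ?_ rfl rfl
  rw [expClass_neg (hK i), sub_eq_iff_eq_add, eq_sub_iff_add_eq, add_comm c, eq_comm]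

theorem classCount_symm {ε m : ℕ} (hε : ε ≤ 1) {K : Fin m → ℤ}
    (hK : ∀ i, 2 ∣ K i + (ε + 2 * m : ℕ) - 1) (c : ZMod d) :
    classCount d ε m K (((ε + 2 * m : ℕ) : ZMod d) - 1 - c) = classCount d ε m K c := by
  rw [classCount_eq hK, classCount_eq hK, sub_sub_cancel]
  congr 1
  · exact Finset.sum_congr rfl fun i _ => add_comm _ _
  · rcases Nat.eq_zero_or_pos ε with rfl | h
    · simp
    · have h0 : (2 : ℤ) ∣ 0 + (ε + 2 * m : ℕ) - 1 := by
        obtain rfl : ε = 1 := by omega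
        exact ⟨m, by push_cast; ring⟩
      have := expClass_neg (d := d) h0
      rw [neg_zero] at this
      congr 1
      refine if_congr ?_ rfl rfl
      constructor
      · intro h
        rw [this, h, sub_sub_cancel]
      · rintro rfl
        exact this

theorem sum_classCount [NeZero d] {ε m : ℕ} (K : Fin m → ℤ) :
    ∑ c : ZMod d, classCount d ε m K c = (ε + 2 * m : ℕ) := by
  simp only [classCount]
  rw [Finset.sum_comm]
  simp

/-- The residues of `K` modulo `2d` are those of `L` up to order and signs. -/
def IsSim (d : ℕ) {m : ℕ} (K L : Fin m → ℤ) : Prop :=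
  ∃ (σ : Equiv.Perm (Fin m)) (s : Fin m → ℤ), (∀ i, s i = 1 ∨ s i = -1) ∧
    ∀ i, (s i * K (σ i)) % (2 * d) = L i % (2 * d)

/-- Equal class counts give a matching: the classes up to negation, as unordered pairs, have
fibres of the same size under both tuples. -/
theorem isSim_of_classCount_eq {ε m : ℕ} {K L : Fin m → ℤ}
    (hK : ∀ i, 2 ∣ K i + (ε + 2 * m : ℕ) - 1) (hL : ∀ i, 2 ∣ L i + (ε + 2 * m : ℕ) - 1)
    (h : classCount d ε m K = classCount d ε m L) : IsSim d K L := by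
  set N := ε + 2 * m with hN
  set τ : ZMod d → ZMod d := fun c => (N : ZMod d) - 1 - c with hτ
  have hττ : ∀ c, τ (τ c) = c := fun c => by simp [hτ]
  set f : (Fin m → ℤ) → Fin m → Sym2 (ZMod d) :=
    fun K i => s(expClass d N (K i), τ (expClass d N (K i))) with hf
  have hiff : ∀ (K : Fin m → ℤ) i c, f K i = s(c, τ c) ↔
      expClass d N (K i) = c ∨ expClass d N (K i) = τ c := by
    intro K i c
    rw [hf, Sym2.eq_iff]
    constructor
    · rintro (h | h)
      · exact Or.inl h.1
      · exact Or.inr h.1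
    · rintro (h | h)
      · exact Or.inl ⟨h, by rw [h]⟩
      · exact Or.inr ⟨h, by rw [h, hττ]⟩
  have hcount : ∀ c, ∑ i, (if f K i = s(c, τ c) then (1 : ℤ) else 0) =
      ∑ i, if f L i = s(c, τ c) then (1 : ℤ) else 0 := by
    intro c
    have h1 := congrFun h c
    rw [classCount_eq hK, classCount_eq hL, add_left_inj] at h1
    simp only [hiff]
    by_cases hc : τ c = c
    · simp only [hc, or_self]
      change ∑ i, (_ + if _ = τ c then (1 : ℤ) else 0) =
        ∑ i, (_ + if _ = τ c then (1 : ℤ) else 0) at h1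
      simp only [hc, ← two_mul, ← Finset.mul_sum] at h1
      exact mul_left_cancel₀ two_ne_zero h1
    · have h2 : ∀ (K : Fin m → ℤ) i, (if expClass d N (K i) = c ∨ expClass d N (K i) = τ c then
          (1 : ℤ) else 0) = (if expClass d N (K i) = c then 1 else 0) +
          if expClass d N (K i) = τ c then 1 else 0 := by
        intro K i
        by_cases h3 : expClass d N (K i) = c
        · have h4 : ¬ (expClass d N (K i) = τ c) := fun h4 => hc (h4.symm.trans h3)
          rw [if_pos (Or.inl h3), if_pos h3, if_neg h4, add_zero]
        · simp only [h3, false_or, if_false, zero_add]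
      simp only [h2]
      exact h1
  have hcard : ∀ z, Fintype.card {i // f L i = z} = Fintype.card {i // f K i = z} := by
    intro z
    rw [Fintype.card_subtype, Fintype.card_subtype]
    by_cases hz : ∃ c, z = s(c, τ c)
    · obtain ⟨c, rfl⟩ := hz
      have := hcount c
      simp only [Finset.sum_boole] at this
      exact_mod_cast this.symm
    · have h1 : ∀ K : Fin m → ℤ, Finset.univ.filter (fun i => f K i = z) = ∅ := by
        intro K
        rw [Finset.filter_eq_empty_iff]
        rintro i - rfl
        exact hz ⟨_, rfl⟩
      rw [h1, h1]
  set σ : Equiv.Perm (Fin m) := Equiv.ofFiberEquiv fun z => Fintype.equivOfCardEq (hcard z)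
    with hσdef
  have hσ : ∀ i, f K (σ i) = f L i := fun i => Equiv.ofFiberEquiv_map _ i
  have hs : ∀ i, ∃ s : ℤ, (s = 1 ∨ s = -1) ∧ (s * K (σ i)) % (2 * d) = L i % (2 * d) := by
    intro i
    have h2 := (hiff K (σ i) (expClass d N (L i))).1 (hσ i)
    rcases h2 with h2 | h2
    · exact ⟨1, Or.inl rfl, by rw [one_mul]; exact (expClass_eq_iff (hK _) (hL _)).1 h2⟩
    · refine ⟨-1, Or.inr rfl, ?_⟩
      have h3 : (2 : ℤ) ∣ -K (σ i) + N - 1 := by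
        have := hK (σ i)
        omega
      rw [neg_one_mul]
      refine (expClass_eq_iff h3 (hL _)).1 ?_
      rw [expClass_neg (hK _), h2]
      exact hττ _
  choose s hs1 hs2 using hs
  exact ⟨σ, s, hs1, hs2⟩

end classes

/-! ### The base exponents -/

section baseExponents

/-- The exponents `1, 3, …, 2m - 1` (for `ε = 0`) or `2, 4, …, 2m` (for `ε = 1`). -/
def baseExp (ε m : ℕ) (i : Fin m) : ℤ := 2 * (i : ℕ) + 1 + ε

theorem dvd_baseExp {ε m : ℕ} (i : Fin m) : 2 ∣ baseExp ε m i + (ε + 2 * m : ℕ) - 1 :=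
  ⟨(i : ℕ) + ε + m, by rw [baseExp]; push_cast; ring⟩

/-- Up to order, the entries of `pmVec` at the base exponents are `1 - N, 3 - N, …, N - 1`. -/
theorem exists_perm_pmVec_baseExp {ε : ℕ} (hε : ε ≤ 1) (m : ℕ) :
    ∃ π : Equiv.Perm (Fin (ε + 2 * m)), ∀ j,
      pmVec ε m (baseExp ε m) j = 2 * ((π j : ℕ) : ℤ) + 1 - (ε + 2 * m : ℕ) := by
  set g : (Fin m × Bool) ⊕ Fin ε → Fin (ε + 2 * m) := Sum.elim
    (fun p => if p.2 then ⟨m - 1 - p.1, by have := p.1.2; omega⟩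
      else ⟨p.1 + m + ε, by have := p.1.2; omega⟩) (fun e => ⟨m, by have := e.2; omega⟩) with hg
  have hbij : Function.Bijective g := by
    rw [Fintype.bijective_iff_injective_and_card]
    constructor
    · rintro (⟨⟨i, hi⟩, b⟩ | ⟨e, he⟩) (⟨⟨j, hj⟩, c⟩ | ⟨e', he'⟩) h
      · cases b <;> cases c <;> simp [hg] at h ⊢ <;> omega
      · cases b <;> simp [hg] at h <;> omega
      · cases c <;> simp [hg] at h <;> omega
      · simp; omega
    · simp; omega
  refine ⟨(pmEquiv ε m).symm.trans (Equiv.ofBijective g hbij), fun j => ?_⟩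
  obtain ⟨c, rfl⟩ := (pmEquiv ε m).surjective j
  rw [Equiv.trans_apply, Equiv.symm_apply_apply, Equiv.ofBijective_apply]
  rcases c with ⟨⟨i, hi⟩, b⟩ | ⟨e, he⟩
  · cases b
    · simp only [pmVec_pmEquiv_inl, hg, baseExp, Sum.elim_inl, Bool.false_eq_true, if_false]
      push_cast; ring
    · simp only [pmVec_pmEquiv_inl, hg, baseExp, Sum.elim_inl, if_true]
      omega
  · simp only [pmVec_pmEquiv_inr, hg, Sum.elim_inr]
    omega

variable {d : ℕ}

/-- The number of pairs of congruent elements of `{0, …, N - 1}`. -/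
def congPairs (d N : ℕ) : ℕ := pairCount fun i : Fin N => ((i : ℕ) : ZMod d)

theorem classCount_baseExp {ε : ℕ} (hε : ε ≤ 1) (m : ℕ) (c : ZMod d) :
    classCount d ε m (baseExp ε m) c =
      ∑ i : Fin (ε + 2 * m), if ((i : ℕ) : ZMod d) = c then (1 : ℤ) else 0 := by
  obtain ⟨π, hπ⟩ := exists_perm_pmVec_baseExp hε m
  rw [classCount, ← Equiv.sum_comp π fun i => if ((i : ℕ) : ZMod d) = c then (1 : ℤ) else 0]
  refine Finset.sum_congr rfl fun j _ => ?_
  have : expClass d (ε + 2 * m) (pmVec ε m (baseExp ε m) j) = ((π j : ℕ) : ZMod d) := by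
    rw [hπ, expClass, show 2 * ((π j : ℕ) : ℤ) + 1 - (ε + 2 * m : ℕ) + (ε + 2 * m : ℕ) - 1 =
      2 * ((π j : ℕ) : ℤ) by ring, Int.mul_ediv_cancel_left _ two_ne_zero, Int.cast_natCast]
  rw [this]

theorem dvd_pmVec {ε : ℕ} (hε : ε ≤ 1) {m : ℕ} {K : Fin m → ℤ}
    (hK : ∀ i, 2 ∣ K i + (ε + 2 * m : ℕ) - 1) (j : Fin (ε + 2 * m)) :
    2 ∣ pmVec ε m K j + (ε + 2 * m : ℕ) - 1 := by
  obtain ⟨c, rfl⟩ := (pmEquiv ε m).surjective j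
  rcases c with ⟨i, b⟩ | e
  · rw [pmVec_pmEquiv_inl]
    have := hK i
    split_ifs <;> omega
  · rw [pmVec_pmEquiv_inr]
    have := e.2
    omega

theorem two_mul_pairCount_pmVec [NeZero d] {ζ : ℂˣ} (hζ : IsPrimitiveRoot ζ (2 * d)) {ε : ℕ}
    (hε : ε ≤ 1) {m : ℕ} {K : Fin m → ℤ} (hK : ∀ i, 2 ∣ K i + (ε + 2 * m : ℕ) - 1) :
    ((2 * pairCount (zcl ζ (pmVec ε m K)) + (ε + 2 * m) : ℕ) : ℤ) =
      ∑ c : ZMod d, classCount d ε m K c ^ 2 := by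
  rw [two_mul_pairCount]
  simp only [classCount]
  rw [← sum_sum_ite_eq_sum_sq]
  congr 1
  refine Finset.sum_congr rfl fun i _ => Finset.sum_congr rfl fun j _ => if_congr ?_ rfl rfl
  rw [zcl, zcl, Units.val_inj, zpow_eq_zpow_iff_emod hζ,
    expClass_eq_iff (dvd_pmVec hε hK i) (dvd_pmVec hε hK j)]

theorem two_mul_congPairs [NeZero d] {ε : ℕ} (hε : ε ≤ 1) (m : ℕ) :
    ((2 * congPairs d (ε + 2 * m) + (ε + 2 * m) : ℕ) : ℤ) =
      ∑ c : ZMod d, classCount d ε m (baseExp ε m) c ^ 2 := by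
  rw [congPairs, two_mul_pairCount, sum_sum_ite_eq_sum_sq]
  simp only [classCount_baseExp hε]

theorem pairCount_baseExp [NeZero d] {ζ : ℂˣ} (hζ : IsPrimitiveRoot ζ (2 * d)) {ε : ℕ}
    (hε : ε ≤ 1) (m : ℕ) :
    pairCount (zcl ζ (pmVec ε m (baseExp ε m))) = congPairs d (ε + 2 * m) := by
  have h1 := two_mul_pairCount_pmVec hζ hε (dvd_baseExp (ε := ε) (m := m))
  rw [← two_mul_congPairs hε] at h1
  have := Int.ofNat_inj.1 h1
  omega

/-- Exponents whose residues are not those of the base exponents, up to order and signs, have more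
pairs in the same class: the base exponents are distributed as evenly as possible. -/
theorem congPairs_lt_pairCount [NeZero d] {ζ : ℂˣ} (hζ : IsPrimitiveRoot ζ (2 * d)) {ε : ℕ}
    (hε : ε ≤ 1) {m n : ℕ} (hN : ε + 2 * m = d * n ∨ ε + 2 * m = d * n + 1 ∨ ε + 2 * m + 1 = d * n)
    {K : Fin m → ℤ} (hK : ∀ i, 2 ∣ K i + (ε + 2 * m : ℕ) - 1)
    (h : ¬ IsSim d K (baseExp ε m)) :
    congPairs d (ε + 2 * m) < pairCount (zcl ζ (pmVec ε m K)) := by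
  by_contra hle
  refine h (isSim_of_classCount_eq hK dvd_baseExp ?_)
  refine eq_of_sum_sq_le (τ := fun c => ((ε + 2 * m : ℕ) : ZMod d) - 1 - c) (ν := n)
    (classCount_symm hε hK) (classCount_symm hε dvd_baseExp) ?_ ?_ ?_ ?_
  · intro c hc
    rw [classCount_eq hK, classCount_eq dvd_baseExp, hc, add_sub_add_right_eq_sub]
    simp only [← two_mul, ← Finset.mul_sum, ← mul_sub]
    exact even_two_mul _
  · rw [sum_classCount, sum_classCount]
  · simp only [classCount_baseExp hε]
    exact sum_sq_count_le_one hN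
  · rw [← two_mul_congPairs hε, ← two_mul_pairCount_pmVec hζ hε hK]
    push_cast at hle ⊢
    have : (pairCount (zcl ζ (pmVec ε m K)) : ℤ) ≤ congPairs d (ε + 2 * m) := by
      exact_mod_cast not_lt.1 hle
    linarith

end baseExponents

/-! ### Limits of theta series and of products of ratios -/

section limit

open Filter Topology
open scoped PowerSeries.WithPiTopology

theorem tendsto_gf {α ι : Type*} {l : Filter α} {e : ι → ℕ} (he : FinFib e) {a : α → ι → ℂ}
    {b : ι → ℂ} (h : ∀ i, Tendsto (fun t => a t i) l (𝓝 (b i))) :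
    Tendsto (fun t => gf e (a t)) l (𝓝 (gf e b)) := by
  rw [PowerSeries.WithPiTopology.tendsto_iff_coeff_tendsto]
  intro n
  have hs : ∀ i, e i = n → i ∈ (he n).toFinset := fun i hi => by simp [hi]
  rw [coeff_gf_eq_sum b _ hs]
  refine Tendsto.congr (fun t => (coeff_gf_eq_sum (a t) _ hs).symm) ?_
  exact tendsto_finsetSum _ fun i _ => h i

theorem tendsto_th4 {α : Type*} {l : Filter α} {r : ℕ} (hr : 0 < r) {x : α → ℂˣ} {x₀ : ℂˣ}
    (h : ∀ k : ℤ, Tendsto (fun t => ((x t ^ k : ℂˣ) : ℂ)) l (𝓝 ((x₀ ^ k : ℂˣ) : ℂ))) :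
    Tendsto (fun t => th4 r (x t)) l (𝓝 (th4 r x₀)) := by
  refine tendsto_gf (finFib_eSq hr) fun n => ?_
  simp only [Units.val_mul]
  exact ((h _).const_mul _).const_mul _

theorem tendsto_Om {α : Type*} {l : Filter α} {r : ℕ} (hr : 0 < r) {x : α → ℂˣ} {x₀ : ℂˣ}
    (h : ∀ k : ℤ, Tendsto (fun t => ((x t ^ k : ℂˣ) : ℂ)) l (𝓝 ((x₀ ^ k : ℂˣ) : ℂ))) :
    Tendsto (fun t => Om r (x t)) l (𝓝 (Om r x₀)) := by
  refine tendsto_gf (finFib_ePr_nat hr) fun n => ?_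
  exact (tendsto_finsetSum _ fun j _ => h _).const_mul _

theorem tendsto_specPt_div {N : ℕ} (ζ : ℂˣ) (d : ℕ) (i j : Fin N) (k : ℤ) :
    Tendsto (fun h : ℝ => (((specPt ζ d h i / specPt ζ d h j) ^ k : ℂˣ) : ℂ)) (𝓝[≠] 0)
      (𝓝 (((ζ ^ ((i : ℤ) - j)) ^ k : ℂˣ) : ℂ)) := by
  have h1 : ∀ h : ℝ, (((specPt ζ d h i / specPt ζ d h j) ^ k : ℂˣ) : ℂ) =
      (((ζ ^ ((i : ℤ) - j)) ^ k : ℂˣ) : ℂ) *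
        ((expUnit h ^ ((((i : ℕ) / d : ℕ) - ((j : ℕ) / d : ℕ) : ℤ) * k) : ℂˣ) : ℂ) := by
    intro h
    rw [← Units.val_mul, specPt, specPt, mul_div_mul_comm, mul_zpow, zpow_mul, zpow_sub, zpow_sub,
      zpow_natCast, zpow_natCast, zpow_natCast, zpow_natCast, ← div_eq_mul_inv, ← div_eq_mul_inv]
  simp only [h1]
  simpa using (tendsto_expUnit_zpow ((((i : ℕ) / d : ℕ) - ((j : ℕ) / d : ℕ) : ℤ) * k)).const_mul
    (((ζ ^ ((i : ℤ) - j)) ^ k : ℂˣ) : ℂ)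

/-- The product of the differences `y j / y i - y i / y j`. -/
noncomputable def ratioVander {N : ℕ} (y : Fin N → ℂˣ) : ℂ :=
  pairProd fun i j => (((y i / y j)⁻¹ : ℂˣ) : ℂ) - ((y i / y j : ℂˣ) : ℂ)

theorem sq_ne_sq_of_ratioVander_ne_zero {N : ℕ} {y : Fin N → ℂˣ} (hy : ratioVander y ≠ 0)
    {i j : Fin N} (hij : i ≠ j) : y i ^ 2 ≠ y j ^ 2 := by
  have key : ∀ {a b : Fin N}, a < b → y a ^ 2 ≠ y b ^ 2 := by
    intro a b hab he
    refine hy (pairProd_eq_zero hab ?_)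
    have : (y a / y b)⁻¹ = y a / y b := by
      rw [inv_div, div_eq_div_iff_mul_eq_mul, ← sq, ← sq, he]
    rw [this, sub_self]
  rcases lt_or_gt_of_ne hij with h | h
  · exact key h
  · exact (key h).symm

/-- The leading coefficient of `ratioVander (specPt ζ d h)` as `h → 0`. -/
noncomputable def ratioLead (ζ : ℂˣ) (d N : ℕ) : ℂ :=
  pairProd fun i j : Fin N => if ((i : ℕ) : ZMod d) = ((j : ℕ) : ZMod d) then
    ((ζ ^ ((j : ℤ) - i) : ℂˣ) : ℂ) * (2 * (((j : ℕ) / d : ℕ) - ((i : ℕ) / d : ℕ)))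
    else ((ζ ^ ((j : ℤ) - i) : ℂˣ) : ℂ) - ((ζ ^ ((i : ℤ) - j) : ℂˣ) : ℂ)

theorem zpow_sub_eq_zpow_sub_iff {d : ℕ} {ζ : ℂˣ} (hζ : IsPrimitiveRoot ζ (2 * d)) (i j : ℕ) :
    ζ ^ ((j : ℤ) - i) = ζ ^ ((i : ℤ) - j) ↔ (i : ZMod d) = (j : ZMod d) := by
  rw [← mul_inv_eq_one, ← zpow_sub, hζ.zpow_eq_one_iff_dvd,
    show (j : ℤ) - i - (i - j) = 2 * (j - i) by ring]
  push_cast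
  rw [mul_dvd_mul_iff_left (two_ne_zero' ℤ), ← ZMod.intCast_eq_intCast_iff_dvd_sub]
  push_cast
  rfl

theorem ratioLead_ne_zero {d : ℕ} {ζ : ℂˣ} (hζ : IsPrimitiveRoot ζ (2 * d)) (N : ℕ) :
    ratioLead ζ d N ≠ 0 := by
  rw [ratioLead, pairProd]
  refine Finset.prod_ne_zero_iff.2 fun i _ => Finset.prod_ne_zero_iff.2 fun j _ => ?_
  split_ifs with hij h
  · refine mul_ne_zero (Units.ne_zero _) (mul_ne_zero two_ne_zero (sub_ne_zero.2 ?_))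
    rw [Nat.cast_injective.ne_iff]
    rw [ZMod.natCast_eq_natCast_iff'] at h
    intro he
    have h1 := Nat.div_add_mod (i : ℕ) d
    have h2 := Nat.div_add_mod (j : ℕ) d
    rw [h, ← he, h2] at h1
    exact hij.ne' (Fin.ext h1)
  · rw [sub_ne_zero, Ne, Units.val_inj, zpow_sub_eq_zpow_sub_iff hζ]
    exact h
  · exact one_ne_zero

theorem tendsto_ratioVander {d : ℕ} {ζ : ℂˣ} (hζ : IsPrimitiveRoot ζ (2 * d))
    (N : ℕ) : Tendsto (fun h : ℝ => ratioVander (specPt (N := N) ζ d h) / (h : ℂ) ^ congPairs d N)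
      (𝓝[≠] 0) (𝓝 (ratioLead ζ d N)) := by
  have hne : ∀ᶠ h : ℝ in 𝓝[≠] 0, h ≠ 0 := eventually_mem_nhdsWithin
  have h1 : Tendsto (fun h : ℝ => pairProd fun i j : Fin N =>
      ((((specPt ζ d h i / specPt ζ d h j)⁻¹ : ℂˣ) : ℂ) -
        ((specPt ζ d h i / specPt ζ d h j : ℂˣ) : ℂ)) /
        if ((i : ℕ) : ZMod d) = ((j : ℕ) : ZMod d) then (h : ℂ) else 1)
      (𝓝[≠] 0) (𝓝 (ratioLead ζ d N)) := by
    refine tendsto_pairProd fun i j _ => ?_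
    split_ifs with hij
    · have h2 := (tendsto_expUnit_sub (((i : ℕ) / d : ℕ) - ((j : ℕ) / d : ℕ) : ℤ)
        (((j : ℕ) / d : ℕ) - ((i : ℕ) / d : ℕ) : ℤ)).const_mul (((ζ ^ ((j : ℤ) - i) : ℂˣ) : ℂ))
      refine (h2.congr fun h => ?_).trans (le_of_eq ?_)
      · rw [mul_div_assoc', mul_sub, ← Units.val_mul, ← Units.val_mul]
        nth_rewrite 2 [(zpow_sub_eq_zpow_sub_iff hζ _ _).2 hij]
        rw [inv_div, specPt, specPt, mul_div_mul_comm, mul_div_mul_comm, zpow_sub, zpow_sub,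
          zpow_sub, zpow_sub]
        simp only [zpow_natCast, ← div_eq_mul_inv]
      · congr 1
        simp only [Int.cast_sub, Int.cast_natCast]
        ring
    · simp only [div_one]
      have h2 := (tendsto_specPt_div ζ d j i 1).sub (tendsto_specPt_div ζ d i j 1)
      simp only [zpow_one] at h2
      simpa only [inv_div] using h2
  refine h1.congr' ?_
  filter_upwards [hne] with h hh
  have hh' : (h : ℂ) ≠ 0 := by exact_mod_cast hh
  rw [congPairs, ← pairProd_ite_const, eq_div_iff, ← pairProd_mul, ratioVander]
  · refine pairProd_congr fun i j _ => div_mul_cancel₀ _ ?_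
    split_ifs
    · exact hh'
    · exact one_ne_zero
  · rw [pairProd_ite_const]
    exact pow_ne_zero _ hh'

theorem eventually_ratioVander_ne_zero {d : ℕ} {ζ : ℂˣ}
    (hζ : IsPrimitiveRoot ζ (2 * d)) (N : ℕ) :
    ∀ᶠ h : ℝ in 𝓝[≠] 0, ratioVander (specPt (N := N) ζ d h) ≠ 0 := by
  filter_upwards [(tendsto_ratioVander hζ N).eventually_ne (ratioLead_ne_zero hζ N)] with h hh h0
  exact hh (by rw [h0, zero_div])

end limit

/-! ### The limit of the determinant identity -/

section limitIdentity

open Filter Topology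
open scoped PowerSeries.WithPiTopology

variable {d ε m : ℕ}

theorem expWeight_baseExp_ne_zero (d ε m : ℕ) : expWeight d (baseExp ε m) ≠ 0 := by
  have h1 : ∀ i : Fin m, (baseExp ε m i : ℚ) ≠ 0 := fun i => by
    rw [Int.cast_ne_zero, baseExp]
    omega
  rw [expWeight, pairProd]
  refine mul_ne_zero (Finset.prod_ne_zero_iff.2 fun i _ => mul_ne_zero ?_ ?_)
    (Finset.prod_ne_zero_iff.2 fun i _ => Finset.prod_ne_zero_iff.2 fun j _ => ?_)
  · rw [expSign]
    split_ifs <;> norm_num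
  · rw [expSelf]
    split_ifs
    · exact h1 i
    · exact div_ne_zero (pow_ne_zero _ (h1 i)) four_ne_zero
    · exact one_ne_zero
  · split_ifs with hij
    · have hij' : (i : ℕ) < j := hij
      have h2 : (baseExp ε m j : ℚ) - baseExp ε m i ≠ 0 := by
        rw [← Int.cast_sub, Int.cast_ne_zero, baseExp, baseExp]
        omega
      have h3 : (baseExp ε m j : ℚ) + baseExp ε m i ≠ 0 := by
        rw [← Int.cast_add, Int.cast_ne_zero, baseExp, baseExp]
        omega
      rw [expPair]
      refine mul_ne_zero ?_ ?_
      · split_ifs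
        · exact pow_ne_zero _ (div_ne_zero h2 two_ne_zero)
        · exact one_ne_zero
      · split_ifs
        · exact pow_ne_zero _ (div_ne_zero h3 two_ne_zero)
        · exact one_ne_zero
    · exact one_ne_zero

/-- The factor of proportionality between the leading coefficients of the determinants and the
weights. -/
noncomputable def leadConst (ζ : ℂˣ) (d ε m : ℕ) : ℂ :=
  confluentDet (zcl ζ (pmVec ε m (baseExp ε m))) (fun i c => c ^ (i : ℕ)) (fun i => (i : ℕ) / d) *
    classVander ζ (pmVec ε m (baseExp ε m)) /
      (((expWeight d (baseExp ε m) : ℚ) : ℂ) * ratioLead ζ d (ε + 2 * m))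

/-- The limit when the exponents are congruent to the base exponents in order and sign: the
classes, and with them `confluentDet`, are those of the base exponents, and `classVander` is
proportional to the weight. -/
theorem tendsto_zvander_div_aux (hd : 0 < d) {ζ : ℂˣ} (hζ : IsPrimitiveRoot ζ (2 * d))
    (hε : ε ≤ 1) {K : Fin m → ℤ} (hK : ∀ i, K i % (2 * d) = baseExp ε m i % (2 * d)) :
    Tendsto (fun h : ℝ => zvander (specPt ζ d h) (pmVec ε m K) /
      ratioVander (specPt (N := ε + 2 * m) ζ d h)) (𝓝[≠] 0)
      (𝓝 (leadConst ζ d ε m * ((expWeight d K : ℚ) : ℂ))) := by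
  have hM : (0 : ℤ) < 2 * d := by positivity
  have := NeZero.of_pos hd
  have hz : zcl ζ (pmVec ε m K) = zcl ζ (pmVec ε m (baseExp ε m)) := by
    funext j
    obtain ⟨c, rfl⟩ := (pmEquiv ε m).surjective j
    rw [zcl, zcl, Units.val_inj, zpow_eq_zpow_iff_emod hζ]
    rcases c with ⟨i, b⟩ | e
    · rw [pmVec_pmEquiv_inl, pmVec_pmEquiv_inl]
      split_ifs
      · rw [neg_emod_eq_neg_emod hM, hK]
      · exact hK i
    · rw [pmVec_pmEquiv_inr, pmVec_pmEquiv_inr]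
  have h1 := tendsto_zvander_specPt ζ d (pmVec ε m K)
  have h2 := tendsto_ratioVander hζ (ε + 2 * m)
  rw [hz, pairCount_baseExp hζ hε] at h1
  have h3 := h1.div h2 (ratioLead_ne_zero hζ _)
  have hne : ∀ᶠ h : ℝ in 𝓝[≠] 0, h ≠ 0 := eventually_mem_nhdsWithin
  refine (h3.congr' ?_).trans (le_of_eq ?_)
  · filter_upwards [hne] with h hh
    have hh' : (h : ℂ) ≠ 0 := by exact_mod_cast hh
    exact div_div_div_cancel_right₀ (pow_ne_zero _ hh') _ _
  · congr 1
    have hε' : ε = 1 ∨ ε = 0 ∧ ∀ i, baseExp ε m i % (2 * d) ≠ 0 := by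
      rcases Nat.le_one_iff_eq_zero_or_eq_one.1 hε with rfl | rfl
      · refine Or.inr ⟨rfl, fun i h => ?_⟩
        have h4 : (2 : ℤ) ∣ baseExp 0 m i := (Dvd.intro _ rfl).trans (Int.dvd_of_emod_eq_zero h)
        rw [baseExp] at h4
        omega
      · exact Or.inl rfl
    have h5 := classVander_mul_expWeight hd hζ hε' hK
    have h6 : ((expWeight d (baseExp ε m) : ℚ) : ℂ) ≠ 0 :=
      Rat.cast_ne_zero.2 (expWeight_baseExp_ne_zero d ε m)
    have h7 := ratioLead_ne_zero hζ (ε + 2 * m)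
    rw [leadConst, div_mul_eq_mul_div, div_eq_div_iff h7 (mul_ne_zero h6 h7)]
    linear_combination confluentDet (zcl ζ (pmVec ε m (baseExp ε m))) (fun i c => c ^ (i : ℕ))
      (fun i => (i : ℕ) / d) * ratioLead ζ d (ε + 2 * m) * h5

open Classical in
/-- The limit of the determinants, normalised by `ratioVander`, at the special points. Exponents
equivalent to the base exponents are brought into order, with the same change of sign in determinant
and weight; for all others the numerator vanishes to higher order than the denominator. -/
theorem tendsto_zvander_div (hd : 0 < d) {ζ : ℂˣ} (hζ : IsPrimitiveRoot ζ (2 * d)) (hε : ε ≤ 1)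
    {n : ℕ} (hN : ε + 2 * m = d * n ∨ ε + 2 * m = d * n + 1 ∨ ε + 2 * m + 1 = d * n)
    {K : Fin m → ℤ} (hK : ∀ i, 2 ∣ K i + (ε + 2 * m : ℕ) - 1) :
    Tendsto (fun h : ℝ => zvander (specPt ζ d h) (pmVec ε m K) /
      ratioVander (specPt (N := ε + 2 * m) ζ d h)) (𝓝[≠] 0)
      (𝓝 (if IsSim d K (baseExp ε m) then
        leadConst ζ d ε m * ((expWeight d K : ℚ) : ℂ) else 0)) := by
  have := NeZero.of_pos hd
  split_ifs with h
  · obtain ⟨σ, s, hs, hKL⟩ := h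
    have h1 := tendsto_zvander_div_aux hd hζ hε (K := fun i => s i * (K ∘ σ) i) hKL
    have h2 : ((∏ i, s i : ℤ) : ℂ) ≠ 0 := by
      rw [Int.cast_ne_zero, Finset.prod_ne_zero_iff]
      intro i _
      rcases hs i with h | h <;> rw [h] <;> decide
    simp only [zvander_pmVec_sign _ _ s hs, zvander_pmVec_comp, expWeight_sign hd _ s hs,
      expWeight_comp hd, Rat.cast_mul, Rat.cast_intCast, mul_div_assoc] at h1
    have h3 := h1.const_mul (((∏ i, s i : ℤ) : ℂ)⁻¹)
    simpa only [inv_mul_cancel_left₀ h2, mul_left_comm (leadConst ζ d ε m)] using h3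
  · have h1 := tendsto_zvander_specPt ζ d (pmVec ε m K)
    have h2 := tendsto_ratioVander hζ (ε + 2 * m)
    have h3 := congPairs_lt_pairCount hζ hε hN hK h
    have h4 : Tendsto (fun t : ℝ => (t : ℂ) ^ (pairCount (zcl ζ (pmVec ε m K)) -
        congPairs d (ε + 2 * m))) (𝓝[≠] 0) (𝓝 0) := by
      have hc : Continuous fun t : ℝ => (t : ℂ) ^ (pairCount (zcl ζ (pmVec ε m K)) -
        congPairs d (ε + 2 * m)) := by fun_prop
      have := hc.tendsto 0
      rw [Complex.ofReal_zero, zero_pow (Nat.sub_pos_of_lt h3).ne'] at this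
      exact this.mono_left nhdsWithin_le_nhds
    have h5 := (h1.mul h4).div h2 (ratioLead_ne_zero hζ _)
    rw [mul_zero, zero_div] at h5
    have hne : ∀ᶠ h : ℝ in 𝓝[≠] 0, h ≠ 0 := eventually_mem_nhdsWithin
    refine h5.congr' ?_
    filter_upwards [hne] with t ht
    have ht' : (t : ℂ) ≠ 0 := by exact_mod_cast ht
    have h6 : (t : ℂ) ^ pairCount (zcl ζ (pmVec ε m K)) = (t : ℂ) ^ congPairs d (ε + 2 * m) *
        (t : ℂ) ^ (pairCount (zcl ζ (pmVec ε m K)) - congPairs d (ε + 2 * m)) := by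
      rw [← pow_add, Nat.add_sub_cancel' h3.le]
    simp only [Pi.div_apply]
    rw [h6, div_mul_eq_mul_div, mul_div_mul_right _ _ (pow_ne_zero _ ht'),
      div_div_div_cancel_right₀ (pow_ne_zero _ ht')]

open Classical in
/-- A product formula for the generating function of determinants at generic points yields, in
the limit at the special points, the generating function of the weights. -/
theorem gf_expWeight_eq (hd : 0 < d) {ζ : ℂˣ} (hζ : IsPrimitiveRoot ζ (2 * d)) (hε : ε ≤ 1)
    {n : ℕ} (hN : ε + 2 * m = d * n ∨ ε + 2 * m = d * n + 1 ∨ ε + 2 * m + 1 = d * n)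
    {κ : Type*} {e : κ → ℕ} (he : FinFib e) {a : κ → ℤ}
    (ha : ∀ i, 2 ∣ a i + (ε + 2 * m : ℕ) - 1) {r : ℕ} (hr : 0 < r) {c : PowerSeries ℂ}
    (hc : ∀ y : Fin (ε + 2 * m) → ℂˣ, (∀ i j, i ≠ j → y i ^ 2 ≠ y j ^ 2) →
      genDet e a ε m y = c * pairProd fun i j => w r (y i / y j)) :
    (gf (fun s : Fin m → κ => ∑ i, e (s i)) fun s =>
      if IsSim d (fun i => a (s i)) (baseExp ε m) then
        leadConst ζ d ε m * ((expWeight d fun i => a (s i) : ℚ) : ℂ) else 0) =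
      c * pairProd fun i j : Fin (ε + 2 * m) => W r (ζ ^ ((i : ℤ) - j)) := by
  have hfin := he.pi m
  have hP : (pairProd fun i j : Fin (ε + 2 * m) => th4 r (ζ ^ ((i : ℤ) - j))) ≠ 0 := by
    rw [pairProd]
    refine Finset.prod_ne_zero_iff.2 fun i _ => Finset.prod_ne_zero_iff.2 fun j _ => ?_
    split_ifs
    · exact th4_ne_zero hr _
    · exact one_ne_zero
  -- Multiplication by the series `th4` leaves only series each of whose coefficients is a finite
  -- sum, continuous in the points.
  refine mul_right_cancel₀ hP ?_
  rw [mul_assoc, ← pairProd_mul]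
  simp only [W_mul_th4 hr]
  have h1 := (tendsto_gf hfin fun s : Fin m → κ =>
    tendsto_zvander_div hd hζ hε hN (K := fun i => a (s i)) fun i => ha _).mul
    (tendsto_pairProd fun (i j : Fin (ε + 2 * m)) _ =>
      tendsto_th4 hr fun k => tendsto_specPt_div ζ d i j k)
  have h2 := (tendsto_const_nhds (x := c)).mul
    (tendsto_pairProd fun (i j : Fin (ε + 2 * m)) _ =>
      tendsto_Om hr fun k => tendsto_specPt_div ζ d i j k)
  refine tendsto_nhds_unique_of_eventuallyEq h1 h2 ?_
  filter_upwards [eventually_ratioVander_ne_zero hζ (ε + 2 * m)] with h hh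
  have h3 := hc _ fun i j hij => sq_ne_sq_of_ratioVander_ne_zero hh hij
  simp only [w_eq_mul_W hr] at h3
  have h6 : PowerSeries.C (ratioVander (specPt (N := ε + 2 * m) ζ d h)) =
      pairProd fun i j : Fin (ε + 2 * m) =>
        PowerSeries.C ((((specPt ζ d h i / specPt ζ d h j)⁻¹ : ℂˣ) : ℂ) -
          ((specPt ζ d h i / specPt ζ d h j : ℂˣ) : ℂ)) := by
    rw [ratioVander]
    exact map_pairProd (PowerSeries.C (R := ℂ)) _
  rw [pairProd_mul, ← h6] at h3
  have h4 : (gf (fun s : Fin m → κ => ∑ i, e (s i)) fun s =>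
      zvander (specPt ζ d h) (pmVec ε m fun i => a (s i)) /
        ratioVander (specPt (N := ε + 2 * m) ζ d h)) =
      PowerSeries.C (ratioVander (specPt (N := ε + 2 * m) ζ d h))⁻¹ *
        genDet e a ε m (specPt ζ d h) := by
    rw [genDet, C_mul_gf hfin]
    simp only [div_eq_inv_mul]
  have h5 : PowerSeries.C (ratioVander (specPt (N := ε + 2 * m) ζ d h))⁻¹ *
      PowerSeries.C (ratioVander (specPt (N := ε + 2 * m) ζ d h)) = 1 := by
    rw [← map_mul, inv_mul_cancel₀ hh, map_one]
  rw [h4, h3, mul_left_comm c, ← mul_assoc (PowerSeries.C _), h5, one_mul, mul_assoc,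
    ← pairProd_mul]
  simp only [W_mul_th4 hr]

end limitIdentity

/-! ### Products of theta quotients at roots of unity -/

section thetaProducts

theorem Om_inv {r : ℕ} (x : ℂˣ) : Om r x⁻¹ = Om r x := by
  rw [Om, Om]
  congr 1
  funext n
  rw [← Finset.sum_range_reflect]
  congr 1
  refine Finset.sum_congr rfl fun j hj => ?_
  have hj' := Finset.mem_range.1 hj
  rw [inv_zpow', show -(2 * ((2 * n + 1 - 1 - j : ℕ) : ℤ) - 2 * n) = 2 * (j : ℤ) - 2 * n by omega]

theorem Om_neg {r : ℕ} (x : ℂˣ) : Om r (-x) = Om r x := by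
  rw [Om, Om]
  congr 1
  funext n
  congr 1
  refine Finset.sum_congr rfl fun j _ => ?_
  have : Even (2 * (j : ℤ) - 2 * n) := ⟨j - n, by ring⟩
  rw [this.neg_zpow]

theorem W_inv {r : ℕ} (x : ℂˣ) : W r x⁻¹ = W r x := by
  rw [W, W, Om_inv, th4_inv]

theorem W_neg {r : ℕ} (x : ℂˣ) : W r (-x) = W r x := by
  rw [W, W, Om_neg, th4_neg]

section periodic

variable {R : Type*} {g : ℤ → R} {d : ℕ}

theorem apply_add_mul_of_periodic (hper : ∀ a, g (a + d) = g a) (n : ℕ) (a : ℤ) :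
    g (a + (d * n : ℕ)) = g a := by
  induction n with
  | zero => simp
  | succ n ih => rw [mul_add_one, Nat.cast_add, ← add_assoc, hper, ih]

variable [CommRing R] {P : R}

theorem prod_range_of_prod_block (hblock : ∀ a : ℤ, ∏ j ∈ Finset.range d, g (a + j) = P) (n : ℕ)
    (a : ℤ) : ∏ j ∈ Finset.range (d * n), g (a + j) = P ^ n := by
  induction n with
  | zero => simp
  | succ n ih =>
    rw [mul_add_one, Finset.prod_range_add, ih, pow_succ, ← hblock (a + (d * n : ℕ))]
    congr 1
    refine Finset.prod_congr rfl fun j _ => ?_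
    push_cast
    rw [add_assoc]

theorem pairProd_sub_sq (hneg : ∀ a, g (-a) = g a) (N : ℕ) :
    (pairProd fun i j : Fin N => g ((i : ℤ) - j)) ^ 2 * g 0 ^ N =
      ∏ i ∈ Finset.range N, ∏ j ∈ Finset.range N, g (-(i : ℤ) + j) := by
  have h1 := pairProd_sq (f := fun i j : Fin N => g ((i : ℤ) - j)) fun i j => by
    rw [← hneg, neg_sub]
  simp only [sub_self, Finset.prod_const, Finset.card_univ, Fintype.card_fin] at h1
  rw [h1, Finset.prod_range]
  refine Finset.prod_congr rfl fun i _ => ?_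
  rw [Finset.prod_range]
  refine Finset.prod_congr rfl fun j _ => ?_
  rw [← hneg, neg_sub, neg_add_eq_sub]

/-- The square of a product of differences over `N` points, for an even function of period `d`
and `N = d * n`, `d * n + 1` or `d * n - 1`. -/
theorem pairProd_sub_sq_eq (hneg : ∀ a, g (-a) = g a) (hper : ∀ a, g (a + d) = g a)
    (hblock : ∀ a : ℤ, ∏ j ∈ Finset.range d, g (a + j) = P) (n N : ℕ) :
    (N = d * n → (pairProd fun i j : Fin N => g ((i : ℤ) - j)) ^ 2 * g 0 ^ N = P ^ (n * N)) ∧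
    (N = d * n + 1 → (pairProd fun i j : Fin N => g ((i : ℤ) - j)) ^ 2 * g 0 ^ N =
      P ^ (n * (N + 1)) * g 0) ∧
    (N + 1 = d * n → (pairProd fun i j : Fin N => g ((i : ℤ) - j)) ^ 2 * g 0 ^ N * P ^ n =
      P ^ (n * N) * g 0) := by
  have h1 := prod_range_of_prod_block hblock n
  have h2 := apply_add_mul_of_periodic hper n
  have h3 : ∏ i ∈ Finset.range (d * n), g (-(i : ℤ)) = P ^ n := by
    simp only [hneg]
    simpa using h1 0
  refine ⟨fun hN => ?_, fun hN => ?_, fun hN => ?_⟩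
  · subst hN
    rw [pairProd_sub_sq hneg]
    simp only [h1, Finset.prod_const, Finset.card_range, ← pow_mul]
  · subst hN
    rw [pairProd_sub_sq hneg]
    simp only [Finset.prod_range_succ (fun j : ℕ => g (_ + (j : ℤ))), h1, h2]
    rw [Finset.prod_mul_distrib, Finset.prod_range_succ (fun i : ℕ => g (-(i : ℤ))), h3,
      hneg ((d * n : ℕ) : ℤ), ← zero_add ((d * n : ℕ) : ℤ), h2, Finset.prod_const,
      Finset.card_range, ← pow_mul, ← mul_assoc, ← pow_add]
    congr 2
  · have h4 : ∀ i : ℕ, (∏ j ∈ Finset.range N, g (-(i : ℤ) + j)) * g (-((i + 1 : ℕ) : ℤ)) =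
        P ^ n := by
      intro i
      rw [← h1 (-(i : ℤ)), ← hN, Finset.prod_range_succ]
      congr 1
      rw [← h2 (-((i + 1 : ℕ) : ℤ)), ← hN]
      congr 1
      push_cast
      ring
    have h5 : (∏ i ∈ Finset.range N, g (-((i + 1 : ℕ) : ℤ))) * g 0 = P ^ n := by
      rw [← h3, ← hN, Finset.prod_range_succ']
      simp
    have h6 : (∏ i ∈ Finset.range N, ∏ j ∈ Finset.range N, g (-(i : ℤ) + j)) *
        ∏ i ∈ Finset.range N, g (-((i + 1 : ℕ) : ℤ)) = P ^ (n * N) := by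
      rw [← Finset.prod_mul_distrib]
      simp only [h4, Finset.prod_const, Finset.card_range, ← pow_mul]
    rw [pairProd_sub_sq hneg, ← h5, ← h6, mul_assoc]

end periodic

theorem constantCoeff_psi {s : ℕ} (hs : 0 < s) : PowerSeries.constantCoeff (psi s) = 1 := by
  rw [psi, constantCoeff_gf_zero _ {0}, Finset.sum_singleton]
  intro n
  rw [Finset.mem_singleton]
  refine ⟨fun hn => ?_, fun hn => by simp [hn]⟩
  by_contra h
  have h1 : 1 ≤ n * (n + 1) / 2 := by
    rw [Nat.le_div_iff_mul_le two_pos]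
    have : 1 ≤ n := Nat.pos_of_ne_zero h
    nlinarith
  have h2 := Nat.mul_pos hs h1
  omega

theorem constantCoeff_W {r : ℕ} (hr : 0 < r) (x : ℂˣ) :
    PowerSeries.constantCoeff (W r x) = 1 := by
  have h1 : PowerSeries.constantCoeff (Om r x) = 1 := by
    rw [← PowerSeries.coeff_zero_eq_constantCoeff_apply, Om, coeff_gf_eq_sum _ {0}]
    · have h0 : ePr r ((0 : ℕ) : ℤ) = 0 := by zify; rw [ePr_cast]; simp
      rw [Finset.sum_filter, Finset.sum_singleton, if_pos h0]
      simp
    · intro n hn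
      rw [Finset.mem_singleton]
      by_contra h
      have h1 := ePr_cast r n
      rw [hn] at h1
      have h2 : (0 : ℤ) < r * (n * (n + 1)) := by
        have : 0 < n := Nat.pos_of_ne_zero h
        positivity
      push_cast at h1
      linarith
  have h2 := congrArg PowerSeries.constantCoeff (W_mul_th4 hr x)
  rwa [map_mul, constantCoeff_th4 hr, mul_one, h1] at h2

/-- The sign of a square root is determined by the constant coefficient. -/
theorem eq_of_sq_eq_of_constantCoeff {f g : PowerSeries ℂ} (h : f ^ 2 = g ^ 2)
    (hf : PowerSeries.constantCoeff f = 1) (hg : PowerSeries.constantCoeff g = 1) : f = g := by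
  rcases sq_eq_sq_iff_eq_or_eq_neg.1 h with h | h
  · exact h
  · rw [h, map_neg, hg] at hf
    norm_num at hf

/-- At the powers of a root of unity the theta quotients multiply to a power of `psi`. -/
theorem psi_pow_mul_pairProd_W {r d : ℕ} (hr : 0 < r) (hd : 0 < d) {ζ : ℂˣ}
    (hζ : IsPrimitiveRoot ζ (2 * d)) (n N : ℕ) :
    (N = d * n → psi r ^ N * (pairProd fun i j : Fin N => W r (ζ ^ ((i : ℤ) - j))) =
      psi (r * d) ^ (n * N)) ∧
    (N = d * n + 1 → psi r ^ (N - 1) * (pairProd fun i j : Fin N => W r (ζ ^ ((i : ℤ) - j))) =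
      psi (r * d) ^ (n * (N + 1))) ∧
    (N + 1 = d * n → 0 < N → psi r ^ (N - 1) *
      (pairProd fun i j : Fin N => W r (ζ ^ ((i : ℤ) - j))) = psi (r * d) ^ (n * (N - 1))) := by
  have hζd : ζ ^ d = -1 := by
    have h1 : ζ ^ d ≠ 1 := hζ.pow_ne_one_of_pos_of_lt hd.ne' (by omega)
    have h2 : (ζ ^ d) ^ 2 = 1 := by rw [← pow_mul, mul_comm, hζ.pow_eq_one]
    have h3 : ((ζ ^ d : ℂˣ) : ℂ) ^ 2 = 1 := by
      rw [← Units.val_pow_eq_pow_val, h2, Units.val_one]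
    rcases sq_eq_one_iff.1 h3 with h | h
    · exact absurd (Units.ext h) h1
    · exact Units.ext h
  have hζ2 : IsPrimitiveRoot (ζ ^ 2) d := hζ.pow (by omega) rfl
  set g : ℤ → PowerSeries ℂ := fun a => W r (ζ ^ a) with hg
  have hneg : ∀ a, g (-a) = g a := fun a => by simp only [hg, zpow_neg, W_inv]
  have hper : ∀ a, g (a + d) = g a := fun a => by
    simp only [hg, zpow_add, zpow_natCast, hζd, mul_neg, mul_one, W_neg]
  have hpm : ∀ a : ℤ, W (r * d) ((ζ ^ a) ^ d) = psi (r * d) ^ 2 := fun a => by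
    have h1 : (ζ ^ a) ^ d = (-1) ^ a := by
      rw [← zpow_natCast, ← zpow_mul, mul_comm, zpow_mul, zpow_natCast, hζd]
    rw [h1]
    rcases Int.even_or_odd a with h | h
    · rw [h.neg_one_zpow, W_one (Nat.mul_pos hr hd)]
    · rw [h.neg_one_zpow, W_neg, W_one (Nat.mul_pos hr hd)]
  have hblock : ∀ a : ℤ, ∏ j ∈ Finset.range d, g (a + j) = psi (r * d) ^ 2 := fun a => by
    rw [← hpm a, ← prod_W hr hd hζ2]
    refine Finset.prod_congr rfl fun j _ => ?_
    simp only [hg]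
    rw [zpow_add, zpow_natCast, mul_comm]
  have h0 : g 0 = psi r ^ 2 := by simp only [hg, zpow_zero, W_one hr]
  have hc : ∀ k l, PowerSeries.constantCoeff (psi (r * d) ^ k) = 1 ∧
      PowerSeries.constantCoeff (psi r ^ l * pairProd fun i j : Fin N => g ((i : ℤ) - j)) = 1 := by
    intro k l
    have h1 := constantCoeff_psi hr
    have h2 := constantCoeff_psi (Nat.mul_pos hr hd)
    rw [map_pow, map_mul, map_pow, map_pairProd, h1, h2]
    simp only [hg, constantCoeff_W hr]
    simp [pairProd]
  have hψ : ∀ {s}, 0 < s → psi s ≠ 0 := fun hs h => by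
    have := constantCoeff_psi hs
    rw [h, map_zero] at this
    exact zero_ne_one this
  obtain ⟨h1, h2, h3⟩ := pairProd_sub_sq_eq hneg hper hblock n N
  rw [h0] at h1 h2 h3
  refine ⟨fun hN => ?_, fun hN => ?_, fun hN hN0 => ?_⟩ <;>
    refine eq_of_sq_eq_of_constantCoeff ?_ (hc 0 _).2 (hc _ 0).1
  · have := h1 hN
    rw [← pow_mul] at this
    linear_combination this
  · have := h2 hN
    refine mul_right_cancel₀ (pow_ne_zero 2 (hψ hr)) ?_
    obtain ⟨k, rfl⟩ : ∃ k, N = k + 1 := ⟨N - 1, by omega⟩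
    rw [Nat.add_sub_cancel]
    linear_combination this
  · have := h3 hN
    refine mul_right_cancel₀ (mul_ne_zero (pow_ne_zero 2 (hψ hr))
      (pow_ne_zero n (pow_ne_zero 2 (hψ (Nat.mul_pos hr hd))))) ?_
    obtain ⟨k, rfl⟩ : ∃ k, N = k + 1 := ⟨N - 1, by omega⟩
    rw [Nat.add_sub_cancel]
    linear_combination this

end thetaProducts

/-! ### The lowest coefficient -/

section normalisation

/-- Among the sets of `m` natural numbers, only `{0, …, m - 1}` has the smallest possible sum. -/
theorem eq_range_of_sum_le {m : ℕ} {S : Finset ℕ} (hcard : S.card = m)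
    (hsum : ∑ x ∈ S, x ≤ ∑ x ∈ Finset.range m, x) : S = Finset.range m := by
  have hc : (S \ Finset.range m).card = (Finset.range m \ S).card :=
    Finset.card_sdiff_comm (by rw [hcard, Finset.card_range])
  have h1 : (S \ Finset.range m).card * m ≤ ∑ x ∈ S \ Finset.range m, x := by
    rw [← smul_eq_mul]
    refine Finset.card_nsmul_le_sum _ _ _ fun x hx => ?_
    simpa using (Finset.mem_sdiff.1 hx).2
  have h2 : ∑ x ∈ Finset.range m \ S, (x + 1) ≤ (Finset.range m \ S).card * m := by
    rw [← smul_eq_mul]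
    refine Finset.sum_le_card_nsmul _ _ _ fun x hx => ?_
    have := Finset.mem_range.1 (Finset.mem_sdiff.1 hx).1
    omega
  rw [Finset.sum_add_distrib, Finset.sum_const, smul_eq_mul, mul_one] at h2
  have h3 := Finset.sum_inter_add_sum_sdiff S (Finset.range m) fun x => x
  have h4 := Finset.sum_inter_add_sum_sdiff (Finset.range m) S fun x => x
  rw [Finset.inter_comm] at h4
  rw [hc] at h1
  have h5 : (Finset.range m \ S).card = 0 := by omega
  refine (Finset.eq_of_subset_of_card_le ?_ (by rw [hcard, Finset.card_range])).symm
  rwa [Finset.card_eq_zero, Finset.sdiff_eq_empty_iff_subset] at h5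

/-- The minimal exponent is attained only by the base exponents, in some order, with all `l = 1`. -/
theorem exists_perm_of_sum_eq {α β m : ℕ} (hα : 0 < α) (hβ : 0 < β) {s : Fin m → ℕ × ℕ}
    (hs : Function.Injective fun i => (s i).1)
    (hsum : ∑ i, (α * (s i).1 + β) * (2 * (s i).2 + 1) = ∑ i : Fin m, (α * (i : ℕ) + β)) :
    ∃ σ : Equiv.Perm (Fin m), s = fun i => ((σ i : ℕ), 0) := by
  have h1 : ∀ i, (α * (s i).1 + β) * (2 * (s i).2 + 1) =
      (α * (s i).1 + β) + (α * (s i).1 + β) * (2 * (s i).2) := fun i => by ring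
  simp only [h1, Finset.sum_add_distrib (f := fun i => α * (s i).1 + β)] at hsum
  have h2 : ∑ i, (s i).1 ≤ ∑ i : Fin m, (i : ℕ) := by
    have h3 : ∑ i, (α * (s i).1 + β) ≤ ∑ i : Fin m, (α * (i : ℕ) + β) := by omega
    rw [Finset.sum_add_distrib, Finset.sum_add_distrib, ← Finset.mul_sum, ← Finset.mul_sum] at h3
    exact Nat.le_of_mul_le_mul_left (by omega) hα
  have h3 := eq_range_of_sum_le (S := Finset.univ.image fun i => (s i).1)
    (by rw [Finset.card_image_of_injective _ hs, Finset.card_univ, Fintype.card_fin])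
    (by rw [Finset.sum_image fun _ _ _ _ h => hs h, Finset.sum_range]; exact h2)
  have h4 : ∀ i, (s i).1 < m := fun i => by
    rw [← Finset.mem_range, ← h3]
    exact Finset.mem_image_of_mem _ (Finset.mem_univ i)
  set σ : Equiv.Perm (Fin m) := Equiv.ofBijective (fun i => ⟨(s i).1, h4 i⟩)
    (Finite.injective_iff_bijective.1 fun i j h => hs (Fin.mk.inj_iff.1 h)) with hσ
  have hσ1 : ∀ i, (σ i : ℕ) = (s i).1 := fun i => rfl
  refine ⟨σ, funext fun i => Prod.ext (hσ1 i).symm ?_⟩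
  have h5 : ∑ i, (α * (s i).1 + β) = ∑ i : Fin m, (α * (i : ℕ) + β) := by
    simp only [← hσ1]
    exact Equiv.sum_comp σ fun i => α * (i : ℕ) + β
  rw [h5, add_eq_left, Finset.sum_eq_zero_iff] at hsum
  have h6 := hsum i (Finset.mem_univ i)
  have h7 : 0 < α * (s i).1 + β := by omega
  rcases Nat.mul_eq_zero.1 h6 with h | h
  · omega
  · show (s i).2 = 0
    omega

variable {d ε m : ℕ}

theorem isSim_baseExp_comp (σ : Equiv.Perm (Fin m)) :
    IsSim d (fun i => baseExp ε m (σ i)) (baseExp ε m) :=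
  ⟨σ⁻¹, fun _ => 1, fun _ => Or.inl rfl, fun i => by simp⟩

open Classical in
/-- The lowest coefficient of the generating function of the weights comes from the base exponents
alone, in any order. -/
theorem coeff_gf_expWeight (hd : 0 < d) {α β : ℕ} (hα : 0 < α) (hβ : 0 < β)
    (he : FinFib fun p : ℕ × ℕ => (α * p.1 + β) * (2 * p.2 + 1)) :
    PowerSeries.coeff (∑ i : Fin m, (α * (i : ℕ) + β))
      (gf (fun s : Fin m → ℕ × ℕ => ∑ i, (α * (s i).1 + β) * (2 * (s i).2 + 1)) fun s =>
        if IsSim d (fun i => 2 * ((s i).1 : ℤ) + 1 + ε) (baseExp ε m) then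
          ((expWeight d fun i => 2 * ((s i).1 : ℤ) + 1 + ε : ℚ) : ℂ) else 0) =
      (m.factorial : ℂ) * ((expWeight d (baseExp ε m) : ℚ) : ℂ) := by
  have hfin := he.pi m
  rw [coeff_gf_eq_sum _ (hfin (∑ i : Fin m, (α * (i : ℕ) + β))).toFinset
    fun s hs => by simp [hs]]
  have h1 : (m.factorial : ℂ) * ((expWeight d (baseExp ε m) : ℚ) : ℂ) =
      ∑ σ : Equiv.Perm (Fin m), ((expWeight d (baseExp ε m) : ℚ) : ℂ) := by
    rw [Finset.sum_const, Finset.card_univ, Fintype.card_perm, Fintype.card_fin, nsmul_eq_mul]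
  rw [h1]
  symm
  refine Finset.sum_of_injOn (fun σ i => ((σ i : ℕ), 0)) ?_ ?_ ?_ ?_
  · intro σ _ τ _ h
    ext i
    exact (Prod.ext_iff.1 (congrFun h i)).1
  · intro σ _
    have h2 : ∑ i, (α * (σ i : ℕ) + β) * (2 * 0 + 1) = ∑ i : Fin m, (α * (i : ℕ) + β) := by
      simp only [mul_zero, zero_add, mul_one]
      exact Equiv.sum_comp σ fun i => α * (i : ℕ) + β
    simp only [Finset.coe_filter, Set.mem_ofPred_eq, Set.Finite.mem_toFinset]
    exact ⟨h2.le, h2⟩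
  · intro s hs hs'
    have h2 := (Finset.mem_filter.1 hs).2
    split_ifs with hsim
    · rw [Rat.cast_eq_zero]
      by_cases hinj : Function.Injective fun i => (s i).1
      · obtain ⟨σ, hσ⟩ := exists_perm_of_sum_eq hα hβ hinj h2
        exact absurd ⟨σ, Finset.mem_coe.2 (Finset.mem_univ σ), hσ.symm⟩ hs'
      · simp only [Function.Injective, not_forall] at hinj
        obtain ⟨i, j, hij, hne⟩ := hinj
        exact expWeight_eq_zero hne (by rw [hij])
    · rfl
  · intro σ _
    have h2 : (fun i => 2 * ((σ i : ℕ) : ℤ) + 1 + ε) = baseExp ε m ∘ σ := rfl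
    have h3 : IsSim d (baseExp ε m ∘ σ) (baseExp ε m) := isSim_baseExp_comp σ
    simp only [h2, if_pos h3, expWeight_comp hd]

open Classical in
/-- The factor of proportionality `ρ` is determined by the lowest coefficient. -/
theorem gf_expWeight_normalise (hd : 0 < d) {α β : ℕ} (hα : 0 < α) (hβ : 0 < β)
    (he : FinFib fun p : ℕ × ℕ => (α * p.1 + β) * (2 * p.2 + 1)) {ρ c : ℂ} (hc : c ≠ 0)
    {Ψ : PowerSeries ℂ} (hΨ : PowerSeries.constantCoeff Ψ = 1)
    (h : (gf (fun s : Fin m → ℕ × ℕ => ∑ i, (α * (s i).1 + β) * (2 * (s i).2 + 1)) fun s =>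
        if IsSim d (fun i => 2 * ((s i).1 : ℤ) + 1 + ε) (baseExp ε m) then
          ρ * ((expWeight d fun i => 2 * ((s i).1 : ℤ) + 1 + ε : ℚ) : ℂ) else 0) =
      PowerSeries.C c * PowerSeries.X ^ (∑ i : Fin m, (α * (i : ℕ) + β)) * Ψ) :
    (gf (fun s : Fin m → ℕ × ℕ => ∑ i, (α * (s i).1 + β) * (2 * (s i).2 + 1)) fun s =>
        if IsSim d (fun i => 2 * ((s i).1 : ℤ) + 1 + ε) (baseExp ε m) then
          ((expWeight d fun i => 2 * ((s i).1 : ℤ) + 1 + ε : ℚ) : ℂ) else 0) =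
      PowerSeries.C ((m.factorial : ℂ) * ((expWeight d (baseExp ε m) : ℚ) : ℂ)) *
        PowerSeries.X ^ (∑ i : Fin m, (α * (i : ℕ) + β)) * Ψ := by
  have h1 : ∀ s : Fin m → ℕ × ℕ,
      (if IsSim d (fun i => 2 * ((s i).1 : ℤ) + 1 + ε) (baseExp ε m) then
        ρ * ((expWeight d fun i => 2 * ((s i).1 : ℤ) + 1 + ε : ℚ) : ℂ) else 0) =
      ρ * if IsSim d (fun i => 2 * ((s i).1 : ℤ) + 1 + ε) (baseExp ε m) then
        ((expWeight d fun i => 2 * ((s i).1 : ℤ) + 1 + ε : ℚ) : ℂ) else 0 := fun s => by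
    split_ifs <;> simp
  simp only [h1] at h
  rw [← C_mul_gf (he.pi m)] at h
  have h2 := congrArg (PowerSeries.coeff (∑ i : Fin m, (α * (i : ℕ) + β))) h
  rw [PowerSeries.coeff_C_mul, coeff_gf_expWeight hd hα hβ he, mul_assoc, PowerSeries.coeff_C_mul,
    PowerSeries.coeff_X_pow_mul', if_pos le_rfl, Nat.sub_self,
    PowerSeries.coeff_zero_eq_constantCoeff_apply, hΨ, mul_one] at h2
  have hρ : ρ ≠ 0 := by
    rintro rfl
    exact hc (by rw [← h2, zero_mul])
  have hCρ : (PowerSeries.C ρ : PowerSeries ℂ) ≠ 0 := by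
    rw [Ne, map_eq_zero]
    exact hρ
  refine mul_left_cancel₀ hCρ ?_
  rw [h, ← h2, map_mul, mul_assoc, mul_assoc, mul_assoc]

end normalisation

/-! ### The generating functions of the weights -/

section mainSeries

theorem exists_unit_isPrimitiveRoot {n : ℕ} (hn : n ≠ 0) : ∃ ζ : ℂˣ, IsPrimitiveRoot ζ n := by
  have h := Complex.isPrimitiveRoot_exp n hn
  exact ⟨(h.isUnit hn).unit, IsPrimitiveRoot.coe_units_iff.1 h⟩

theorem sum_two_mul_add_one (m : ℕ) : ∑ i : Fin m, (2 * (i : ℕ) + 1) = m ^ 2 := by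
  rw [← Finset.sum_range fun i => 2 * i + 1]
  induction m with
  | zero => rfl
  | succ m ih => rw [Finset.sum_range_succ, ih]; ring

theorem sum_add_one (m : ℕ) : ∑ i : Fin m, (1 * (i : ℕ) + 1) = m * (m + 1) / 2 := by
  rw [← Finset.sum_range fun i => 1 * i + 1]
  simp only [one_mul]
  rw [Finset.sum_add_distrib, Finset.sum_const, Finset.card_range, smul_eq_mul, mul_one,
    Finset.sum_range_id]
  rcases m with _ | m
  · rfl
  · rw [Nat.add_sub_cancel, show (m + 1) * (m + 1 + 1) = (m + 1) * m + (m + 1) * 2 by ring,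
      Nat.add_mul_div_right _ _ two_pos]

theorem finFib_mul_oddLambert {α β : ℕ} (hα : 0 < α) (hβ : 0 < β) :
    FinFib fun p : ℕ × ℕ => (α * p.1 + β) * (2 * p.2 + 1) := fun N =>
  ((Set.finite_Iic N).prod (Set.finite_Iic N)).subset fun p hp => by
    have hp' : (α * p.1 + β) * (2 * p.2 + 1) ≤ N := hp
    have h1 : p.1 ≤ α * p.1 := Nat.le_mul_of_pos_left _ hα
    exact ⟨show p.1 ≤ N by nlinarith, show p.2 ≤ N by nlinarith⟩

variable {d m n : ℕ}

open Classical in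
/-- The generating function of the weights of tuples of odd numbers. -/
theorem gf_expWeight_odd (hd : 0 < d) (hN : 2 * m = d * n) :
    (gf (fun s : Fin m → ℕ × ℕ => ∑ i, (2 * (s i).1 + 1) * (2 * (s i).2 + 1)) fun s =>
        if IsSim d (fun i => 2 * ((s i).1 : ℤ) + 1 + (0 : ℕ)) (baseExp 0 m) then
          ((expWeight d fun i => 2 * ((s i).1 : ℤ) + 1 + (0 : ℕ) : ℚ) : ℂ) else 0) =
      PowerSeries.C ((m.factorial : ℂ) * ((expWeight d (baseExp 0 m) : ℚ) : ℂ)) *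
        PowerSeries.X ^ m ^ 2 * psi (2 * d) ^ (n * (2 * m)) := by
  obtain ⟨ζ, hζ⟩ := exists_unit_isPrimitiveRoot (n := 2 * d) (by omega)
  have hψ : PowerSeries.constantCoeff (psi (2 * d) ^ (n * (2 * m))) = 1 := by
    rw [map_pow, constantCoeff_psi (by omega), one_pow]
  have hc : (-1) ^ m * (m.factorial : ℂ) ≠ 0 :=
    mul_ne_zero (pow_ne_zero _ (by norm_num)) (Nat.cast_ne_zero.2 m.factorial_ne_zero)
  have hfin := finFib_mul_oddLambert (α := 2) two_pos one_pos
  have h := gf_expWeight_eq (ε := 0) (m := m) hd hζ zero_le_one (n := n) (by omega) hfin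
    (a := fun p => 2 * (p.1 : ℤ) + 1 + (0 : ℕ)) (fun p => by omega) two_pos
    (c := (-1) ^ m * (m.factorial : PowerSeries ℂ) * PowerSeries.X ^ m ^ 2 * psi 2 ^ (2 * m))
    fun y hy => by
      have := genDet_odd m y hy
      simp only [Nat.cast_zero, add_zero]
      exact this
  have h1 := (psi_pow_mul_pairProd_W two_pos hd hζ n (0 + 2 * m)).1 (by omega)
  simp only [zero_add] at h1
  rw [← sum_two_mul_add_one]
  refine gf_expWeight_normalise hd two_pos one_pos hfin hc hψ (h.trans ?_)
  rw [sum_two_mul_add_one, ← h1, map_mul, map_pow, map_neg, map_one, map_natCast]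
  simp only [mul_assoc]

open Classical in
theorem gf_expWeight_even_aux (hd : 0 < d) (hN : 2 * m = d * n ∨ 2 * m + 2 = d * n) {E : ℕ}
    (hE : ∀ ζ : ℂˣ, IsPrimitiveRoot ζ (2 * d) →
      psi 1 ^ (2 * m) * (pairProd fun i j : Fin (1 + 2 * m) => W 1 (ζ ^ ((i : ℤ) - j))) =
        psi d ^ E) :
    (gf (fun s : Fin m → ℕ × ℕ => ∑ i, (1 * (s i).1 + 1) * (2 * (s i).2 + 1)) fun s =>
        if IsSim d (fun i => 2 * ((s i).1 : ℤ) + 1 + (1 : ℕ)) (baseExp 1 m) then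
          ((expWeight d fun i => 2 * ((s i).1 : ℤ) + 1 + (1 : ℕ) : ℚ) : ℂ) else 0) =
      PowerSeries.C ((m.factorial : ℂ) * ((expWeight d (baseExp 1 m) : ℚ) : ℂ)) *
        PowerSeries.X ^ (m * (m + 1) / 2) * psi d ^ E := by
  obtain ⟨ζ, hζ⟩ := exists_unit_isPrimitiveRoot (n := 2 * d) (by omega)
  have hψ : PowerSeries.constantCoeff (psi d ^ E) = 1 := by
    rw [map_pow, constantCoeff_psi hd, one_pow]
  have hc : (m.factorial : ℂ) ≠ 0 := Nat.cast_ne_zero.2 m.factorial_ne_zero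
  have hfin := finFib_mul_oddLambert (α := 1) one_pos one_pos
  have h := gf_expWeight_eq (ε := 1) (m := m) hd hζ le_rfl (n := n) (by omega) hfin
    (a := fun p => 2 * (p.1 : ℤ) + 1 + (1 : ℕ)) (fun p => by omega) one_pos
    (c := (m.factorial : PowerSeries ℂ) * PowerSeries.X ^ (m * (m + 1) / 2) * psi 1 ^ (2 * m))
    fun y hy => by
      rw [← genDet_even m y hy]
      congr 1
      funext p
      ring
  rw [← sum_add_one]
  refine gf_expWeight_normalise hd one_pos one_pos hfin hc hψ (h.trans ?_)
  rw [sum_add_one, ← hE ζ hζ, map_natCast]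
  simp only [mul_assoc]

open Classical in
/-- The generating function of the weights of tuples of positive integers, for `d ∣ 2m`. -/
theorem gf_expWeight_even (hd : 0 < d) (hN : 2 * m = d * n) :
    (gf (fun s : Fin m → ℕ × ℕ => ∑ i, (1 * (s i).1 + 1) * (2 * (s i).2 + 1)) fun s =>
        if IsSim d (fun i => 2 * ((s i).1 : ℤ) + 1 + (1 : ℕ)) (baseExp 1 m) then
          ((expWeight d fun i => 2 * ((s i).1 : ℤ) + 1 + (1 : ℕ) : ℚ) : ℂ) else 0) =
      PowerSeries.C ((m.factorial : ℂ) * ((expWeight d (baseExp 1 m) : ℚ) : ℂ)) *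
        PowerSeries.X ^ (m * (m + 1) / 2) * psi d ^ (n * (2 * m + 2)) := by
  refine gf_expWeight_even_aux hd (Or.inl hN) fun ζ hζ => ?_
  have h := (psi_pow_mul_pairProd_W one_pos hd hζ n (1 + 2 * m)).2.1 (by omega)
  rwa [Nat.add_sub_cancel_left, one_mul, show 1 + 2 * m + 1 = 2 * m + 2 by ring] at h

open Classical in
/-- The generating function of the weights of tuples of positive integers, for `d ∣ 2m + 2`. -/
theorem gf_expWeight_even' (hd : 0 < d) (hN : 2 * m + 2 = d * n) :
    (gf (fun s : Fin m → ℕ × ℕ => ∑ i, (1 * (s i).1 + 1) * (2 * (s i).2 + 1)) fun s =>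
        if IsSim d (fun i => 2 * ((s i).1 : ℤ) + 1 + (1 : ℕ)) (baseExp 1 m) then
          ((expWeight d fun i => 2 * ((s i).1 : ℤ) + 1 + (1 : ℕ) : ℚ) : ℂ) else 0) =
      PowerSeries.C ((m.factorial : ℂ) * ((expWeight d (baseExp 1 m) : ℚ) : ℂ)) *
        PowerSeries.X ^ (m * (m + 1) / 2) * psi d ^ (n * (2 * m)) := by
  refine gf_expWeight_even_aux hd (Or.inr hN) fun ζ hζ => ?_
  have h := (psi_pow_mul_pairProd_W one_pos hd hζ n (1 + 2 * m)).2.2 (by omega) (by omega)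
  rwa [Nat.add_sub_cancel_left, one_mul] at h

end mainSeries

/-! ### The absolute weight of the base exponents -/

section baseWeight

variable {d : ℕ}

/-- The absolute half difference of two exponents in the same class. -/
def halfDiff (d : ℕ) (a b : ℤ) : ℚ := if a % (2 * d) = b % (2 * d) then |((b : ℚ) - a) / 2| else 1

/-- The factors that involve a single index combine to the absolute weight of a single exponent. -/
theorem halfDiff_self (hd : 0 < d) {ε : ℕ} {a : ℤ} (hε : ε = 1 ∨ ε = 0 ∧ a % (2 * d) ≠ 0)
    (ha : 0 ≤ a) : halfDiff d a (-a) * (halfDiff d a 0 * halfDiff d (-a) 0) ^ ε = expSelf d a := by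
  have hM : (0 : ℤ) < 2 * d := by positivity
  have h1 := Int.emod_nonneg a hM.ne'
  have h2 := Int.emod_lt_of_pos a hM
  have ha' : (0 : ℚ) ≤ a := by exact_mod_cast ha
  have h5 : |((-a : ℤ) : ℚ) - a| = 2 * a := by
    rw [abs_of_nonpos (by push_cast; linarith)]
    push_cast; ring
  simp only [halfDiff, expSelf, neg_emod_eq hM, Int.zero_emod, abs_div, h5, abs_two]
  generalize a % (2 * d) = r at *
  by_cases hr : r = 0
  · subst hr
    have hε : ε = 1 := by tauto
    subst hε
    have hd' : (0 : ℤ) ≠ d := by exact_mod_cast hd.ne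
    simp only [hd', if_true, if_false, pow_one]
    rw [abs_of_nonpos (by push_cast; linarith), abs_of_nonneg (by push_cast; linarith)]
    push_cast; ring
  · have h3 : ¬(2 * (d : ℤ) - r = 0) := by omega
    simp only [hr, h3, if_false, mul_one, one_pow]
    by_cases h : r = d
    · have h4 : r = 2 * d - r := by omega
      rw [if_pos h4, if_pos h]
      ring
    · have h4 : ¬(r = 2 * d - r) := by omega
      rw [if_neg h4, if_neg h]

theorem halfDiff_pair (hd : 0 < d) (a b : ℤ) :
    halfDiff d a b * halfDiff d a (-b) * (halfDiff d (-a) b * halfDiff d (-a) (-b)) =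
      expPair d a b := by
  have hM : (0 : ℤ) < 2 * d := by positivity
  simp only [halfDiff, expPair, emod_eq_neg_emod_comm hM, neg_neg]
  have h1 : |((b : ℚ) - (-a : ℤ)) / 2| = |((b : ℚ) + a) / 2| := by push_cast; rw [sub_neg_eq_add]
  have h2 : |(((-b : ℤ) : ℚ) - a) / 2| = |((b : ℚ) + a) / 2| := by
    rw [← abs_neg]; congr 1; push_cast; ring
  have h3 : |(((-b : ℤ) : ℚ) - (-a : ℤ)) / 2| = |((b : ℚ) - a) / 2| := by
    rw [← abs_neg]; congr 1; push_cast; ring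
  simp only [h1, h2, h3, ← sq_abs (((b : ℚ) - a) / 2), ← sq_abs (((b : ℚ) + a) / 2)]
  split_ifs <;> ring

/-- Up to sign, the weight of the base exponents is a product over pairs of congruent elements of
`{0, …, N - 1}`. -/
theorem abs_expWeight_baseExp (hd : 0 < d) {ε : ℕ} (hε : ε ≤ 1) (m : ℕ) :
    (∏ i, expSelf d (baseExp ε m i)) * (pairProd fun i j =>
      expPair d (baseExp ε m i) (baseExp ε m j)) =
    pairProd fun i j : Fin (ε + 2 * m) =>
      if ((i : ℕ) : ZMod d) = ((j : ℕ) : ZMod d) then |((j : ℕ) : ℚ) - ((i : ℕ) : ℚ)| else 1 := by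
  obtain ⟨π, hπ⟩ := exists_perm_pmVec_baseExp hε m
  have h1 := pairProd_pmVec hε (baseExp ε m) (halfDiff d)
  simp only [halfDiff_pair hd] at h1
  have h2 : ∀ i : Fin m, halfDiff d (baseExp ε m i) (-baseExp ε m i) *
      (halfDiff d (baseExp ε m i) 0 * halfDiff d (-baseExp ε m i) 0) ^ ε =
      expSelf d (baseExp ε m i) := by
    intro i
    refine halfDiff_self hd ?_ (by rw [baseExp]; positivity)
    rcases Nat.le_one_iff_eq_zero_or_eq_one.1 hε with rfl | rfl
    · refine Or.inr ⟨rfl, fun h => ?_⟩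
      have h4 : (2 : ℤ) ∣ baseExp 0 m i := (Dvd.intro _ rfl).trans (Int.dvd_of_emod_eq_zero h)
      rw [baseExp] at h4
      omega
    · exact Or.inl rfl
  simp only [h2] at h1
  rw [← h1]
  refine pairProd_eq_of_perm (fun i j => ?_) (fun i j => ?_) π fun i j => ?_
  · rw [abs_sub_comm]
    simp only [eq_comm]
  · split_ifs
    · exact abs_nonneg _
    · exact zero_le_one
  · rw [halfDiff]
    refine if_congr ?_ ?_ rfl
    · have e : ∀ j, 2 ∣ pmVec ε m (baseExp ε m) j + (ε + 2 * m : ℕ) - 1 :=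
        dvd_pmVec hε dvd_baseExp
      rw [← expClass_eq_iff (e i) (e j), expClass, expClass, hπ, hπ]
      simp only [show ∀ x y : ℤ, 2 * x + 1 - y + y - 1 = 2 * x by intros; ring,
        Int.mul_ediv_cancel_left _ (two_ne_zero' ℤ), Int.cast_natCast]
    · rw [hπ, hπ]
      push_cast
      congr 1
      ring

/-- The product of the multiples of `d` up to `b`. -/
theorem prod_range_dvd (d b : ℕ) :
    ∏ c ∈ Finset.range b, (if d ∣ c + 1 then ((c + 1 : ℕ) : ℚ) else 1) =
      (d : ℚ) ^ (b / d) * ((b / d).factorial : ℚ) := by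
  induction b with
  | zero => simp
  | succ b ih =>
    rw [Finset.prod_range_succ, ih, Nat.succ_div]
    split_ifs with h
    · have h1 : b + 1 = d * (b / d + 1) := by
        have h2 := Nat.succ_div (a := b) (b := d)
        rw [if_pos h] at h2
        rw [← h2, Nat.mul_div_cancel' h]
      rw [h1, Nat.factorial_succ, pow_succ]
      push_cast
      ring
    · rw [mul_one, add_zero]

/-- The inner product over `i < b` is the product of the positive multiples of `d` up to `b`. -/
theorem pairProd_congruent (d N : ℕ) :
    (pairProd fun i j : Fin N =>
      if ((i : ℕ) : ZMod d) = ((j : ℕ) : ZMod d) then |((j : ℕ) : ℚ) - ((i : ℕ) : ℚ)| else 1) =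
      ∏ b ∈ Finset.range N, ((d : ℚ) ^ (b / d) * ((b / d).factorial : ℚ)) := by
  rw [pairProd, Finset.prod_comm, Finset.prod_range]
  refine Finset.prod_congr rfl fun j _ => ?_
  simp only [Fin.lt_def]
  rw [← prod_range_dvd d, ← Finset.prod_range_reflect,
    Fin.prod_univ_eq_prod_range (fun i : ℕ => if i < (j : ℕ) then
      (if (i : ZMod d) = ((j : ℕ) : ZMod d) then |((j : ℕ) : ℚ) - (i : ℚ)| else 1) else 1) N]
  rw [← Finset.prod_filter]
  have h1 : (Finset.range N).filter (fun i => i < (j : ℕ)) = Finset.range j := by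
    ext i
    simp only [Finset.mem_filter, Finset.mem_range]
    omega
  rw [h1]
  refine Finset.prod_congr rfl fun i hi => ?_
  have hi' := Finset.mem_range.1 hi
  rw [show (j : ℕ) - 1 - i + 1 = j - i by omega]
  refine if_congr ?_ ?_ rfl
  · rw [ZMod.natCast_eq_natCast_iff, Nat.modEq_iff_dvd' hi'.le]
  · rw [Nat.cast_sub hi'.le, abs_of_nonneg]
    rw [sub_nonneg]
    exact_mod_cast hi'.le

theorem prod_range_mul_div (hd : 0 < d) (n : ℕ) :
    ∏ b ∈ Finset.range (d * n), ((d : ℚ) ^ (b / d) * ((b / d).factorial : ℚ)) =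
      ∏ q ∈ Finset.range n, ((d : ℚ) ^ q * (q.factorial : ℚ)) ^ d := by
  induction n with
  | zero => simp
  | succ n ih =>
    rw [mul_add_one, Finset.prod_range_add, ih, Finset.prod_range_succ]
    congr 1
    have h1 : ∀ t ∈ Finset.range d,
        (d : ℚ) ^ ((d * n + t) / d) * (((d * n + t) / d).factorial : ℚ) =
        (d : ℚ) ^ n * (n.factorial : ℚ) := fun t ht => by
      rw [Nat.mul_add_div hd, Nat.div_eq_of_lt (Finset.mem_range.1 ht), add_zero]
    rw [Finset.prod_congr rfl h1, Finset.prod_const, Finset.card_range]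

theorem prod_range_pow_mul_factorial (n : ℕ) {M : ℕ} (hM : d * n = 2 * M) :
    ∏ q ∈ Finset.range n, ((d : ℚ) ^ q * (q.factorial : ℚ)) ^ d =
      (d : ℚ) ^ (M * (n - 1)) * ∏ l ∈ Finset.Icc 1 (n - 1), (l.factorial : ℚ) ^ d := by
  simp only [mul_pow, Finset.prod_mul_distrib, ← pow_mul]
  congr 1
  · rw [Finset.prod_pow_eq_pow_sum, ← Finset.sum_mul]
    congr 1
    have h1 := Finset.sum_range_id_mul_two n
    refine Nat.eq_of_mul_eq_mul_right two_pos ?_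
    calc (∑ i ∈ Finset.range n, i) * d * 2 = ((∑ i ∈ Finset.range n, i) * 2) * d := by ring
      _ = (d * n) * (n - 1) := by rw [h1]; ring
      _ = M * (n - 1) * 2 := by rw [hM]; ring
  · rcases n with _ | n
    · simp
    · rw [Finset.prod_range_succ', Nat.factorial_zero, Nat.cast_one, one_pow, mul_one,
        Nat.add_sub_cancel, Finset.range_eq_Ico,
        Finset.prod_Ico_add' (fun l : ℕ => (l.factorial : ℚ) ^ d) 0 n 1]
      rfl

end baseWeight

/-! ### The sign of the weight of the base exponents -/

section baseSign

variable {d : ℕ}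

theorem expSign_add_mul (a : ℤ) (k : ℕ) : expSign d (a + 2 * d * k) = expSign d a := by
  rw [expSign, expSign, Int.add_mul_emod_self_left]

theorem prod_range_neg_one (D : ℕ) :
    ∏ i ∈ Finset.range D, (if D ≤ 2 * i then (-1 : ℚ) else 1) = (-1) ^ (D / 2) := by
  obtain ⟨c, hc⟩ : ∃ c, D = c + D / 2 := ⟨D - D / 2, by omega⟩
  have h1 : ∀ i ∈ Finset.range c, (if D ≤ 2 * i then (-1 : ℚ) else 1) = 1 := fun i hi => by
    have := Finset.mem_range.1 hi
    rw [if_neg (by omega)]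
  have h2 : ∀ i ∈ Finset.range (D / 2), (if D ≤ 2 * (c + i) then (-1 : ℚ) else 1) = -1 :=
    fun i _ => by rw [if_pos (by omega)]
  have h3 : Finset.range D = Finset.range (c + D / 2) := by rw [← hc]
  rw [h3, Finset.prod_range_add, Finset.prod_congr rfl h1, Finset.prod_congr rfl h2]
  simp

/-- The sign of a full period of exponents. -/
theorem prod_expSign_block (hd : 0 < d) {ε : ℕ} (hε : ε ≤ 1) :
    ∏ i ∈ Finset.range d, expSign d (2 * (i : ℤ) + 1 + ε) = (-1) ^ ((d - ε) / 2) := by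
  have h1 : ∀ i ∈ Finset.range (d - ε), expSign d (2 * (i : ℤ) + 1 + ε) =
      if d - ε ≤ 2 * i then (-1 : ℚ) else 1 := fun i hi => by
    have := Finset.mem_range.1 hi
    rw [expSign, Int.emod_eq_of_lt (by omega) (by omega)]
    refine if_congr ?_ rfl rfl
    omega
  have h2 : d = d - ε + ε := by omega
  have h3 : Finset.range d = Finset.range (d - ε + ε) := by rw [← h2]
  rw [h3, Finset.prod_range_add, Finset.prod_congr rfl h1, prod_range_neg_one]
  rcases Nat.le_one_iff_eq_zero_or_eq_one.1 hε with rfl | rfl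
  · simp
  · rw [Finset.prod_range_one, expSign,
      show 2 * ((d - 1 + 0 : ℕ) : ℤ) + 1 + (1 : ℕ) = 2 * d by omega, Int.emod_self,
      if_neg (by omega), mul_one]

/-- The sign of the weight of `M` successive exponents, when `2M` is a multiple of `d`: each
full period contributes the same sign, and half a period has no negative signs. -/
theorem prod_expSign (hd : 0 < d) {ε : ℕ} (hε : ε ≤ 1) {M n : ℕ} (hM : d * n = 2 * M) :
    ∏ i ∈ Finset.range M, expSign d (2 * (i : ℤ) + 1 + ε) = (-1) ^ ((d - ε) / 2 * (n / 2)) := by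
  have key : ∀ k, ∏ i ∈ Finset.range (d * k), expSign d (2 * (i : ℤ) + 1 + ε) =
      (-1) ^ ((d - ε) / 2 * k) := by
    intro k
    induction k with
    | zero => simp
    | succ k ih =>
      rw [mul_add_one, Finset.prod_range_add, ih, mul_add_one, pow_add, ← prod_expSign_block hd hε]
      congr 1
      refine Finset.prod_congr rfl fun i _ => ?_
      rw [← expSign_add_mul (2 * (i : ℤ) + 1 + ε) k]
      congr 1
      push_cast
      ring
  rcases Nat.even_or_odd' n with ⟨k, rfl | rfl⟩
  · have hM' : M = d * k := by linarith
    rw [hM', key, Nat.mul_div_cancel_left _ two_pos]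
  · obtain ⟨e, he⟩ : ∃ e, d = 2 * e := ⟨M - d * k, by
      have : d * (2 * k + 1) = 2 * (d * k) + d := by ring
      omega⟩
    have hM' : M = d * k + e := by
      have : d * (2 * k + 1) = 2 * (d * k) + d := by ring
      omega
    rw [hM', Finset.prod_range_add, key, show (2 * k + 1) / 2 = k by omega]
    have h1 : ∀ i ∈ Finset.range e, expSign d (2 * ((d * k + i : ℕ) : ℤ) + 1 + ε) = 1 :=
      fun i hi => by
        have := Finset.mem_range.1 hi
        rw [show 2 * ((d * k + i : ℕ) : ℤ) + 1 + ε = (2 * (i : ℤ) + 1 + ε) + 2 * d * k by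
          push_cast; ring, expSign_add_mul, expSign, Int.emod_eq_of_lt (by omega) (by omega),
          if_neg (by omega)]
    rw [Finset.prod_congr rfl h1, Finset.prod_const_one, mul_one]

theorem choose_two_mod_two (n : ℕ) : n.choose 2 % 2 = n / 2 % 2 := by
  obtain ⟨q, hq⟩ : ∃ q, n = 4 * q ∨ n = 4 * q + 1 ∨ n = 4 * q + 2 ∨ n = 4 * q + 3 :=
    ⟨n / 4, by omega⟩
  rw [Nat.choose_two_right]
  rcases hq with rfl | rfl | rfl | rfl
  · rcases q with _ | q
    · rfl
    · rw [show 4 * (q + 1) * (4 * (q + 1) - 1) = 2 * (2 * ((q + 1) * (4 * (q + 1) - 1))) by ring]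
      omega
  · rw [Nat.add_sub_cancel, show (4 * q + 1) * (4 * q) = 2 * (2 * (q * (4 * q + 1))) by ring]
    omega
  · rw [show 4 * q + 2 - 1 = 4 * q + 1 by omega,
      show (4 * q + 2) * (4 * q + 1) = 2 * (2 * (4 * q * q + 3 * q) + 1) by ring]
    omega
  · rw [show 4 * q + 3 - 1 = 4 * q + 2 by omega,
      show (4 * q + 3) * (4 * q + 2) = 2 * (2 * (4 * q * q + 5 * q + 1) + 1) by ring]
    omega

/-- `n.choose 2` and `n / 2` have the same parity. -/
theorem neg_one_pow_div_two_mul (a b : ℕ) :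
    (-1 : ℚ) ^ (a / 2 * (b / 2)) = (-1) ^ (a.choose 2 * b.choose 2) := by
  rw [neg_one_pow_eq_pow_mod_two, neg_one_pow_eq_pow_mod_two (n := a.choose 2 * b.choose 2),
    Nat.mul_mod, Nat.mul_mod (a.choose 2), choose_two_mod_two, choose_two_mod_two]

theorem expWeight_baseExp (hd : 0 < d) {ε : ℕ} (hε : ε ≤ 1) (m : ℕ) :
    expWeight d (baseExp ε m) = (∏ i ∈ Finset.range m, expSign d (2 * (i : ℤ) + 1 + ε)) *
      ∏ b ∈ Finset.range (ε + 2 * m), ((d : ℚ) ^ (b / d) * ((b / d).factorial : ℚ)) := by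
  rw [expWeight, Finset.prod_mul_distrib, mul_assoc, abs_expWeight_baseExp hd hε,
    pairProd_congruent d, Finset.prod_range fun i => expSign d (2 * (i : ℤ) + 1 + ε)]
  rfl

theorem expWeight_baseExp_odd (hd : 0 < d) {m n : ℕ} (hN : d * n = 2 * m) :
    expWeight d (baseExp 0 m) = (-1) ^ (d.choose 2 * n.choose 2) *
      ((d : ℚ) ^ (m * (n - 1)) * ∏ l ∈ Finset.Icc 1 (n - 1), (l.factorial : ℚ) ^ d) := by
  rw [expWeight_baseExp hd zero_le_one, prod_expSign hd zero_le_one hN, Nat.sub_zero,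
    neg_one_pow_div_two_mul, zero_add, ← hN, prod_range_mul_div hd,
    prod_range_pow_mul_factorial n hN]

theorem expWeight_baseExp_even (hd : 0 < d) {m n : ℕ} (hN : d * n = 2 * m) :
    expWeight d (baseExp 1 m) = (-1) ^ ((d - 1).choose 2 * n.choose 2) *
      ((d : ℚ) ^ (m * (n - 1)) * (∏ l ∈ Finset.Icc 1 (n - 1), (l.factorial : ℚ) ^ d) *
        ((d : ℚ) ^ n * (n.factorial : ℚ))) := by
  rw [expWeight_baseExp hd le_rfl, prod_expSign hd le_rfl hN, neg_one_pow_div_two_mul,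
    add_comm 1, Finset.prod_range_succ, ← hN, prod_range_mul_div hd,
    prod_range_pow_mul_factorial n hN, Nat.mul_div_cancel_left _ hd]

/-- For `d ∣ 2 (m + 1)` the product over `{0, …, 2m}` lacks the last factor of that over
`{0, …, 2m + 1}`, and the exponent `2 (m + 1)` which completes the last half period has sign `1`. -/
theorem expWeight_baseExp_even' (hd : 0 < d) {m n : ℕ} (hN : d * n = 2 * (m + 1)) :
    expWeight d (baseExp 1 m) * ((d : ℚ) ^ (n - 1) * ((n - 1).factorial : ℚ)) =
      (-1) ^ ((d - 1).choose 2 * n.choose 2) *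
        ((d : ℚ) ^ ((m + 1) * (n - 1)) * ∏ l ∈ Finset.Icc 1 (n - 1), (l.factorial : ℚ) ^ d) := by
  have h1 := prod_expSign hd le_rfl hN
  have h2 : expSign d (2 * (m : ℤ) + 1 + (1 : ℕ)) = 1 := by
    have h3 : 2 * (m : ℤ) + 1 + (1 : ℕ) = d * n := by
      rw [← Nat.cast_mul, hN]; push_cast; ring
    rw [h3, expSign]
    rcases Nat.even_or_odd' n with ⟨k, rfl | rfl⟩
    · rw [show (d : ℤ) * ((2 * k : ℕ) : ℤ) = 2 * d * k by push_cast; ring, Int.mul_emod_right,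
        if_neg (by omega)]
    · rw [show (d : ℤ) * ((2 * k + 1 : ℕ) : ℤ) = d + 2 * d * k by push_cast; ring,
        Int.add_mul_emod_self_left, Int.emod_eq_of_lt (by omega) (by omega), if_neg (by omega)]
  rw [Finset.prod_range_succ, h2, mul_one, neg_one_pow_div_two_mul] at h1
  have h3 := prod_range_mul_div hd n
  have h4 : d * n = 1 + 2 * m + 1 := by omega
  have h5 : (1 + 2 * m) / d = n - 1 := by
    obtain ⟨k, rfl⟩ : ∃ k, n = k + 1 := ⟨n - 1, by
      rcases n with _ | n
      · omega
      · rfl⟩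
    rw [Nat.add_sub_cancel, Nat.div_eq_iff hd]
    rw [mul_add_one] at h4
    rw [mul_comm k]
    omega
  rw [prod_range_pow_mul_factorial n hN, h4, Finset.prod_range_succ, h5] at h3
  rw [expWeight_baseExp hd le_rfl, h1, mul_assoc, h3]

end baseSign

/-! ### Sums over solutions as coefficients -/

section translation

theorem gf_pow {A ι : Type*} [CommRing A] {e : ι → ℕ} (he : FinFib e) (k : ℕ) :
    gf e (fun _ => (1 : A)) ^ k = gf (fun a : Fin k → ι => ∑ i, e (a i)) fun _ => 1 := by
  induction k with
  | zero =>
    ext N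
    rw [pow_zero, coeff_gf_eq_sum _ Finset.univ fun _ _ => Finset.mem_univ _,
      PowerSeries.coeff_one]
    by_cases h : N = 0
    · simp [h]
    · rw [if_neg h, Finset.filter_false_of_mem, Finset.sum_empty]
      intro a _
      simpa using Ne.symm h
  | succ k ih =>
    rw [pow_succ', ih, gf_mul he (he.pi k)]
    refine gf_equiv (Fin.consEquiv fun _ : Fin (k + 1) => ι) (fun p => ?_) fun p => ?_
    · rw [Fin.sum_univ_succ]
      rfl
    · simp

/-- Powers of `psi` count representations as sums of triangular numbers. -/
theorem coeff_psi_pow {s : ℕ} (hs : 0 < s) (k N : ℕ) :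
    PowerSeries.coeff N (psi s ^ k) = (triangleCountDiv k N s : ℂ) := by
  have hfin := (finFib_tri hs).pi k
  rw [psi, gf_pow (finFib_tri hs), coeff_gf_eq_sum _ (hfin N).toFinset fun a ha => by simp [ha],
    Finset.sum_const, nsmul_eq_mul, mul_one, Nat.cast_inj, triangleCountDiv]
  simp only [← Finset.mul_sum]
  split_ifs with h
  · obtain ⟨c, rfl⟩ := h
    rw [Nat.mul_div_cancel_left _ hs, triangleCount, ← Set.ncard_coe_finset]
    congr 1
    ext a
    simp only [Finset.coe_filter, Set.Finite.mem_toFinset, Set.mem_ofPred_eq]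
    constructor
    · rintro ⟨-, h⟩
      exact Nat.eq_of_mul_eq_mul_left hs h
    · intro h
      rw [h]
      exact ⟨le_rfl, rfl⟩
  · rw [Finset.card_eq_zero, Finset.filter_eq_empty_iff]
    intro a _ ha
    exact h ⟨_, ha.symm⟩

theorem prod_pairs {m : ℕ} {R : Type*} [CommRing R] (c : Fin m → Fin m → Prop)
    [∀ a b, Decidable (c a b)] (g : Fin m → Fin m → R) :
    ∏ p : Fin m × Fin m with p.1 < p.2 ∧ c p.1 p.2, g p.1 p.2 =
      pairProd fun a b => if c a b then g a b else 1 := by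
  rw [Finset.prod_filter, Fintype.prod_prod_type, pairProd]
  refine Finset.prod_congr rfl fun a _ => Finset.prod_congr rfl fun b _ => ?_
  by_cases h1 : a < b <;> by_cases h2 : c a b <;> simp [h1, h2]

theorem neg_one_pow_card_filter {ι : Type*} [Fintype ι] (c : ι → Prop) [DecidablePred c] :
    (-1 : ℚ) ^ (Finset.univ.filter c).card = ∏ i, if c i then -1 else 1 := by
  rw [← Finset.prod_const, Finset.prod_filter]

variable {d m : ℕ}

/-- An odd exponent is never `0` modulo `2d`, so that the cubic factors do not occur. -/
theorem oddWeight_eq_expWeight (hd : 0 < d) {k : Fin m → ℕ} (hk : ∀ i, Odd (k i)) :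
    oddWeight d k = expWeight d fun i => (k i : ℤ) := by
  have h0 : ∀ i, ((k i : ℤ) % (2 * d)) = ((k i % (2 * d) : ℕ) : ℤ) := fun i => by push_cast; rfl
  have h1 : ∀ i, k i % (2 * d) ≠ 0 := fun i h => by
    obtain ⟨c, hc⟩ := Nat.dvd_of_mod_eq_zero h
    obtain ⟨e, he⟩ := hk i
    rw [mul_assoc] at hc
    omega
  have h2 : (d : ℤ) % (2 * d) = d := Int.emod_eq_of_lt (by omega) (by omega)
  rw [oddWeight, neg_one_pow_card_filter, Finset.prod_filter, ← Finset.prod_mul_distrib,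
    prod_pairs (fun a b : Fin m => (k a : ℤ) ≡ k b [ZMOD 2 * d])
      (fun a b => (((k b : ℚ) - k a) / 2) ^ 2),
    prod_pairs (fun a b : Fin m => (k a : ℤ) ≡ -k b [ZMOD 2 * d])
      (fun a b => (((k b : ℚ) + k a) / 2) ^ 2), mul_assoc, ← pairProd_mul, expWeight]
  congr 1
  refine Finset.prod_congr rfl fun i _ => ?_
  have h3 := Nat.mod_lt (k i) (show 2 * d > 0 by omega)
  have h4 := h1 i
  congr 1
  · rw [expSign, h0]
    refine if_congr ?_ rfl rfl
    omega
  · rw [expSelf, if_neg (c := (k i : ℤ) % (2 * d) = 0) (by rw [h0]; exact_mod_cast h4)]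
    refine if_congr ?_ (by push_cast; rfl) rfl
    rw [Int.ModEq, h2]

/-- For the exponents `2k` modulo `2d`, the factors `a ^ 3 / 4` and `a` become `2 k ^ 3` and `2
k`. -/
theorem positiveWeight_eq_expWeight (hd : 0 < d) (k : Fin m → ℕ) :
    positiveWeight d k = expWeight d fun i => 2 * (k i : ℤ) := by
  have h0 : ∀ a : ℤ, (2 * a) % (2 * d) = 2 * (a % d) := fun a =>
    Int.mul_emod_mul_of_pos _ _ two_pos
  have h0' : ∀ i, ((k i : ℤ) % d) = ((k i % d : ℕ) : ℤ) := fun i => by push_cast; rfl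
  rw [positiveWeight, neg_one_pow_card_filter, Finset.prod_filter, Finset.prod_filter,
    ← Finset.prod_mul_distrib, ← Finset.prod_mul_distrib,
    prod_pairs (fun a b : Fin m => (k a : ℤ) ≡ k b [ZMOD d])
      (fun a b => ((k b : ℚ) - k a) ^ 2),
    prod_pairs (fun a b : Fin m => (k a : ℤ) ≡ -k b [ZMOD d])
      (fun a b => ((k a : ℚ) + k b) ^ 2), mul_assoc, ← pairProd_mul, expWeight]
  congr 1
  · refine Finset.prod_congr rfl fun i _ => ?_
    have h3 := Nat.mod_lt (k i) hd
    rw [mul_assoc]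
    congr 1
    · rw [expSign, h0, h0']
      refine if_congr ?_ rfl rfl
      rw [div_le_iff₀ two_pos]
      constructor
      · rintro ⟨h, -⟩
        have h' : d + 1 ≤ k i % d * 2 := by exact_mod_cast h
        omega
      · intro h
        refine ⟨?_, by omega⟩
        have h' : d + 1 ≤ k i % d * 2 := by omega
        exact_mod_cast h'
    · rw [expSelf, h0, h0']
      have e1 : ((k i : ℤ) ≡ 0 [ZMOD d]) ↔ k i % d = 0 := by
        rw [Int.ModEq, h0', Int.zero_emod]
        omega
      have e2 : (Even d ∧ (k i : ℤ) ≡ (d / 2 : ℕ) [ZMOD d]) ↔ 2 * (k i % d) = d := by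
        rw [Int.ModEq, h0', Int.emod_eq_of_lt (by omega) (by omega), Nat.even_iff]
        omega
      simp only [e1, e2]
      by_cases h4 : k i % d = 0
      · have h5 : ¬ (2 * (k i % d) = d) := by omega
        rw [if_pos h4, if_neg h5, if_neg (by omega), if_pos (by omega)]
        push_cast
        ring
      · by_cases h5 : 2 * (k i % d) = d
        · rw [if_neg h4, if_pos h5, if_pos (by omega)]
          push_cast
          ring
        · rw [if_neg h4, if_neg h5, if_neg (by omega), if_neg (by omega), mul_one]
  · refine pairProd_congr fun i j _ => ?_
    have h1 : ∀ a b : ℤ, 2 * (a % d) = 2 * (b % d) ↔ a % d = b % d := fun a b => by omega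
    simp only [expPair, Int.ModEq, ← mul_neg, h0, h1]
    congr 1
    · refine if_congr Iff.rfl ?_ rfl
      push_cast
      ring
    · refine if_congr Iff.rfl ?_ rfl
      push_cast
      ring

theorem isSim_iff_modEq {K L : Fin m → ℤ} : IsSim d K L ↔
    ∃ (σ : Equiv.Perm (Fin m)) (s : Fin m → ℤ), (∀ i, s i = 1 ∨ s i = -1) ∧
      ∀ i, K (σ i) ≡ s i * L i [ZMOD (2 * d)] := by
  refine exists_congr fun σ => exists_congr fun s => and_congr_right fun hs =>
    forall_congr' fun i => ?_
  change s i * K (σ i) ≡ L i [ZMOD (2 * d)] ↔ _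
  rcases hs i with h | h
  · simp [h]
  · rw [h, neg_one_mul, neg_one_mul, Int.modEq_iff_dvd, Int.modEq_iff_dvd, ← dvd_neg]
    ring_nf

theorem simeqMod_two_mul_iff {k : Fin m → ℕ} :
    SimeqMod (2 * d) k (fun i => 2 * (i : ℕ) + 1) ↔
      IsSim d (fun i => (k i : ℤ)) (baseExp 0 m) := by
  rw [isSim_iff_modEq, SimeqMod]
  simp only [baseExp]
  push_cast
  simp only [add_zero]

theorem simeqMod_iff {k : Fin m → ℕ} :
    SimeqMod d k (fun i => (i : ℕ) + 1) ↔ IsSim d (fun i => 2 * (k i : ℤ)) (baseExp 1 m) := by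
  rw [isSim_iff_modEq, SimeqMod]
  refine exists_congr fun σ => exists_congr fun s => and_congr_right fun hs =>
    forall_congr' fun i => ?_
  rw [Int.modEq_iff_dvd, Int.modEq_iff_dvd, baseExp,
    ← mul_dvd_mul_iff_left (two_ne_zero' ℤ) (b := (d : ℤ))]
  push_cast
  ring_nf

open Classical in
/-- A sum over pairs of tuples as a coefficient of the generating function of the weights. -/
theorem sum_eq_coeff_gf {α β ε N : ℕ} (hα : 0 < α) (hβ : 0 < β) (e : ℕ → ℤ)
    (heq : ∀ n, e (α * n + β) = 2 * (n : ℤ) + 1 + ε) {T : Set ((Fin m → ℕ) × (Fin m → ℕ))}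
    (hT : T.Finite) (hTiff : ∀ p, p ∈ T ↔ ∑ i, p.1 i * p.2 i = N ∧
      (∀ i, ∃ n, p.1 i = α * n + β) ∧ (∀ i, Odd (p.2 i)) ∧
        IsSim d (fun i => e (p.1 i)) (baseExp ε m))
    {wt : (Fin m → ℕ) → ℚ} (hwt : ∀ p ∈ T, wt p.1 = expWeight d fun i => e (p.1 i)) :
    ((∑ p ∈ hT.toFinset, wt p.1 : ℚ) : ℂ) = PowerSeries.coeff N
      (gf (fun s : Fin m → ℕ × ℕ => ∑ i, (α * (s i).1 + β) * (2 * (s i).2 + 1)) fun s =>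
        if IsSim d (fun i => 2 * ((s i).1 : ℤ) + 1 + ε) (baseExp ε m) then
          ((expWeight d fun i => 2 * ((s i).1 : ℤ) + 1 + ε : ℚ) : ℂ) else 0) := by
  have hfin := (finFib_mul_oddLambert hα hβ).pi m
  rw [coeff_gf_eq_sum _ (hfin N).toFinset fun s hs => by simp [hs], ← Finset.sum_filter,
    Rat.cast_sum]
  symm
  refine Finset.sum_bij (fun s _ => (fun i => α * (s i).1 + β, fun i => 2 * (s i).2 + 1))
    ?_ ?_ ?_ ?_
  · intro s hs
    simp only [Finset.mem_filter] at hs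
    rw [Set.Finite.mem_toFinset, hTiff]
    refine ⟨hs.1.2, fun i => ⟨_, rfl⟩, fun i => ⟨_, rfl⟩, ?_⟩
    simp only [heq]
    exact hs.2
  · intro s _ t _ h
    obtain ⟨h1, h2⟩ := Prod.mk.inj h
    funext i
    refine Prod.ext ?_ ?_
    · exact Nat.eq_of_mul_eq_mul_left hα (Nat.add_right_cancel (congrFun h1 i))
    · have := congrFun h2 i
      omega
  · intro p hp
    rw [Set.Finite.mem_toFinset, hTiff] at hp
    obtain ⟨h1, h2, h3, h4⟩ := hp
    choose a ha using h2
    choose b hb using h3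
    refine ⟨fun i => (a i, b i), ?_, ?_⟩
    · simp only [Finset.mem_filter, Set.Finite.mem_toFinset]
      have h5 : ∑ i, (α * a i + β) * (2 * b i + 1) = N := by
        simp only [← ha, ← hb]
        exact h1
      refine ⟨⟨h5.le, h5⟩, ?_⟩
      simp only [ha, heq] at h4
      exact h4
    · simp only [← ha, ← hb]
  · intro s hs
    simp only [Finset.mem_filter] at hs
    rw [hwt]
    · simp only [heq]
    · rw [hTiff]
      refine ⟨hs.1.2, fun i => ⟨_, rfl⟩, fun i => ⟨_, rfl⟩, ?_⟩
      simp only [heq]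
      exact hs.2

end translation

/-! ### Evaluation of the sums -/

section identities

variable {d m n : ℕ}

theorem oddSum_eq (hd : 0 < d) (hN : 2 * m = d * n) (x : ℕ) :
    oddSum m d x = (m.factorial : ℚ) * expWeight d (baseExp 0 m) *
      triangleCountDiv (n * (2 * m)) x (2 * d) := by
  have h1 := sum_eq_coeff_gf (d := d) (m := m) (α := 2) (β := 1) (ε := 0) (N := m ^ 2 + x) two_pos
    one_pos (fun k => (k : ℤ)) (fun n => by push_cast; ring) (finite_oddSolutions m d (m ^ 2 + x))
    (fun p => by
      rw [oddSolutions, Set.mem_ofPred_eq, simeqMod_two_mul_iff]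
      rfl)
    (fun p hp => oddWeight_eq_expWeight hd hp.2.1)
  rw [gf_expWeight_odd hd hN, mul_assoc, PowerSeries.coeff_C_mul, PowerSeries.coeff_X_pow_mul',
    if_pos (Nat.le_add_right _ _), Nat.add_sub_cancel_left, coeff_psi_pow (by omega)] at h1
  rw [oddSum]
  exact_mod_cast h1

theorem positiveSum_eq_coeff (hd : 0 < d) (x : ℕ) {E : ℕ} {c : ℚ} {f : PowerSeries ℂ}
    (hf : f = PowerSeries.C (c : ℂ) * PowerSeries.X ^ (m * (m + 1) / 2) * psi d ^ E)
    (h : ((positiveSum m d x : ℚ) : ℂ) = PowerSeries.coeff (m * (m + 1) / 2 + x) f) :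
    positiveSum m d x = c * triangleCountDiv E x d := by
  rw [hf, mul_assoc, PowerSeries.coeff_C_mul, PowerSeries.coeff_X_pow_mul',
    if_pos (Nat.le_add_right _ _), Nat.add_sub_cancel_left, coeff_psi_pow hd] at h
  exact_mod_cast h

open Classical in
theorem positiveSum_eq_coeff_gf (hd : 0 < d) (x : ℕ) :
    ((positiveSum m d x : ℚ) : ℂ) = PowerSeries.coeff (m * (m + 1) / 2 + x)
      (gf (fun s : Fin m → ℕ × ℕ => ∑ i, (1 * (s i).1 + 1) * (2 * (s i).2 + 1)) fun s =>
        if IsSim d (fun i => 2 * ((s i).1 : ℤ) + 1 + (1 : ℕ)) (baseExp 1 m) then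
          ((expWeight d fun i => 2 * ((s i).1 : ℤ) + 1 + (1 : ℕ) : ℚ) : ℂ) else 0) := by
  refine sum_eq_coeff_gf one_pos one_pos (fun k => 2 * (k : ℤ)) (fun n => by push_cast; ring)
    (finite_positiveSolutions m d (m * (m + 1) / 2 + x)) (fun p => ?_)
    fun p hp => positiveWeight_eq_expWeight hd p.1
  rw [positiveSolutions, Set.mem_ofPred_eq, simeqMod_iff]
  refine and_congr_right fun _ => and_congr_left fun _ => forall_congr' fun i => ?_
  exact ⟨fun h => ⟨p.1 i - 1, by omega⟩, fun ⟨n, hn⟩ => by omega⟩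

theorem positiveSum_eq (hd : 0 < d) (hN : 2 * m = d * n) (x : ℕ) :
    positiveSum m d x = (m.factorial : ℚ) * expWeight d (baseExp 1 m) *
      triangleCountDiv (n * (2 * m + 2)) x d :=
  positiveSum_eq_coeff hd x
    ((gf_expWeight_even hd hN).trans (by push_cast; rfl)) (positiveSum_eq_coeff_gf hd x)

theorem positiveSum_eq' (hd : 0 < d) (hN : 2 * m + 2 = d * n) (x : ℕ) :
    positiveSum m d x = (m.factorial : ℚ) * expWeight d (baseExp 1 m) *
      triangleCountDiv (n * (2 * m)) x d :=
  positiveSum_eq_coeff hd x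
    ((gf_expWeight_even' hd hN).trans (by push_cast; rfl)) (positiveSum_eq_coeff_gf hd x)

theorem mul_sub_one_div (hd : 0 < d) (n : ℕ) : (d * n - d) / d = n - 1 := by
  rw [← Nat.mul_sub_one, Nat.mul_div_cancel_left _ hd]

theorem sub_mul_div (hd : 0 < d) (n m : ℕ) : (d * n - d) * m / d = m * (n - 1) := by
  rw [← Nat.mul_sub_one, mul_assoc, Nat.mul_div_cancel_left _ hd, mul_comm]

/-- The exponent of `d`; for `m = 0` the truncated subtraction is harmless. -/
theorem add_two_sub_mul_div (hd : 0 < d) (hn : 2 * m = d * n) :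
    (d * n + 2 - d) * m / d = m * (n - 1) + n := by
  rcases n with _ | n
  · obtain rfl : m = 0 := by omega
    simp
  · have h1 : d * (n + 1) + 2 - d = d * n + 2 := by rw [mul_add_one]; omega
    rw [h1, show (d * n + 2) * m = d * n * m + 2 * m by ring, hn,
      show d * n * m + d * (n + 1) = d * (m * n + (n + 1)) by ring,
      Nat.mul_div_cancel_left _ hd, Nat.add_sub_cancel]

end identities

theorem mainTheorem1 (d m x : ℕ) (hd : 0 < d) :
    (d ∣ 2 * m →
      oddSum m d x =
        (-1 : ℚ) ^ (d.choose 2 * (2 * m / d).choose 2) *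
          (d : ℚ) ^ ((2 * m - d) * m / d) * (m.factorial : ℚ) *
          (∏ l ∈ Finset.Icc 1 ((2 * m - d) / d), (l.factorial : ℚ) ^ d) *
          (triangleCountDiv (4 * m ^ 2 / d) x (2 * d) : ℚ)) ∧
    (d ∣ 2 * m →
      positiveSum m d x =
        ((-1 : ℚ) ^ ((d - 1).choose 2 * (2 * m / d).choose 2) *
          ((2 * m / d).factorial : ℚ) *
          (∏ l ∈ Finset.Icc 1 ((2 * m - d) / d), (l.factorial : ℚ) ^ d)) *
          (d : ℚ) ^ ((2 * m + 2 - d) * m / d) * (m.factorial : ℚ) *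
          (triangleCountDiv (4 * m * (m + 1) / d) x d : ℚ)) ∧
    (d ∣ 2 * m + 2 →
      positiveSum m d x =
        ((-1 : ℚ) ^ ((d - 1).choose 2 * (2 * (m + 1) / d).choose 2) *
          (((2 * m + 2 - d) / d).factorial : ℚ)⁻¹ *
          (∏ l ∈ Finset.Icc 1 ((2 * m + 2 - d) / d), (l.factorial : ℚ) ^ d)) *
          (d : ℚ) ^ ((2 * m + 2 - d) * m / d) * (m.factorial : ℚ) *
          (triangleCountDiv (4 * m * (m + 1) / d) x d : ℚ)) := by
  refine ⟨fun h => ?_, fun h => ?_, fun h => ?_⟩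
  · obtain ⟨n, hn⟩ := h
    rw [oddSum_eq hd hn, expWeight_baseExp_odd hd hn.symm, hn, Nat.mul_div_cancel_left _ hd,
      mul_sub_one_div hd, show 4 * m ^ 2 = 2 * m * (2 * m) by ring, hn, mul_assoc d n,
      Nat.mul_div_cancel_left _ hd, sub_mul_div hd]
    ring
  · obtain ⟨n, hn⟩ := h
    rw [positiveSum_eq hd hn, expWeight_baseExp_even hd hn.symm, hn, Nat.mul_div_cancel_left _ hd,
      mul_sub_one_div hd, show 4 * m * (m + 1) = 2 * m * (2 * m + 2) by ring, hn,
      mul_assoc d n, Nat.mul_div_cancel_left _ hd, add_two_sub_mul_div hd hn, pow_add]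
    ring
  · obtain ⟨n, hn⟩ := h
    have hn' : 2 * (m + 1) = d * n := by rw [← hn]; ring
    have h1 := expWeight_baseExp_even' hd hn'.symm
    have hd' : (d : ℚ) ≠ 0 := by exact_mod_cast hd.ne'
    have hf : ((n - 1).factorial : ℚ) ≠ 0 := by exact_mod_cast (n - 1).factorial_ne_zero
    rw [← eq_div_iff (mul_ne_zero (pow_ne_zero _ hd') hf), add_one_mul m, pow_add] at h1
    rw [positiveSum_eq' hd hn, h1, hn', hn, Nat.mul_div_cancel_left _ hd, mul_sub_one_div hd,
      show 4 * m * (m + 1) = (2 * (m + 1)) * (2 * m) by ring, hn', mul_assoc d n,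
      Nat.mul_div_cancel_left _ hd, sub_mul_div hd]
    field_simp
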